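/- **Definitions.** A *weighted counting problem* in $\#\mathrm{P}_{\mathbb R}$ is a function $f:\{0,1\}^\star\to\mathbb R$ of the form $f(x)=\sum_{u\in\{0,1\}^{p(|x|)}}w(x,u)$, where $p$ is a polynomial with natural coefficients and $w:\{0,1\}^\star\times\{0,1\}^\star\to\mathbb R$ is *efficiently approximable*: there is a function $v:\{0,1\}^\star\times\{0,1\}^\star\times\mathbb N\to\mathbb Z$, computable by a Turing machine in time polynomial in $|x|$, $|u|$ and $b$, such that $|w(x,u)-v(x,u,b)/2^b|\le 2^{-b}$ for all $x,u,b$. A *quantum Turing machine* $M$ has a finite set $Q$ of states with an initial state and a set of final states, a finite tape alphabet $\Gamma$ containing a blank and the two input bits, one two-way infinite tape, and for each state, scanned symbol and move $m=(q',\sigma',d)\in Q\times\Gamma\times\{-1,0,1\}$ (new state, written symbol, head shift) a complex transition amplitude. The real and imaginary parts of the amplitudes can be computed to within $2^{-b}$ in time polynomial in $b$, and the induced time evolution preserves the $\ell^2$ norm of superpositions of non-final configurations. Before each step it is measured whether $M$ has halted (is in a final state) and, if not, the value of an observable with finitely many values that is a given function of the state and the scanned symbol (a constant function means that nothing else is measured);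 the superposition collapses accordingly, is renormalized, and the next step is applied to it. Whether a final configuration is accepting is determined by its state and scanned symbol. The acceptance probability of $M$ on $x$ is the probability that $M$, started on $x$, eventually halts in an accepting configuration. $M$ runs in *polynomial time* $t$, for a polynomial $t$ with natural coefficients, if on every input $x$ it halts with probability $1$ after at most $t(|x|)$ steps. A *path* on input $x$ is a sequence of at most $t(|x|)$ moves, starting from the initial configuration on $x$; its amplitude $a_p$ is the product of the amplitudes of its moves. Two paths $p_1,p_2$ are *compatible*, $p_1\sim p_2$, if both reach a final configuration exactly at their end, they end in the same accepting configuration, and they have the same results of all intermediate measurements (in particular the same length). **Theorem.** Let $M$ be a quantum Turing machine that runs in polynomial time $t$. Then the function $x\mapsto\Pr(M\text{ accepts }x)$ belongs to $\#\mathrm{P}_{\mathbb R}$. More precisely, for all $x\in\{0,1\}^\star$, $$\Pr(M\text{ accepts }x)=\sum_{p_1,p_2}W_x(p_1,p_2),\qquad W_x(p_1,p_2)=\begin{cases}\operatorname{Re}\bigl(a_{p_1}\overline{a_{p_2}}\bigr)&\text{if }p_1\sim p_2,\\0&\text{otherwise,}\end{cases}$$ where the sum is over all pairs of paths on $x$,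 and there are $k\in\mathbb N$ and an injective code of the moves by bit strings of length $k$ such that the following holds. Encode a path $m_1\dots m_s$ on $x$ by the bit string $1\,\mathrm{code}(m_1)\cdots 1\,\mathrm{code}(m_s)\,0\cdots0$ of length $(k+1)\,t(|x|)$, and a pair of paths by the concatenation of their codes, of length $p(|x|)$ with $p=2(k+1)t$. Then $x\mapsto\Pr(M\text{ accepts }x)$ is the weighted counting problem associated with $p$ and some efficiently approximable $w$ such that, for $u\in\{0,1\}^{p(|x|)}$, $w(x,u)=W_x(p_1,p_2)$ if $u$ encodes the pair $(p_1,p_2)$ of paths on $x$, and $w(x,u)=0$ if $u$ encodes no such pair. -/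

import Mathlib

open Computability Turing

/-! ## Weighted counting problems -/

/-- Binary encoding of the integers: a sign bit followed by the binary digits of `|z|`. -/
def encodingInt : Encoding ℤ Bool where
  encode z := decide (z < 0) :: encodeNat z.natAbs
  decode l := match l with
    | [] => none
    | s :: l => some (if s = true then -(decodeNat l : ℤ) else (decodeNat l : ℤ))
  decode_encode z := by
    by_cases h : z < 0
    · simp [h, abs_of_neg h]
    · simp [h, abs_of_nonneg (not_lt.mp h)]

/-- Encoding of a triple `(x, u, b)`, the number `b` being written in unary, so that the length of
the code is `|x| + |u| + b`. -/
def encodingTriple : Encoding (List Bool × List Bool × ℕ) (Bool ⊕ (Bool ⊕ Bool)) :=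
  encodingProd (encodingList Bool) (encodingProd (encodingList Bool) unaryEncodingNat)

/-- A weight function `w : {0,1}* × {0,1}* → ℝ` that can be approximated to within `2^{-b}` by the
dyadic number `v(x, u, b) / 2^b`, where the integer `v(x, u, b)` is computed by a Turing machine in
time polynomial in `|x|`, `|u|` and `b`. -/
def EfficientlyApproximable (w : List Bool → List Bool → ℝ) : Prop :=
  ∃ v : List Bool × List Bool × ℕ → ℤ,
    Nonempty (TM2ComputableInPolyTime encodingTriple.encode encodingInt.encode v) ∧
    ∀ (x u : List Bool) (b : ℕ), |w x u - (v (x, u, b) : ℝ) / 2 ^ b| ≤ 1 / 2 ^ b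

/-- `f` is the weighted counting problem associated with the polynomial `p` and the weight function
`w`, whose values lie in `S`: `f x` is the sum of `w x u` over all `u ∈ {0,1}^{p(|x|)}`. -/
def IsWeightedCountingProblem (S : Set ℝ) (p : Polynomial ℕ) (w : List Bool → List Bool → ℝ)
    (f : List Bool → ℝ) : Prop :=
  EfficientlyApproximable w ∧ (∀ x u, w x u ∈ S) ∧
    ∀ x, f x = ∑ u : Fin (p.eval x.length) → Bool, w x (List.ofFn u)

/-- The class `#P_S` of weighted counting problems with weights in `S`. -/
def SharpP (S : Set ℝ) : Set (List Bool → ℝ) :=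
  {f | ∃ p w, IsWeightedCountingProblem S p w f}

/-! ## Quantum Turing machines -/

/-- A real number whose dyadic approximations to within `2^{-b}` can be computed in time polynomial
in `b`. -/
def EfficientReal (a : ℝ) : Prop :=
  ∃ v : ℕ → ℤ,
    Nonempty (TM2ComputableInPolyTime unaryEncodingNat.encode encodingInt.encode v) ∧
    ∀ b : ℕ, |a - (v b : ℝ) / 2 ^ b| ≤ 1 / 2 ^ b

/-- The data of a quantum Turing machine with control states `Q`, tape alphabet `Γ` and results
`R` of intermediate measurements. A move `(q, s, d)` enters the state `q`, writes the symbol `s`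
into the scanned cell and then shifts the head by `d ∈ {-1, 0, 1}`. -/
structure QuantumTM (Q Γ R : Type) where
  /-- the symbols for the blank (`none`) and for the input bits -/
  symbol : Option Bool ↪ Γ
  /-- the initial state -/
  start : Q
  /-- the final (halting) states -/
  final : Q → Bool
  /-- for a final configuration: is it accepting, given its state and scanned symbol? -/
  accept : Q → Γ → Bool
  /-- the transition amplitude of each move, given the current state and scanned symbol -/
  amplitude : Q → Γ → Q × Γ × SignType → ℂ
  /-- the observable, a function of state and scanned symbol, measured between the steps; where it
  is constant, nothing is measured -/
  outcome : Q → Γ → R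

/-- A configuration: the state, the position of the head and the contents of the two-way infinite
tape. -/
@[ext]
structure QCfg (Q Γ : Type) where
  /-- the control state -/
  state : Q
  /-- the position of the head -/
  head : ℤ
  /-- the contents of the tape -/
  tape : ℤ → Γ

namespace QCfg

variable {Q Γ : Type}

/-- The symbol in the scanned cell. -/
def scanned (c : QCfg Q Γ) : Γ := c.tape c.head

/-- The configuration reached by a move. -/
def move (c : QCfg Q Γ) (m : Q × Γ × SignType) : QCfg Q Γ where
  state := m.1
  head := c.head + (m.2.2 : ℤ)
  tape := Function.update c.tape c.head m.2.1

end QCfg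

/-- The squared norm of a superposition of configurations. -/
noncomputable def superNormSq {Q Γ : Type} (ψ : QCfg Q Γ →₀ ℂ) : ℝ := ψ.sum fun _ a => ‖a‖ ^ 2

namespace QuantumTM

variable {Q Γ R : Type}

/-- The initial configuration: the input is written in the cells `0, …, |x| - 1`, all other cells
are blank, and the head scans the cell `0`. -/
def init (M : QuantumTM Q Γ R) (x : List Bool) : QCfg Q Γ where
  state := M.start
  head := 0
  tape i := M.symbol (if 0 ≤ i then x[i.toNat]? else none)

/-- A final configuration. -/
def IsFinal (M : QuantumTM Q Γ R) (c : QCfg Q Γ) : Prop := M.final c.state = true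

/-- An accepting (final) configuration. -/
def IsAccepting (M : QuantumTM Q Γ R) (c : QCfg Q Γ) : Prop :=
  M.IsFinal c ∧ M.accept c.state c.scanned = true

/-- The time evolution of superpositions: the linear extension of
`c ↦ ∑ m, amplitude(c, m) • (c after the move m)`. -/
noncomputable def evolve [Fintype Q] [Fintype Γ] (M : QuantumTM Q Γ R) (ψ : QCfg Q Γ →₀ ℂ) :
    QCfg Q Γ →₀ ℂ :=
  ψ.sum fun c a => ∑ m : Q × Γ × SignType,
    Finsupp.single (c.move m) (a * M.amplitude c.state c.scanned m)

/-- The time evolution preserves the `ℓ²` norm (of superpositions of non-final configurations: the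
evolution is never applied to a final one). -/
def WellFormed [Fintype Q] [Fintype Γ] (M : QuantumTM Q Γ R) : Prop :=
  ∀ ψ : QCfg Q Γ →₀ ℂ, (∀ c ∈ ψ.support, ¬ M.IsFinal c) →
    superNormSq (M.evolve ψ) = superNormSq ψ

/-- The real and imaginary parts of all transition amplitudes are computable to within `2^{-b}` in
time polynomial in `b`. -/
def HasEfficientAmplitudes (M : QuantumTM Q Γ R) : Prop :=
  ∀ q s m, EfficientReal (M.amplitude q s m).re ∧ EfficientReal (M.amplitude q s m).im

open Classical in
/-- The part of a superposition that is compatible with the machine not having halted and the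
measured observable having the value `r`. -/
noncomputable def project (M : QuantumTM Q Γ R) (r : R) (ψ : QCfg Q Γ →₀ ℂ) : QCfg Q Γ →₀ ℂ :=
  ψ.filter fun c => ¬ M.IsFinal c ∧ M.outcome c.state c.scanned = r

/-- The (renormalized) superposition after the result `r` has been measured. -/
noncomputable def collapse (M : QuantumTM Q Γ R) (r : R) (ψ : QCfg Q Γ →₀ ℂ) : QCfg Q Γ →₀ ℂ :=
  (((Real.sqrt (superNormSq (M.project r ψ)))⁻¹ : ℝ) : ℂ) • M.project r ψ

open Classical in
/-- The probability that the machine, started in the (normalized) superposition `ψ`, halts after at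
most `n` steps and is then found in a configuration satisfying `F`. Between the steps it is
measured whether the machine has halted and, if not, which value the observable `outcome` has; then
the superposition collapses and the next step is applied to it. -/
noncomputable def haltProbWith [Fintype Q] [Fintype Γ] [Fintype R] (M : QuantumTM Q Γ R)
    (F : QCfg Q Γ → Prop) : ℕ → (QCfg Q Γ →₀ ℂ) → ℝ
  | 0, ψ => superNormSq (ψ.filter fun c => M.IsFinal c ∧ F c)
  | n + 1, ψ => superNormSq (ψ.filter fun c => M.IsFinal c ∧ F c) +
      ∑ r : R, superNormSq (M.project r ψ) * haltProbWith M F n (M.evolve (M.collapse r ψ))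

/-- On every input `x`, the machine halts with certainty after at most `t(|x|)` steps. -/
def HaltsInTime [Fintype Q] [Fintype Γ] [Fintype R] (M : QuantumTM Q Γ R) (t : Polynomial ℕ) :
    Prop :=
  ∀ x : List Bool,
    M.haltProbWith (fun _ => True) (t.eval x.length) (Finsupp.single (M.init x) 1) = 1

/-- The acceptance probability: the probability that the machine halts, after any number of steps,
in an accepting configuration. -/
noncomputable def acceptanceProbability [Fintype Q] [Fintype Γ] [Fintype R]
    (M : QuantumTM Q Γ R) (x : List Bool) : ℝ :=
  ⨆ n : ℕ, M.haltProbWith M.IsAccepting n (Finsupp.single (M.init x) 1)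

/-! ### Computational paths -/

/-- The configuration reached from `c` by a sequence of moves. -/
def endCfg (c : QCfg Q Γ) (l : List (Q × Γ × SignType)) : QCfg Q Γ := l.foldl QCfg.move c

/-- The amplitude of a path from `c`: the product of its transition amplitudes. -/
def pathAmplitude (M : QuantumTM Q Γ R) :
    QCfg Q Γ → List (Q × Γ × SignType) → ℂ
  | _, [] => 1
  | c, m :: l => M.amplitude c.state c.scanned m * pathAmplitude M (c.move m) l

/-- The results of the intermediate measurements along a path from `c`. -/
def pathOutcomes (M : QuantumTM Q Γ R) : QCfg Q Γ → List (Q × Γ × SignType) → List R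
  | _, [] => []
  | c, m :: l => M.outcome c.state c.scanned :: pathOutcomes M (c.move m) l

/-- No configuration of the path before the last one is final. -/
def RunsUntilEnd (M : QuantumTM Q Γ R) : QCfg Q Γ → List (Q × Γ × SignType) → Prop
  | _, [] => True
  | c, m :: l => ¬ M.IsFinal c ∧ RunsUntilEnd M (c.move m) l

/-- A computational path from `c` that halts in an accepting configuration. -/
def IsAcceptingPath (M : QuantumTM Q Γ R) (c : QCfg Q Γ) (l : List (Q × Γ × SignType)) : Prop :=
  M.RunsUntilEnd c l ∧ M.IsAccepting (endCfg c l)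

/-- Two paths from `c` are compatible if they halt in the same accepting configuration and have the
same results of the intermediate measurements (in particular, as it is measured between the steps
whether the machine has halted, the same number of steps). -/
def Compatible (M : QuantumTM Q Γ R) (c : QCfg Q Γ) (l₁ l₂ : List (Q × Γ × SignType)) : Prop :=
  M.IsAcceptingPath c l₁ ∧ M.IsAcceptingPath c l₂ ∧ endCfg c l₁ = endCfg c l₂ ∧
    M.pathOutcomes c l₁ = M.pathOutcomes c l₂

open Classical in
/-- The weight of a pair of paths. -/
noncomputable def pairWeight (M : QuantumTM Q Γ R) (x : List Bool)
    (l₁ l₂ : List (Q × Γ × SignType)) : ℝ :=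
  if M.Compatible (M.init x) l₁ l₂ then
    (M.pathAmplitude (M.init x) l₁ * starRingEnd ℂ (M.pathAmplitude (M.init x) l₂)).re
  else 0

end QuantumTM

/-- The sequences of at most `T` moves. -/
abbrev QPath (Q Γ : Type) (T : ℕ) : Type := (n : Fin (T + 1)) × (Fin n → Q × Γ × SignType)

namespace QPath

variable {Q Γ : Type} {T : ℕ}

/-- The list of the moves of a path. -/
def moves (P : QPath Q Γ T) : List (Q × Γ × SignType) := List.ofFn P.2

/-- A path of at most `T` moves as a bit string of length `(k + 1) * T`, given a code with
code words of length `k` for the moves: each move contributes `1` followed by its code word, and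
the rest is filled up with `0`. -/
def toBits (k : ℕ) (code : Q × Γ × SignType → List Bool) (P : QPath Q Γ T) : List Bool :=
  P.moves.flatMap (fun m => true :: code m) ++ List.replicate ((k + 1) * (T - P.1)) false

end QPath

/-! Two things have to be shown: the formula for the acceptance probability, and the efficient
approximability of the weights in it.

The formula. Renormalization divides a superposition by its norm, while the probability of the
measured result is the square of this norm. Since halting probabilities are quadratic in the
superposition, the two factors cancel (`haltProbWith_eq_haltWeight`), and the unnormalized
projections may be followed instead. The probability of halting within `n` steps in a configuration
of a given kind is then a sum of squared norms. The coefficient of a configuration is the sum of the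
amplitudes of the paths that lead to it, so its squared modulus is a double sum over pairs of paths
with the same end; the projections leave only pairs with equal results of measurement, hence of
equal length (`haltWeight_sum`). The total is real, so only the real parts of the terms matter. The
supremum over `n` is attained at `t(|x|)`: the total weight of halting never exceeds 1 and has
reached 1 there, so nothing can be added later (`haltWeight_le_of_halts`).

Approximability. To decode a pair of paths, to simulate both and to compare the results is a
discrete computation on a window of the tape that `t(|x|)` moves cannot leave. The weight itself is
the real part of a product of at most `2T` numbers, where `T = t(|x|)`. They have modulus at most 1,
because the evolution preserves the norm of non-final configurations (`norm_amplitude_le`). If each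
is known up to `2 / 2 ^ n`, then the product is known up to `2 ^ (2T) * (2 / 2 ^ n)`
(`norm_prod_sub_prod_le`). With `n = b + 2T + 2` this is half of the permitted error `1 / 2 ^ b`,
and the other half pays for rounding to an integer (`abs_pairWeight_sub_le`).

Machines. That all this takes polynomial time must be proved for stack machines. The programs `Prog`
serve as an intermediate language. They are compiled to stack machines step by step (`Run.steps`,
`polyTime_of_run`); conversely, the machines that approximate the transition amplitudes are
simulated by programs (`PolyTime.of_stackMachine`). In between, the class `PolyTime` is closed under
composition, pairing, case distinction and iteration with polynomially bounded intermediate results,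
and list operations, binary arithmetic and the simulation of paths are built from these.

Finally, the code of pairs of paths can be decoded, and the weight is zero on bit strings that are
no codes, so the sum over bit strings is the sum over pairs of paths (`sum_bitWeight`). -/

/-! ## Programs on stacks -/

/-- Programs that operate on stacks of natural numbers; the stacks are numbered, too. -/
inductive Prog
  | skip
  | push (v a : ℕ)
  | seq (P Q : Prog)
  | pop (v : ℕ) (P : Option ℕ → Prog)
  | loop (v : ℕ) (P : ℕ → Prog)

/-- The contents of the stacks. -/
abbrev Store := ℕ → List ℕ

namespace Prog

open Function

/-- `Run P s s' c`: started in `s`, the program `P` halts in `s'` after `c` steps. -/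
inductive Run : Prog → Store → Store → ℕ → Prop
  | skip (s) : Run skip s s 1
  | push (v a s) : Run (push v a) s (update s v (a :: s v)) 1
  | seq {P Q s s' s'' c d} : Run P s s' c → Run Q s' s'' d → Run (seq P Q) s s'' (c + d)
  | pop {v P s s' c} : Run (P (s v).head?) (update s v (s v).tail) s' c →
      Run (pop v P) s s' (c + 1)
  | loop_nil {v P s} : s v = [] → Run (loop v P) s s 1
  | loop_cons {v P s a l s' s'' c d} : s v = a :: l → Run (P a) (update s v l) s' c →
      Run (loop v P) s' s'' d → Run (loop v P) s s'' (c + d + 1)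

/-- All stacks and symbols that occur in a program are bounded by `N`, except for symbols that
have been read before. -/
def Bdd : Prog → ℕ → Prop
  | skip, _ => True
  | push v a, N => v < N ∧ a < N
  | seq P Q, N => P.Bdd N ∧ Q.Bdd N
  | pop v P, N => v < N ∧ (P none).Bdd N ∧ ∀ a, (P (some a)).Bdd (max N (a + 1))
  | loop v P, N => v < N ∧ ∀ a, (P a).Bdd (max N (a + 1))

theorem Bdd.mono {P : Prog} {N M : ℕ} (h : P.Bdd N) (hNM : N ≤ M) : P.Bdd M := by
  induction P generalizing N M with
  | skip => trivial
  | push v a => exact ⟨h.1.trans_le hNM, h.2.trans_le hNM⟩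
  | seq P Q hP hQ => exact ⟨hP h.1 hNM, hQ h.2 hNM⟩
  | pop v P ih =>
    exact ⟨h.1.trans_le hNM, ih _ h.2.1 hNM, fun a => ih _ (h.2.2 a) (max_le_max_right _ hNM)⟩
  | loop v P ih => exact ⟨h.1.trans_le hNM, fun a => ih _ (h.2 a) (max_le_max_right _ hNM)⟩

/-- A step pushes at most one symbol. This is why results of polynomial time computations have
polynomial length. -/
theorem Run.length_le {P : Prog} {s s' : Store} {c : ℕ} (h : Run P s s' c) (v : ℕ) :
    (s' v).length ≤ (s v).length + c := by
  induction h with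
  | skip => omega
  | push w a s =>
    by_cases hv : v = w
    · subst hv; simp
    · simp [hv]
  | seq _ _ h₁ h₂ => omega
  | @pop w P s s' c _ ih =>
    by_cases hv : v = w
    · subst hv; simp at ih; omega
    · simp [hv] at ih; omega
  | loop_nil => omega
  | @loop_cons w P s a l s' s'' c d hs _ _ h₁ h₂ =>
    by_cases hv : v = w
    · subst hv; simp [hs] at *; omega
    · simp [hv] at *; omega

/-! ### Compilation to stack machines -/

/-- The labels of the compiled program. -/
def Lab (N : ℕ) : Prog → Type
  | skip => Unit
  | push _ _ => Unit
  | seq P Q => Lab N P ⊕ Lab N Q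
  | pop _ P => Unit ⊕ (o : Option (Fin N)) × Lab N (P (o.map Fin.val))
  | loop _ P => Unit ⊕ (a : Fin N) × Lab N (P a)

-- A program may branch over all natural numbers. Labels exist only for the branches that belong to
-- symbols below `N`, and this makes them finite in number.
set_option linter.unusedVariables false in
noncomputable instance Lab.fintype (N : ℕ) : (P : Prog) → Fintype (Lab N P)
  | skip => inferInstanceAs (Fintype Unit)
  | push _ _ => inferInstanceAs (Fintype Unit)
  | seq P Q =>
    have := Lab.fintype N P
    have := Lab.fintype N Q
    inferInstanceAs (Fintype (Lab N P ⊕ Lab N Q))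
  | pop _ P =>
    have := fun o => Lab.fintype N (P o)
    inferInstanceAs (Fintype (Unit ⊕ (o : Option (Fin N)) × Lab N (P (o.map Fin.val))))
  | loop _ P =>
    have := fun o => Lab.fintype N (P o)
    inferInstanceAs (Fintype (Unit ⊕ (a : Fin N) × Lab N (P a)))

/-- The label at which the compiled program starts. -/
def entry (N : ℕ) : (P : Prog) → Lab N P
  | skip => ()
  | push _ _ => ()
  | seq P _ => Sum.inl (entry N P)
  | pop _ _ => Sum.inl ()
  | loop _ _ => Sum.inl ()

section compile

/-- The alphabets of a machine with `N` working stacks and two further stacks for the input and the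
output. -/
def stackAlphabet (N : ℕ) (α β : Type) : Fin N ⊕ Bool → Type
  | Sum.inl _ => Fin N
  | Sum.inr false => α
  | Sum.inr true => β

variable {N : ℕ} {α β Λ : Type}

/-- The statements of the compiled program, given the embedding `j` of its labels into those of the
whole machine and the label `next` at which the machine continues. -/
def code (N : ℕ) [NeZero N] (α β : Type) {Λ : Type} : (P : Prog) → (Lab N P → Λ) → Λ → Lab N P →
    TM2.Stmt (stackAlphabet N α β) Λ (Option (Fin N))
  | skip, _, next, _ => .goto fun _ => next
  | push v a, _, next, _ =>
    .push (Sum.inl (Fin.ofNat N v)) (fun _ => Fin.ofNat N a) (.goto fun _ => next)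
  | seq P Q, j, _, Sum.inl l =>
    code N α β P (fun l => j (Sum.inl l)) (j (Sum.inr (entry N Q))) l
  | seq _ Q, j, next, Sum.inr l => code N α β Q (fun l => j (Sum.inr l)) next l
  | pop v P, j, _, Sum.inl _ =>
    .pop (Sum.inl (Fin.ofNat N v)) (fun _ o => o)
      (.goto fun o => j (Sum.inr ⟨o, entry N (P (o.map Fin.val))⟩))
  | pop _ P, j, next, Sum.inr ⟨o, l⟩ =>
    code N α β (P (o.map Fin.val)) (fun l => j (Sum.inr ⟨o, l⟩)) next l
  | loop v P, j, next, Sum.inl _ =>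
    .pop (Sum.inl (Fin.ofNat N v)) (fun _ o => o)
      (.goto fun o => o.elim next fun a => j (Sum.inr ⟨a, entry N (P a)⟩))
  | loop _ P, j, _, Sum.inr ⟨a, l⟩ =>
    code N α β (P a) (fun l => j (Sum.inr ⟨a, l⟩)) (j (Sum.inl ())) l

/-- The working stack `i` of the machine. -/
def work (S : ∀ k, List (stackAlphabet N α β k)) (i : Fin N) : List (Fin N) := S (Sum.inl i)

/-- The machine with the working stack `i` replaced by `l`. -/
def setWork (S : ∀ k, List (stackAlphabet N α β k)) (i : Fin N) (l : List (Fin N)) :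
    ∀ k, List (stackAlphabet N α β k) := Function.update S (Sum.inl i) l

theorem work_setWork_self (S : ∀ k, List (stackAlphabet N α β k)) (i : Fin N) (l : List (Fin N)) :
    work (setWork S i l) i = l := Function.update_self _ _ _

theorem work_setWork_of_ne (S : ∀ k, List (stackAlphabet N α β k)) {i i' : Fin N} (h : i' ≠ i)
    (l : List (Fin N)) : work (setWork S i l) i' = work S i' :=
  Function.update_of_ne (by simpa using h) _ _

theorem setWork_inr (S : ∀ k, List (stackAlphabet N α β k)) (i : Fin N) (l : List (Fin N))
    (k : Bool) : setWork S i l (Sum.inr k) = S (Sum.inr k) :=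
  Function.update_of_ne Sum.inr_ne_inl _ _

/-- The working stacks of the machine represent the store `s`. -/
def Represents (S : ∀ k, List (stackAlphabet N α β k)) (s : Store) : Prop :=
  ∀ i : Fin N, s i = (work S i).map Fin.val

/-- The machine `m` gets from `a` to `b` in `n` steps. -/
def Steps {K Λ σ : Type} {Γ : K → Type} [DecidableEq K] (m : Λ → TM2.Stmt Γ Λ σ) (n : ℕ)
    (a b : TM2.Cfg Γ Λ σ) : Prop :=
  (flip bind (TM2.step m))^[n] (some a) = some b

theorem Steps.trans {K Λ σ : Type} {Γ : K → Type} [DecidableEq K] {m : Λ → TM2.Stmt Γ Λ σ}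
    {n n' : ℕ} {a b c : TM2.Cfg Γ Λ σ} (h : Steps m n a b) (h' : Steps m n' b c) :
    Steps m (n + n') a c := by
  rw [Steps] at *
  rw [add_comm, Function.iterate_add_apply, h, h']

theorem Steps.single {K Λ σ : Type} {Γ : K → Type} [DecidableEq K] {m : Λ → TM2.Stmt Γ Λ σ}
    {l : Λ} {v : σ} {S : ∀ k, List (Γ k)} :
    Steps m 1 ⟨some l, v, S⟩ (TM2.stepAux (m l) v S) := rfl

theorem Steps.of_eq {K Λ σ : Type} {Γ : K → Type} [DecidableEq K] {m : Λ → TM2.Stmt Γ Λ σ}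
    {l : Λ} {v : σ} {S : ∀ k, List (Γ k)} {c : TM2.Cfg Γ Λ σ} (h : TM2.stepAux (m l) v S = c) :
    Steps m 1 ⟨some l, v, S⟩ c := congrArg some h

/-- The stacks of a machine, given by the working stacks, the input and the output. -/
def allStacks (w : Fin N → List (Fin N)) (l : List α) (o : List β) :
    ∀ k, List (stackAlphabet N α β k)
  | Sum.inl i => w i
  | Sum.inr false => l
  | Sum.inr true => o

theorem update_stacks_inl (w : Fin N → List (Fin N)) (l : List α) (o : List β) (i : Fin N)
    (l' : List (Fin N)) :
    Function.update (allStacks w l o) (Sum.inl i) l' = allStacks (Function.update w i l') l o := by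
  funext k
  rcases k with k | _ | _
  · by_cases h : k = i
    · subst h
      exact (Function.update_self _ _ _).trans (Function.update_self k l' w).symm
    · have : Sum.inl k ≠ (Sum.inl i : Fin N ⊕ Bool) := by simpa using h
      exact (Function.update_of_ne this l' (allStacks w l o)).trans
        (Function.update_of_ne (f := w) h l').symm
  · exact Function.update_of_ne Sum.inr_ne_inl _ _
  · exact Function.update_of_ne Sum.inr_ne_inl _ _

theorem update_stacks_false (w : Fin N → List (Fin N)) (l : List α) (o : List β)
    (l' : List α) : Function.update (allStacks w l o) (Sum.inr false) l' = allStacks w l' o := by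
  funext k
  rcases k with k | _ | _
  · exact Function.update_of_ne Sum.inl_ne_inr _ _
  · exact Function.update_self _ _ _
  · exact Function.update_of_ne (by simp) _ _

theorem update_stacks_true (w : Fin N → List (Fin N)) (l : List α) (o : List β)
    (o' : List β) : Function.update (allStacks w l o) (Sum.inr true) o' = allStacks w l o' := by
  funext k
  rcases k with k | _ | _
  · exact Function.update_of_ne Sum.inl_ne_inr _ _
  · exact Function.update_of_ne (by simp) _ _
  · exact Function.update_self _ _ _

theorem exists_stacks (S : ∀ k, List (stackAlphabet N α β k)) :
    S = allStacks (work S) (S (Sum.inr false)) (S (Sum.inr true)) := by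
  funext k
  rcases k with k | _ | _ <;> rfl

variable [NeZero N]

theorem Represents.update {S : ∀ k, List (stackAlphabet N α β k)} {s : Store}
    (h : Represents S s) (v : ℕ) (hv : v < N) (l : List (Fin N)) :
    Represents (setWork S (Fin.ofNat N v) l)
      (Function.update s v (l.map Fin.val)) := by
  intro i
  by_cases hi : i = Fin.ofNat N v
  · subst hi
    rw [work_setWork_self, Fin.val_ofNat, Nat.mod_eq_of_lt hv, Function.update_self]
  · have : (i : ℕ) ≠ v := fun h => hi (Fin.ext (by simp [h, Nat.mod_eq_of_lt hv]))
    rw [Function.update_of_ne this, work_setWork_of_ne S hi, h i]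

theorem Represents.apply {S : ∀ k, List (stackAlphabet N α β k)} {s : Store}
    (h : Represents S s) {v : ℕ} (hv : v < N) :
    s v = (work S (Fin.ofNat N v)).map Fin.val := by
  rw [← h, Fin.val_ofNat, Nat.mod_eq_of_lt hv]

/-- Induction on the run. The costs in `Run` are chosen such that each rule corresponds to exactly
as many machine steps. The embedding `j` and the continuation `next` are arbitrary, since a
subprogram occupies only part of the labels and continues in the surrounding program. -/
theorem Run.steps {P : Prog} {s s' : Store} {c : ℕ} (h : Run P s s' c) (hB : P.Bdd N)
    (m : Λ → TM2.Stmt (stackAlphabet N α β) Λ (Option (Fin N))) (j : Lab N P → Λ) (next : Λ)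
    (hm : ∀ l, m (j l) = code N α β P j next l) (S) (hS : Represents S s) (x : Option (Fin N)) :
    ∃ S' x', Steps m c ⟨some (j (entry N P)), x, S⟩ ⟨some next, x', S'⟩ ∧ Represents S' s' ∧
      ∀ k, S' (Sum.inr k) = S (Sum.inr k) := by
  induction h generalizing S x next with
  | skip s =>
    refine ⟨S, x, ?_, hS, fun _ => rfl⟩
    have := hm (entry N .skip)
    rw [code] at this
    simpa [this] using Steps.single (m := m) (l := j (entry N .skip)) (v := x) (S := S)
  | push v a s =>
    have r₀ := hS.update v hB.1 (Fin.ofNat N a :: work S (Fin.ofNat N v))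
    rw [List.map_cons, Fin.val_ofNat, Nat.mod_eq_of_lt hB.2, ← hS.apply hB.1] at r₀
    refine ⟨_, x, ?_, r₀, setWork_inr _ _ _⟩
    · have := hm (entry N (.push v a))
      rw [code] at this
      have h₁ := Steps.single (m := m) (l := j (entry N (.push v a))) (v := x) (S := S)
      rw [this] at h₁
      exact h₁
  | @seq P Q s s' s'' c d _ _ hP hQ =>
    obtain ⟨S₁, x₁, h₁, r₁, e₁⟩ := hP hB.1 (fun l => j (Sum.inl l)) (j (Sum.inr (entry N Q)))
      (fun l => hm (Sum.inl l)) S hS x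
    obtain ⟨S₂, x₂, h₂, r₂, e₂⟩ := hQ hB.2 (fun l => j (Sum.inr l)) next
      (fun l => hm (Sum.inr l)) S₁ r₁ x₁
    exact ⟨S₂, x₂, h₁.trans h₂, r₂, fun k => (e₂ k).trans (e₁ k)⟩
  | @pop v P s s' c _ ih =>
    have hsv := hS.apply hB.1
    set l := work S (Fin.ofNat N v) with hl
    have hb : (P (s v).head?).Bdd N := by
      cases hc : l with
      | nil => simpa [hsv, hc] using hB.2.1
      | cons a l' =>
        have := hB.2.2 a
        -- The symbol just read is an element of `Fin N`, so the bound for the branch is still `N`.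
        rw [max_eq_left (by omega)] at this
        simpa [hsv, hc] using this
    have ho : (s v).head? = l.head?.map Fin.val := by rw [hsv, List.head?_map]
    have r₀ := hS.update v hB.1 l.tail
    rw [List.map_tail, ← hsv] at r₀
    rw [ho] at hb ih
    obtain ⟨S₂, x₂, h₂, r₂, e₂⟩ := ih hb (fun y => j (Sum.inr ⟨l.head?, y⟩)) next
      (fun y => hm (Sum.inr ⟨l.head?, y⟩)) _ r₀ l.head?
    refine ⟨S₂, x₂, ?_, r₂, fun k => (e₂ k).trans (setWork_inr _ _ _ _)⟩
    have := hm (entry N (.pop v P))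
    rw [entry, code] at this
    have h₁ := Steps.single (m := m) (l := j (entry N (.pop v P))) (v := x) (S := S)
    rw [entry, this] at h₁
    rw [add_comm]
    exact h₁.trans h₂
  | @loop_nil v P s hs =>
    have hsv := hS.apply hB.1
    have hl : work S (Fin.ofNat N v) = [] := by
      rw [hs] at hsv
      exact List.map_eq_nil_iff.mp hsv.symm
    have r₀ := hS.update v hB.1 []
    rw [List.map_nil, ← hs, Function.update_eq_self] at r₀
    refine ⟨_, none, ?_, r₀, setWork_inr _ _ _⟩
    have := hm (entry N (loop v P))
    rw [entry, code] at this
    have h₁ := Steps.single (m := m) (l := j (entry N (loop v P))) (v := x) (S := S)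
    rw [entry, this] at h₁
    have hl' : S (Sum.inl (Fin.ofNat N v)) = [] := hl
    simp only [TM2.stepAux, hl'] at h₁
    exact h₁
  | @loop_cons v P s a l s' s'' c d hs _ _ h₁ h₂ =>
    have hsv := hS.apply hB.1
    obtain ⟨a', l', hl, rfl, rfl⟩ : ∃ (a' : Fin N) (l' : List (Fin N)),
        work S (Fin.ofNat N v) = a' :: l' ∧ a'.val = a ∧
          l'.map Fin.val = l := by
      rw [hs] at hsv
      exact List.map_eq_cons_iff.mp hsv.symm
    have hb := hB.2 a'
    rw [max_eq_left (by omega)] at hb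
    have r₀ := hS.update v hB.1 l'
    obtain ⟨S₁, x₁, s₁, r₁, e₁⟩ := h₁ hb (fun y => j (Sum.inr ⟨a', y⟩)) (j (Sum.inl ()))
      (fun y => hm (Sum.inr ⟨a', y⟩)) _ r₀ (some a')
    obtain ⟨S₂, x₂, s₂, r₂, e₂⟩ := h₂ hB j next hm S₁ r₁ x₁
    refine ⟨S₂, x₂, ?_, r₂, fun k => (e₂ k).trans ((e₁ k).trans (setWork_inr _ _ _ _))⟩
    have := hm (entry N (loop v P))
    rw [entry, code] at this
    have h₁ := Steps.single (m := m) (l := j (entry N (loop v P))) (v := x) (S := S)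
    rw [entry, this] at h₁
    have hl' : S (Sum.inl (Fin.ofNat N v)) = a' :: l' := hl
    simp only [TM2.stepAux, hl'] at h₁
    rw [show c + d + 1 = 1 + c + d by ring]
    exact (h₁.trans s₁).trans s₂

/-- A machine that reads the input, runs the program `P`, and writes the output. -/
def machine (P : Prog) (ia : α → Fin N) (ob : Fin N → β) :
    Lab N P ⊕ Bool → TM2.Stmt (stackAlphabet N α β) (Lab N P ⊕ Bool) (Option (Fin N))
  | Sum.inl l => code N α β P Sum.inl (Sum.inr true) l
  | Sum.inr false => .pop (Sum.inr false) (fun _ o => o.map ia)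
      (.branch Option.isNone (.goto fun _ => Sum.inl (entry N P))
        (.push (Sum.inl 0) (fun o => o.getD 0) (.goto fun _ => Sum.inr false)))
  | Sum.inr true => .pop (Sum.inl 0) (fun _ o => o)
      (.branch Option.isNone .halt
        (.push (Sum.inr true) (fun o => ob (o.getD 0)) (.goto fun _ => Sum.inr true)))

/-- Moving the input symbol by symbol to another stack reverses it; the same happens to the output
in `machine_write`. -/
theorem machine_read (P : Prog) (ia : α → Fin N) (ob : Fin N → β) (l : List α)
    (w : Fin N → List (Fin N)) (o : List β) (x : Option (Fin N)) :
    Steps (machine P ia ob) (l.length + 1) ⟨some (Sum.inr false), x, allStacks w l o⟩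
      ⟨some (Sum.inl (entry N P)), none,
        allStacks (Function.update w 0 ((l.map ia).reverse ++ w 0)) [] o⟩ := by
  induction l generalizing w x with
  | nil =>
    have e : Function.update (allStacks w ([] : List α) o) (Sum.inr false) [] =
        allStacks (Function.update w 0 ([] ++ w 0)) [] o := by
      rw [List.nil_append, Function.update_eq_self]
      exact update_stacks_false w [] o []
    exact Steps.of_eq (congrArg (TM2.Cfg.mk _ _) e)
  | cons a l ih =>
    have e₁ := update_stacks_false w (a :: l) o l
    have e₂ := update_stacks_inl w l o 0 (ia a :: w 0)
    have h := ih (Function.update w 0 (ia a :: w 0)) (some (ia a))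
    rw [← e₂, ← e₁] at h
    have h' := (Steps.of_eq (m := machine P ia ob) (l := Sum.inr false) (v := x)
      (S := allStacks w (a :: l) o) rfl).trans h
    rw [add_comm 1] at h'
    simpa only [List.map_cons, List.reverse_cons, List.append_assoc, List.singleton_append,
      List.length_cons, Function.update_idem, Function.update_self] using h'

theorem machine_write (P : Prog) (ia : α → Fin N) (ob : Fin N → β) (l : List (Fin N))
    (w : Fin N → List (Fin N)) (hw : w 0 = l) (o : List β) (x : Option (Fin N)) :
    Steps (machine P ia ob) (l.length + 1) ⟨some (Sum.inr true), x, allStacks w [] o⟩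
      ⟨none, none, allStacks (Function.update w 0 []) [] ((l.map ob).reverse ++ o)⟩ := by
  -- The contents of the working stack `0` are separated from `w`, so that the induction changes
  -- only them.
  obtain ⟨w, rfl⟩ : ∃ w' : Fin N → List (Fin N), w = Function.update w' 0 l :=
    ⟨w, by rw [← hw, Function.update_eq_self]⟩
  clear hw
  rw [Function.update_idem]
  induction l generalizing x o with
  | nil =>
    have e := update_stacks_inl (Function.update w 0 []) ([] : List α) o 0 []
    rw [Function.update_idem] at e
    exact Steps.of_eq (congrArg (TM2.Cfg.mk _ _) e)
  | cons a l ih =>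
    have e₁ := update_stacks_inl (Function.update w 0 (a :: l)) ([] : List α) o 0 l
    have e₂ := update_stacks_true (Function.update w 0 l) ([] : List α) o (ob a :: o)
    rw [Function.update_idem] at e₁
    have h := ih (ob a :: o) (some a)
    rw [← e₂, ← e₁] at h
    have h' := (Steps.of_eq (m := machine P ia ob) (l := Sum.inr true) (v := x)
      (S := allStacks (Function.update w 0 (a :: l)) [] o) rfl).trans h
    rw [add_comm 1] at h'
    simpa only [List.map_cons, List.reverse_cons, List.append_assoc, List.singleton_append,
      List.length_cons] using h'

end compile

/-- The store with `l` on the stack `0` and nothing else. -/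
def single (l : List ℕ) : Store := update (fun _ => []) 0 l

/-- A function that is computed by a program in polynomial time is computed by a stack machine in
polynomial time. The program finds the input in reverse order and leaves the output in reverse
order. -/
theorem polyTime_of_run {α β X Y : Type} [Fintype α] (ea : X → List α) (eb : Y → List β)
    (f : X → Y) (P : Prog) (ia : α → ℕ) (ob : ℕ → β) (p : Polynomial ℕ)
    {N₀ : ℕ} (hB : P.Bdd N₀)
    (h : ∀ x, ∃ c ≤ p.eval (ea x).length, ∃ l : List ℕ, (l.map ob).reverse = eb (f x) ∧
      Run P (single ((ea x).map ia).reverse) (single l) c) :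
    Nonempty (TM2ComputableInPolyTime ea eb f) := by
  obtain ⟨N₁, hN₁⟩ : ∃ N₁, ∀ a, ia a < N₁ :=
    ⟨(Finset.univ.sup ia) + 1, fun a => Nat.lt_succ_of_le (Finset.le_sup (Finset.mem_univ a))⟩
  let N := N₀ + N₁ + 1
  have hB' : P.Bdd N := hB.mono (by omega)
  let ia' : α → Fin N := fun a => ⟨ia a, (hN₁ a).trans_le (by omega)⟩
  let m := machine P ia' (fun a => ob a.val)
  let tm : FinTM2 :=
    { k₀ := (Sum.inr false : Fin N ⊕ Bool), k₁ := Sum.inr true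
      Γ := stackAlphabet N α β
      Λ := Lab N P ⊕ Bool, main := Sum.inr false
      σ := Option (Fin N), initialState := none
      Γk₀Fin := inferInstanceAs (Fintype α)
      m := m }
  have hinit : ∀ l : List α, initList tm l =
      (⟨some (Sum.inr false), none, allStacks (fun _ => []) l []⟩ : TM2.Cfg _ _ _) := by
    intro l
    refine congrArg (TM2.Cfg.mk _ _) ?_
    funext k
    rcases k with k | _ | _ <;> rfl
  have hhalt : ∀ o : List β, haltList tm o =
      (⟨none, none, allStacks (fun _ => []) [] o⟩ : TM2.Cfg _ _ _) := by
    intro l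
    refine congrArg (TM2.Cfg.mk _ _) ?_
    funext k
    rcases k with k | _ | _ <;> rfl
  refine ⟨{ tm := tm
            inputAlphabet := Equiv.refl α
            outputAlphabet := Equiv.refl β
            -- The three phases: reading the input, running the program, and writing the output,
            -- whose length is at most that of the input plus the running time.
            time := Polynomial.X + 1 + p + (Polynomial.X + p + 1)
            outputsFun := fun x => Classical.choice ?_ }⟩
  obtain ⟨c, hc, l, hl, hr⟩ := h x
  have h₁ := machine_read P ia' (fun a => ob a.val) (ea x) (fun _ => []) [] none
  rw [List.append_nil] at h₁
  set w₀ : Fin N → List (Fin N) :=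
    Function.update (fun _ => []) 0 ((ea x).map ia').reverse with hw₀
  have hrep : Represents (allStacks w₀ ([] : List α) ([] : List β))
      (single ((ea x).map ia).reverse) := by
    intro i
    change _ = (w₀ i).map Fin.val
    by_cases hi : i = 0
    · subst hi
      simp [single, hw₀, ia']
    · have : (i : ℕ) ≠ 0 := fun h => hi (Fin.ext h)
      simp [single, hw₀, hi, this]
  obtain ⟨S', y, h₂, r', e⟩ := hr.steps hB' m Sum.inl (Sum.inr true) (fun l => rfl) _ hrep none
  rw [exists_stacks S', e, e] at h₂
  have h₃ := machine_write P ia' (fun a => ob a.val) (work S' 0) (work S') rfl [] y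
  have hw : (work S' 0).map Fin.val = l := by
    simpa [single] using (r' 0).symm
  have hlen : (work S' 0).length = l.length := by rw [← hw, List.length_map]
  -- A halting machine must leave all stacks empty except for the output; the final store `single l`
  -- has nothing outside the stack `0`.
  have hw' : Function.update (work S') 0 [] = fun _ => [] := by
    funext i
    by_cases hi : i = 0
    · subst hi; simp
    · have : (i : ℕ) ≠ 0 := fun h => hi (Fin.ext h)
      have := r' i
      simp [single, *] at this
      simp [hi, this]
  have h₄ := (h₁.trans h₂).trans h₃
  rw [hw', List.append_nil] at h₄
  have hout : ((work S' 0).map fun a => ob a.val).reverse = eb (f x) := by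
    rw [← hl, ← hw, List.map_map]; rfl
  rw [hout] at h₄
  have hl' := hr.length_le 0
  simp [single] at hl'
  refine ⟨⟨⟨(ea x).length + 1 + c + ((work S' 0).length + 1), ?_⟩, ?_⟩⟩
  · have hi := (congrArg (initList tm) (List.map_id (ea x))).trans (hinit _)
    have ho := (congrArg (haltList tm) (List.map_id (eb (f x)))).trans (hhalt _)
    exact (congrArg _ (congrArg some hi)).trans (Eq.trans h₄ (congrArg some ho.symm))
  · simp only [Polynomial.eval_add, Polynomial.eval_X, Polynomial.eval_one, hlen]
    omega

end Prog

/-! ### Upper bounds for running times, and elementary programs -/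

theorem Polynomial.eval_mono_nat (p : Polynomial ℕ) {m n : ℕ} (h : m ≤ n) :
    p.eval m ≤ p.eval n := by
  rw [Polynomial.eval_eq_sum, Polynomial.eval_eq_sum]
  exact Finset.sum_le_sum fun i _ => Nat.mul_le_mul_left _ (Nat.pow_le_pow_left h i)

namespace Prog

open Function

/-- The program `P` gets from `s` to `s'` in at most `c` steps. -/
def RunLE (P : Prog) (s s' : Store) (c : ℕ) : Prop := ∃ d ≤ c, Run P s s' d

theorem RunLE.mono {P : Prog} {s s' : Store} {c d : ℕ} (h : RunLE P s s' c) (hcd : c ≤ d) :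
    RunLE P s s' d :=
  let ⟨e, he, hr⟩ := h
  ⟨e, he.trans hcd, hr⟩

theorem RunLE.seq {P Q : Prog} {s s' s'' : Store} {c d : ℕ} (h : RunLE P s s' c)
    (h' : RunLE Q s' s'' d) : RunLE (seq P Q) s s'' (c + d) :=
  let ⟨e, he, hr⟩ := h
  let ⟨e', he', hr'⟩ := h'
  ⟨e + e', by omega, hr.seq hr'⟩

theorem RunLE.congr {P : Prog} {s s' s'' : Store} {c : ℕ} (h : RunLE P s s' c) (hs : s' = s'') :
    RunLE P s s'' c := hs ▸ h

theorem RunLE.push (v a : ℕ) (s : Store) : RunLE (push v a) s (update s v (a :: s v)) 1 :=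
  ⟨1, le_rfl, Run.push v a s⟩

theorem RunLE.skip (s : Store) : RunLE skip s s 1 := ⟨1, le_rfl, Run.skip s⟩

theorem RunLE.pop {v : ℕ} {P : Option ℕ → Prog} {s s' : Store} {c : ℕ}
    (h : RunLE (P (s v).head?) (update s v (s v).tail) s' c) : RunLE (pop v P) s s' (c + 1) :=
  let ⟨e, he, hr⟩ := h
  ⟨e + 1, by omega, hr.pop⟩

theorem RunLE.loop_nil {v : ℕ} {P : ℕ → Prog} {s : Store} (h : s v = []) :
    RunLE (loop v P) s s 1 := ⟨1, le_rfl, Run.loop_nil h⟩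

theorem RunLE.loop_cons {v : ℕ} {P : ℕ → Prog} {s s' s'' : Store} {a : ℕ} {l : List ℕ} {c d : ℕ}
    (h : s v = a :: l) (h₁ : RunLE (P a) (update s v l) s' c) (h₂ : RunLE (loop v P) s' s'' d) :
    RunLE (loop v P) s s'' (c + d + 1) :=
  let ⟨e, he, hr⟩ := h₁
  let ⟨e', he', hr'⟩ := h₂
  ⟨e + e' + 1, by omega, hr.loop_cons h hr'⟩

/-- Push a word onto a stack. -/
def pushes (w : ℕ) : List ℕ → Prog
  | [] => skip
  | a :: l => seq (pushes w l) (push w a)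

theorem bdd_pushes {w N : ℕ} {l : List ℕ} (hw : w < N) (hl : ∀ a ∈ l, a < N) :
    (pushes w l).Bdd N := by
  induction l with
  | nil => trivial
  | cons a l ih =>
    exact ⟨ih fun b hb => hl b (List.mem_cons_of_mem _ hb), hw, hl a List.mem_cons_self⟩

theorem runLE_pushes (w : ℕ) (l : List ℕ) (s : Store) :
    RunLE (pushes w l) s (update s w (l ++ s w)) (l.length + 1) := by
  induction l with
  | nil => exact (RunLE.skip s).congr (by simp)
  | cons a l ih =>
    exact ((ih.seq (RunLE.push w a _)).congr (by simp)).mono (by simp)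

/-- Pop the symbols of the stack `v` one by one and push the word `g a` for each symbol `a`. -/
def pour (v w : ℕ) (g : ℕ → List ℕ) : Prog := loop v fun a => pushes w (g a)

theorem bdd_pour {v w N : ℕ} {g : ℕ → List ℕ} (hv : v < N) (hw : w < N)
    (hg : ∀ a, ∀ b ∈ g a, b < max N (a + 1)) : (pour v w g).Bdd N :=
  ⟨hv, fun a => bdd_pushes (hw.trans_le (le_max_left _ _)) (hg a)⟩

/-- The symbols are taken from the top and later words are pushed above earlier ones, whence the
reversal. Each symbol costs one step of the loop and at most `C + 1` steps for its word. -/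
theorem runLE_pour {v w : ℕ} (hvw : v ≠ w) (g : ℕ → List ℕ) (C : ℕ) (hC : ∀ a, (g a).length ≤ C)
    (s : Store) : RunLE (pour v w g) s
      (update (update s v []) w ((s v).reverse.flatMap g ++ s w)) ((C + 2) * (s v).length + 1) := by
  generalize hl : s v = l
  induction l generalizing s with
  | nil =>
    refine (RunLE.loop_nil hl).congr ?_
    have : update s v [] = s := by rw [← hl, update_eq_self]
    simp [this]
  | cons a l ih =>
    have h₁ := runLE_pushes w (g a) (update s v l)
    have h₂ := ih _ (show update (update s v l) w (g a ++ update s v l w) v = l by simp [hvw])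
    refine ((RunLE.loop_cons hl h₁ h₂).congr ?_).mono ?_
    · funext i
      by_cases h : i = w
      · subst h; simp [hvw.symm]
      · by_cases h' : i = v
        · subst h'; simp [h]
        · simp [h, h']
    · have := hC a
      simp only [List.length_cons]
      nlinarith

/-- Reverse the stack `v` onto `w`. -/
def rev (v w : ℕ) : Prog := pour v w fun a => [a]

theorem bdd_rev {v w N : ℕ} (hv : v < N) (hw : w < N) : (rev v w).Bdd N :=
  bdd_pour hv hw (by simp)

theorem runLE_rev {v w : ℕ} (hvw : v ≠ w) (s : Store) : RunLE (rev v w) s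
    (update (update s v []) w ((s v).reverse ++ s w)) (3 * (s v).length + 1) := by
  simpa [rev] using runLE_pour hvw (fun a => [a]) 1 (by simp) s

/-- Move the contents of the stack `v` to `w`, using the empty stack `t`. -/
def move (v w t : ℕ) : Prog := seq (rev v t) (rev t w)

theorem bdd_move {v w t N : ℕ} (hv : v < N) (hw : w < N) (ht : t < N) : (move v w t).Bdd N :=
  ⟨bdd_rev hv ht, bdd_rev ht hw⟩

theorem runLE_move {v w t : ℕ} (hvw : v ≠ w) (hvt : v ≠ t) (hwt : w ≠ t) (s : Store)
    (ht : s t = []) : RunLE (move v w t) s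
      (update (update s v []) w (s v ++ s w)) (6 * (s v).length + 2) := by
  have h := (runLE_rev hvt s).seq (runLE_rev hwt.symm _)
  refine (h.congr ?_).mono ?_
  · funext i
    by_cases hi : i = w
    · subst hi; simp [hvw.symm, hwt, ht]
    · by_cases hi' : i = t
      · subst hi'; simp [hi, ht, hvt.symm]
      · simp [hi, hi']
  · simp [ht]; omega

/-- Copy the stack `0` to the empty stack `N`, using the empty stack `N + 1`. -/
def save (N : ℕ) : Prog :=
  seq (rev 0 (N + 1)) (loop (N + 1) fun a => seq (push 0 a) (push N a))

theorem bdd_save {N M : ℕ} (h : N + 1 < M) : (save N).Bdd M :=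
  ⟨bdd_rev (by omega) h, h, fun a => ⟨⟨by omega, by omega⟩, by omega, by omega⟩⟩

theorem runLE_save {N : ℕ} (hN : 0 < N) (s : Store) (h₀ : s N = []) (h₁ : s (N + 1) = []) :
    RunLE (save N) s (update s N (s 0)) (6 * (s 0).length + 2) := by
  have key : ∀ (l : List ℕ) (s : Store), s (N + 1) = l →
      RunLE (loop (N + 1) fun a => seq (push 0 a) (push N a)) s
        (update (update (update s (N + 1) []) 0 (l.reverse ++ s 0)) N (l.reverse ++ s N))
        (3 * l.length + 1) := by
    intro l
    induction l with
    | nil =>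
      intro s hs
      refine (RunLE.loop_nil hs).congr ?_
      have h' : update s (N + 1) [] = s := by rw [← hs, update_eq_self]
      simp [h']
    | cons a l ih =>
      intro s hs
      have hr := (RunLE.push 0 a (update s (N + 1) l)).seq (RunLE.push N a _)
      have hr' := ih (update (update (update s (N + 1) l) 0 (a :: update s (N + 1) l 0)) N
        (a :: update (update s (N + 1) l) 0 (a :: update s (N + 1) l 0) N)) (by simp)
      refine ((RunLE.loop_cons hs hr hr').congr ?_).mono (by simp; omega)
      have h0 : N ≠ 0 := by omega
      funext i
      by_cases hi : i = N
      · subst hi; simp [h0]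
      · by_cases hi0 : i = 0
        · subst hi0; simp [h0.symm]
        · by_cases hi1 : i = N + 1
          · subst hi1; simp
          · simp [hi, hi0, hi1]
  refine (((runLE_rev (by omega) s).seq (key _ _ rfl)).congr ?_).mono ?_
  · have h0 : N ≠ 0 := by omega
    funext i
    by_cases hi : i = N
    · subst hi; simp [h0, h₀, h₁]
    · by_cases hi0 : i = 0
      · subst hi0; simp [h0.symm, h₁]
      · by_cases hi1 : i = N + 1
        · subst hi1; simp [h₁]
        · simp [hi, hi0, hi1]
  · simp [h₁]; omega

/-- Empty the stack `v`. -/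
def drain (v : ℕ) : Prog := loop v fun _ => skip

theorem bdd_drain {v N : ℕ} (h : v < N) : (drain v).Bdd N := ⟨h, fun _ => trivial⟩

theorem runLE_drain (v : ℕ) (s : Store) :
    RunLE (drain v) s (update s v []) (2 * (s v).length + 1) := by
  generalize hl : s v = l
  induction l generalizing s with
  | nil =>
    refine (RunLE.loop_nil hl).congr ?_
    rw [← hl, update_eq_self]
  | cons a l ih =>
    have h := ih (update s v l) (by simp)
    exact ((RunLE.loop_cons hl (RunLE.skip _) h).congr (by simp)).mono (by simp; omega)

end Prog

/-! ## Functions computable in polynomial time -/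

/-- A type whose elements are coded by words. -/
class Enc (X : Type) where
  enc : X → List ℕ

/-- A type whose elements are coded by single symbols. -/
class FinEnc (F : Type) where
  idx : F → ℕ
  inj : Function.Injective idx

open Enc (enc)

/-- The length of the code. -/
def size {X : Type} [Enc X] (x : X) : ℕ := (enc x).length

namespace Prog

open Function

/-- The store `s` with new contents of the stacks `0`, `N`, `N + 1` and `N + 2`. -/
def frame (s : Store) (N : ℕ) (a b c d : List ℕ) : Store := fun i =>
  if i = 0 then a else if i = N then b else if i = N + 1 then c else if i = N + 2 then d else s i

section frame

variable {s : Store} {N : ℕ} 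

theorem update_frame_zero (a b c d a' : List ℕ) :
    update (frame s N a b c d) 0 a' = frame s N a' b c d := by
  funext i; simp only [frame, update_apply]; split_ifs <;> rfl

theorem update_frame_one (hN : 0 < N) (a b c d a' : List ℕ) :
    update (frame s N a b c d) N a' = frame s N a a' c d := by
  funext i; simp only [frame, update_apply]; split_ifs <;> first | rfl | omega

theorem update_frame_two (hN : 0 < N) (a b c d a' : List ℕ) :
    update (frame s N a b c d) (N + 1) a' = frame s N a b a' d := by
  funext i; simp only [frame, update_apply]; split_ifs <;> first | rfl | omega

theorem frame_zero (a b c d : List ℕ) : frame s N a b c d 0 = a := by simp [frame]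

theorem frame_one (hN : 0 < N) (a b c d : List ℕ) : frame s N a b c d N = b := by
  simp [frame, hN.ne']

theorem frame_two (a b c d : List ℕ) : frame s N a b c d (N + 1) = c := by simp [frame]

theorem frame_three (a b c d : List ℕ) : frame s N a b c d (N + 2) = d := by simp [frame]

end frame

theorem frame_lt {s : Store} {N : ℕ} (a b c d : List ℕ) {i : ℕ} (h : 0 < i) (h' : i < N) :
    frame s N a b c d i = s i := by
  simp only [frame]; split_ifs <;> first | rfl | omega

theorem frame_self {s : Store} {N : ℕ} (hN : 0 < N) {a : List ℕ} (h₀ : s 0 = a)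
    (h : ∀ i, 0 < i → i < N + 3 → s i = []) : s = frame s N a [] [] [] := by
  funext i
  simp only [frame]
  split_ifs with h1 h2 h3 h4
  · rw [h1, h₀]
  · exact h i (by omega) (by omega)
  · exact h i (by omega) (by omega)
  · exact h i (by omega) (by omega)
  · rfl

theorem frame_update {s : Store} {N : ℕ} (hN : 0 < N) {a : List ℕ}
    (h : ∀ i, 0 < i → i < N + 3 → s i = []) : frame s N a [] [] [] = update s 0 a := by
  funext i
  simp only [frame, update_apply]
  split_ifs with h1 h2 h3 h4
  · rfl
  · exact (h i (by omega) (by omega)).symm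
  · exact (h i (by omega) (by omega)).symm
  · exact (h i (by omega) (by omega)).symm
  · rfl

end Prog

open Prog Function

/-- `f` is computed by a program in polynomial time. -/
def PolyTime {X Y : Type} [Enc X] [Enc Y] (f : X → Y) : Prop :=
  ∃ (P : Prog) (N : ℕ) (p : Polynomial ℕ), P.Bdd N ∧ ∀ (x : X) (s : Store), s 0 = enc x →
    (∀ i, 0 < i → i < N → s i = []) → RunLE P s (update s 0 (enc (f x))) (p.eval (size x))

namespace PolyTime

variable {X Y Z : Type} [Enc X] [Enc Y] [Enc Z]

/-- Since the definition of `PolyTime` leaves the stacks from the bound `M` on arbitrary and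
unchanged, a larger program can keep data on the stacks `N`, `N + 1` and `N + 2` while a subprogram
runs. -/
theorem run_frame {f : X → Y} {P : Prog} {M N : ℕ} {p : Polynomial ℕ}
    (h : ∀ (x : X) (s : Store), s 0 = enc x →
      (∀ i, 0 < i → i < M → s i = []) → RunLE P s (update s 0 (enc (f x))) (p.eval (size x)))
    (hM : M ≤ N) (x : X) (s : Store) (hs : ∀ i, 0 < i → i < N → s i = []) (b c d : List ℕ) :
    RunLE P (frame s N (enc x) b c d) (frame s N (enc (f x)) b c d) (p.eval (size x)) := by
  have := h x (frame s N (enc x) b c d) (frame_zero _ _ _ _) fun i hi hi' => by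
    rw [frame_lt _ _ _ _ hi (by omega), hs i hi (by omega)]
  rwa [update_frame_zero] at this

/-- The output is no longer than the input plus the running time. Compositions and loops need this
to bound the time of what follows. -/
theorem size_le {f : X → Y} (hf : PolyTime f) :
    ∃ p : Polynomial ℕ, ∀ x, size (f x) ≤ p.eval (size x) := by
  obtain ⟨P, N, p, -, h⟩ := hf
  refine ⟨Polynomial.X + p, fun x => ?_⟩
  obtain ⟨c, hc, hr⟩ := h x (update (fun _ => []) 0 (enc x)) (by simp)
    (fun i hi _ => by simp [hi.ne'])
  have := hr.length_le 0
  simp only [update_self] at this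
  simp only [Polynomial.eval_add, Polynomial.eval_X]
  exact this.trans (Nat.add_le_add_left hc _)

/-- It suffices to consider stores of a particular form. -/
theorem of_frame {f : X → Y} {P : Prog} {N : ℕ} {p : Polynomial ℕ} (hN : 0 < N)
    (hB : P.Bdd (N + 3))
    (h : ∀ x s, (∀ i, 0 < i → i < N → s i = []) →
      RunLE P (frame s N (enc x) [] [] []) (frame s N (enc (f x)) [] [] [])
        (p.eval (size x))) : PolyTime f := by
  refine ⟨P, N + 3, p, hB, fun x s h0 hs => ?_⟩
  have := h x s (fun i hi hi' => hs i hi (by omega))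
  rwa [← frame_self hN h0 hs, frame_update hN hs] at this

/-- The codes are designed so that several conversions are free: a number has the same code as its
optional predecessor, a list the same as the optional pair of its head and tail. -/
theorem of_enc_eq {f : X → Y} (h : ∀ x, enc (f x) = enc x) : PolyTime f :=
  ⟨skip, 1, 1, trivial, fun x s h0 _ => (RunLE.skip s).congr (by rw [h, ← h0, update_eq_self])
    |>.mono (by simp)⟩

theorem of_enc_append {f : X → Y} (l : List ℕ) (h : ∀ x, enc (f x) = l ++ enc x) :
    PolyTime f := by
  refine ⟨pushes 0 l, (l.foldr max 0) + 1, (l.length + 1 : ℕ), bdd_pushes (by omega) ?_,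
    fun x s h0 _ => ((runLE_pushes 0 l s).congr ?_).mono ?_⟩
  · intro a ha
    exact Nat.lt_succ_of_le (List.le_max_of_le' 0 ha le_rfl)
  · rw [h, h0]
  · simp

theorem id : PolyTime (fun x : X => x) := of_enc_eq fun _ => rfl

theorem const (y : Y) : PolyTime (fun _ : X => y) := by
  refine ⟨.seq (drain 0) (pushes 0 (enc y)), ((enc y).foldr max 0) + 1,
    2 * Polynomial.X + 1 + (((enc y).length + 1 : ℕ) : Polynomial ℕ), ⟨bdd_drain (by omega),
      bdd_pushes (by omega) ?_⟩,
    fun x s h0 _ => (((runLE_drain 0 s).seq (runLE_pushes 0 _ _)).congr ?_).mono ?_⟩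
  · intro a ha
    exact Nat.lt_succ_of_le (List.le_max_of_le' 0 ha le_rfl)
  · simp
  · simp [h0, size]

theorem comp {g : Y → Z} {f : X → Y} (hg : PolyTime g) (hf : PolyTime f) :
    PolyTime (fun x => g (f x)) := by
  obtain ⟨q', hq'⟩ := hf.size_le
  obtain ⟨P, N, p, hB, h⟩ := hf
  obtain ⟨Q, M, q, hB', h'⟩ := hg
  refine ⟨.seq P Q, max N M, p + q.comp q',
    ⟨hB.mono (le_max_left _ _), hB'.mono (le_max_right _ _)⟩,
    fun x s h0 hs => ?_⟩
  have h₁ := h x s h0 fun i hi hi' => hs i hi (hi'.trans_le (le_max_left _ _))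
  have h₂ := h' (f x) (update s 0 (enc (f x))) (by simp) fun i hi hi' => by
    rw [update_of_ne hi.ne', hs i hi (hi'.trans_le (le_max_right _ _))]
  refine ((h₁.seq h₂).congr (by simp)).mono ?_
  rw [Polynomial.eval_add, Polynomial.eval_comp]
  exact Nat.add_le_add_left (q.eval_mono_nat (hq' x)) _

theorem congr {f g : X → Y} (hf : PolyTime f) (h : ∀ x, g x = f x) : PolyTime g := by
  rwa [funext h]

end PolyTime

/-! ### Codes of data and closure properties of polynomial time -/

/-- The code of a pair of words. -/
def encPair (l l' : List ℕ) : List ℕ := l.flatMap (fun a => [1, a]) ++ 0 :: l'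

/-- The code is unary, because these numbers are lengths, precisions and loop counters. Numbers in
binary have the type `Bin`. -/
instance : Enc ℕ := ⟨fun n => List.replicate n 1⟩
instance {X Y : Type} [Enc X] [Enc Y] : Enc (X × Y) := ⟨fun x => encPair (enc x.1) (enc x.2)⟩
instance {X : Type} [Enc X] : Enc (Option X) := ⟨fun x => x.elim [] fun x => 1 :: enc x⟩
instance {X : Type} [Enc X] : Enc (List X) :=
  ⟨fun l => l.foldr (fun a l => 1 :: encPair (enc a) l) []⟩
instance {F : Type} [FinEnc F] : Enc F := ⟨fun a => [FinEnc.idx a]⟩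
instance : FinEnc Bool := ⟨Bool.toNat, fun a b h => by cases a <;> cases b <;> simp_all⟩

/-- Words of bits, coded by themselves. -/
structure Bits where
  bits : List Bool

instance : Enc Bits := ⟨fun l => l.bits.map Bool.toNat⟩

@[simp] theorem size_nat (n : ℕ) : size n = n := by simp [size, enc]
@[simp] theorem length_encPair (l l' : List ℕ) :
    (encPair l l').length = 2 * l.length + l'.length + 1 := by
  simp [encPair]; omega
@[simp] theorem size_pair {X Y : Type} [Enc X] [Enc Y] (x : X × Y) :
    size x = 2 * size x.1 + size x.2 + 1 := length_encPair _ _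
@[simp] theorem size_nil {X : Type} [Enc X] : size ([] : List X) = 0 := rfl
@[simp] theorem size_cons {X : Type} [Enc X] (a : X) (l : List X) :
    size (a :: l) = 2 * size a + size l + 2 := by
  change (1 :: encPair (enc a) (enc l)).length = _
  simp [size]
@[simp] theorem size_some {X : Type} [Enc X] (a : X) : size (some a) = size a + 1 := rfl
@[simp] theorem size_fin {F : Type} [FinEnc F] (a : F) : size a = 1 := rfl
@[simp] theorem size_bits (l : Bits) : size l = l.bits.length := by simp [size, enc]

namespace PolyTime

variable {X Y Z : Type} [Enc X] [Enc Y] [Enc Z]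

/-- The input is needed twice. A copy waits on the stack `N` while `f` is computed; then the value
of `f` waits, reversed, on `N + 1` while `g` is computed. Pouring it back above the value of `g`
restores its order and inserts the marks required by `encPair`. -/
theorem pair {f : X → Y} {g : X → Z} (hf : PolyTime f) (hg : PolyTime g) :
    PolyTime (fun x => (f x, g x)) := by
  obtain ⟨p', hp'⟩ := hf.size_le
  obtain ⟨P, Nf, p, hP, hp⟩ := hf
  obtain ⟨Q, Ng, q, hQ, hq⟩ := hg
  set N := max Nf Ng + 1 with hNdef
  have hN : 0 < N := by omega
  refine of_frame (N := N)
    (P := .seq (save N) <| .seq P <| .seq (rev 0 (N + 1)) <| .seq (move N 0 (N + 2)) <|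
      .seq Q <| .seq (.push 0 0) (pour (N + 1) 0 fun a => [1, a]))
    (p := (6 * Polynomial.X + 2) + (p + ((3 * p' + 1) + ((6 * Polynomial.X + 2) + (q +
      (1 + (4 * p' + 1)))))))
    hN ?_ fun x s hs => ?_
  · refine ⟨bdd_save (by omega), hP.mono (by omega), bdd_rev (by omega) (by omega),
      bdd_move (by omega) (by omega) (by omega), hQ.mono (by omega), ⟨by omega, by omega⟩,
      bdd_pour (by omega) (by omega) ?_⟩
    simp
  · have h₁ := runLE_save hN (frame s N (enc x) [] [] []) (frame_one hN _ _ _ _)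
      (frame_two _ _ _ _)
    rw [update_frame_one hN, frame_zero] at h₁
    have h₂ := run_frame hp (by omega) x s hs (enc x) [] []
    have h₃ := runLE_rev (v := 0) (w := N + 1) (by omega) (frame s N (enc (f x)) (enc x) [] [])
    rw [update_frame_zero, update_frame_two hN, frame_zero, frame_two] at h₃
    have h₄ := runLE_move (v := N) (w := 0) (t := N + 2) (by omega) (by omega) (by omega)
      (frame s N [] (enc x) ((enc (f x)).reverse ++ []) []) (frame_three _ _ _ _)
    rw [update_frame_one hN, update_frame_zero, frame_one hN, frame_zero, List.append_nil,
      List.append_nil] at h₄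
    have h₅ := run_frame hq (by omega) x s hs [] (enc (f x)).reverse []
    have h₆ := RunLE.push 0 0 (frame s N (enc (g x)) [] (enc (f x)).reverse [])
    rw [update_frame_zero, frame_zero] at h₆
    have h₇ := runLE_pour (v := N + 1) (w := 0) (by omega) (fun a => [1, a]) 2 (by simp)
      (frame s N (0 :: enc (g x)) [] (enc (f x)).reverse [])
    rw [update_frame_two hN, update_frame_zero, frame_two, frame_zero] at h₇
    rw [List.append_nil] at h₃
    refine ((h₁.seq <| h₂.seq <| h₃.seq <| h₄.seq <| h₅.seq <| h₆.seq h₇).congr ?_).mono ?_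
    · simp [enc, encPair]
    · have := hp' x
      simp only [List.length_reverse, Polynomial.eval_add, Polynomial.eval_mul,
        Polynomial.eval_X, Polynomial.eval_ofNat, Polynomial.eval_one]
      simp only [size] at *
      omega

/-- In the code of a pair a mark `1` announces a further symbol of the first component, which is
saved on the stack `1`; the mark `0` announces the second component, which is discarded. For `snd`
the roles are exchanged. -/
theorem fst : PolyTime (fun x : X × Y => x.1) := by
  have key : ∀ (l r : List ℕ) (s : Store), s 0 = encPair l r →
      RunLE (.loop 0 fun t => if t = 1 then .pop 0 (fun o => o.elim .skip (.push 1)) else drain 0) s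
        (update (update s 0 []) 1 (l.reverse ++ s 1)) (3 * l.length + 2 * r.length + 3) := by
    intro l r
    induction l with
    | nil =>
      intro s hs
      have h := runLE_drain 0 (update s 0 r)
      have h' := RunLE.loop_cons (P := fun t => if t = 1 then .pop 0 (fun o => o.elim .skip
        (.push 1)) else drain 0) hs h (RunLE.loop_nil (by simp))
      refine (h'.congr ?_).mono ?_
      · simp
      · simp
    | cons a l ih =>
      intro s hs
      have h₂ := ih (update (update s 0 (encPair l r)) 1 (a :: s 1)) (by simp)
      have h₁ : RunLE (.pop 0 (fun o => o.elim .skip (.push 1))) (update s 0 (a :: encPair l r))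
          (update (update s 0 (encPair l r)) 1 (a :: s 1)) 2 := by
        refine RunLE.pop ?_
        have := RunLE.push 1 a (update s 0 (encPair l r))
        simpa using this
      refine ((RunLE.loop_cons hs h₁ h₂).congr ?_).mono ?_
      · funext i
        by_cases h0 : i = 0
        · simp [h0]
        · by_cases h1 : i = 1
          · simp [h1]
          · simp [h0, h1]
      · simp; omega
  refine ⟨.seq (.loop 0 fun t => if t = 1 then .pop 0 (fun o => o.elim .skip (.push 1))
    else drain 0)
    (rev 1 0), 2, 6 * Polynomial.X + 4, ⟨⟨by omega, fun a => ?_⟩, bdd_rev (by omega) (by omega)⟩,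
    fun x s h0 hs => (((key _ _ s h0).seq (runLE_rev (by omega) _)).congr ?_).mono ?_⟩
  · beta_reduce
    split_ifs
    · exact ⟨by omega, trivial, fun b => ⟨by omega, by omega⟩⟩
    · exact bdd_drain (by omega)
  · have := hs 1 (by omega) (by omega)
    funext i
    by_cases h0 : i = 0
    · simp [h0, this]
    · by_cases h1 : i = 1
      · simp [h1, this]
      · simp [h0, h1]
  · have := hs 1 (by omega) (by omega)
    simp [this]
    simp only [size]
    omega

theorem snd : PolyTime (fun x : X × Y => x.2) := by
  have key : ∀ (l r : List ℕ) (s : Store), s 0 = encPair l r →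
      RunLE (.loop 0 fun t => if t = 1 then .pop 0 (fun _ => .skip) else rev 0 1) s
        (update (update s 0 []) 1 (r.reverse ++ s 1)) (3 * l.length + 3 * r.length + 3) := by
    intro l r
    induction l with
    | nil =>
      intro s hs
      have h := runLE_rev (v := 0) (w := 1) (by omega) (update s 0 r)
      have h' := RunLE.loop_cons (P := fun t => if t = 1 then .pop 0 (fun _ => .skip)
        else rev 0 1) hs h (RunLE.loop_nil (by simp))
      refine (h'.congr ?_).mono ?_
      · simp
      · simp
    | cons a l ih =>
      intro s hs
      have h₂ := ih (update s 0 (encPair l r)) (by simp)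
      have h₁ : RunLE (.pop 0 (fun _ => .skip)) (update s 0 (a :: encPair l r))
          (update s 0 (encPair l r)) 2 := by
        refine RunLE.pop ?_
        have := RunLE.skip (update s 0 (encPair l r))
        simpa using this
      refine ((RunLE.loop_cons hs h₁ h₂).congr ?_).mono ?_
      · simp
      · simp; omega
  refine ⟨.seq (.loop 0 fun t => if t = 1 then .pop 0 (fun _ => .skip) else rev 0 1)
    (rev 1 0), 2, 9 * Polynomial.X + 4, ⟨⟨by omega, fun a => ?_⟩, bdd_rev (by omega) (by omega)⟩,
    fun x s h0 hs => (((key _ _ s h0).seq (runLE_rev (by omega) _)).congr ?_).mono ?_⟩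
  · beta_reduce
    split_ifs
    · exact ⟨by omega, trivial, fun b => trivial⟩
    · exact bdd_rev (by omega) (by omega)
  · have := hs 1 (by omega) (by omega)
    funext i
    by_cases h0 : i = 0
    · simp [h0, this]
    · by_cases h1 : i = 1
      · simp [h1, this]
      · simp [h0, h1]
  · have := hs 1 (by omega) (by omega)
    simp [this]
    simp only [size]
    omega

/-- With a copy of the input set aside, the first symbol of the code of `o x` decides the case. If
there is one, the code of `z` is left on the stack `0` and is completed in place to that of `(x,
z)`. -/
theorem optionElim {f : X → Y} {o : X → Option Z} {g : X × Z → Y} (hf : PolyTime f)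
    (ho : PolyTime o) (hg : PolyTime g) :
    PolyTime (fun x => (o x).elim (f x) fun z => g (x, z)) := by
  obtain ⟨r', hr'⟩ := ho.size_le
  obtain ⟨P, Nf, p, hP, hp⟩ := hf
  obtain ⟨Q, Ng, q, hQ, hq⟩ := hg
  obtain ⟨R, No, r, hR, hr⟩ := ho
  set N := max (max Nf Ng) No + 1 with hNdef
  have hN : 0 < N := by omega
  refine of_frame (N := N)
    (P := .seq (save N) <| .seq R <| .pop 0 fun o => o.elim (.seq (move N 0 (N + 1)) P)
      fun _ => .seq (.push 0 0) <| .seq (rev N (N + 1)) <|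
        .seq (pour (N + 1) 0 fun a => [1, a]) Q)
    (p := (6 * Polynomial.X + 2) + (r + (((6 * Polynomial.X + 2) + p +
      (1 + (3 * Polynomial.X + 1 + (4 * Polynomial.X + 1 +
        q.comp (2 * Polynomial.X + r' + 1))))) + 1)))
    hN ?_ fun x s hs => ?_
  · refine ⟨bdd_save (by omega), hR.mono (by omega), by omega,
      ⟨bdd_move (by omega) (by omega) (by omega), hP.mono (by omega)⟩, fun a =>
      ⟨⟨by omega, by omega⟩, bdd_rev (by omega) (by omega), bdd_pour (by omega) (by omega) ?_,
        hQ.mono (by omega)⟩⟩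
    simp
  · have h₁ := runLE_save hN (frame s N (enc x) [] [] []) (frame_one hN _ _ _ _)
      (frame_two _ _ _ _)
    rw [update_frame_one hN, frame_zero] at h₁
    have h₂ := run_frame hr (by omega) x s hs (enc x) [] []
    refine (h₁.seq <| h₂.seq (RunLE.pop (c := (6 * Polynomial.X + 2 + p +
      (1 + (3 * Polynomial.X + 1 + (4 * Polynomial.X + 1 +
        q.comp (2 * Polynomial.X + r' + 1))))).eval (size x)) ?_)).mono ?_
    · rw [frame_zero, update_frame_zero]
      have hs' := hr' x
      cases ho : o x with
      | none =>
        have h₄ := runLE_move (v := N) (w := 0) (t := N + 1) (by omega) (by omega) (by omega)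
          (frame s N [] (enc x) [] []) (frame_two _ _ _ _)
        rw [update_frame_one hN, update_frame_zero, frame_one hN, frame_zero,
          List.append_nil] at h₄
        have h₅ := run_frame hp (by omega) x s hs [] [] []
        refine (h₄.seq h₅).mono ?_
        simp only [Polynomial.eval_add, Polynomial.eval_mul,
          Polynomial.eval_X, Polynomial.eval_ofNat, Polynomial.eval_one]
        simp only [size]
        omega
      | some z =>
        have h₄ := RunLE.push 0 0 (frame s N (enc z) (enc x) [] [])
        rw [update_frame_zero, frame_zero] at h₄
        have h₅ := runLE_rev (v := N) (w := N + 1) (by omega)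
          (frame s N (0 :: enc z) (enc x) [] [])
        rw [update_frame_one hN, update_frame_two hN, frame_two, frame_one hN,
          List.append_nil] at h₅
        have h₆ := runLE_pour (v := N + 1) (w := 0) (by omega) (fun a => [1, a]) 2 (by simp)
          (frame s N (0 :: enc z) [] (enc x).reverse [])
        rw [update_frame_two hN, update_frame_zero, frame_two, frame_zero,
          List.reverse_reverse] at h₆
        have h₇ := run_frame hq (by omega) (x, z) s hs [] [] []
        refine (h₄.seq <| h₅.seq <| h₆.seq h₇).mono ?_
        rw [ho, size_some] at hs'
        have := q.eval_mono_nat (show size (x, z) ≤ 2 * size x + r'.eval (size x) + 1 by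
          rw [size_pair]; simp only; omega)
        simp only [List.length_reverse, Polynomial.eval_add, Polynomial.eval_mul,
          Polynomial.eval_comp,
          Polynomial.eval_X, Polynomial.eval_ofNat, Polynomial.eval_one]
        simp only [size] at *
        omega
    · simp only [Polynomial.eval_add, Polynomial.eval_mul, Polynomial.eval_comp,
        Polynomial.eval_X, Polynomial.eval_ofNat, Polynomial.eval_one]
      simp only [size]
      omega

/-- An element of `F` is a single symbol, so the program can contain a separate subprogram for each
of the finitely many values. Symbols that code no element never occur. -/
theorem finElim {F : Type} [Fintype F] [FinEnc F] {g : X → F} {h : F → X → Y} (hg : PolyTime g)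
    (hh : ∀ a, PolyTime (h a)) : PolyTime (fun x => h (g x) x) := by
  classical
  obtain ⟨Q, Ng, q, hQ, hq⟩ := hg
  choose P Nh p hP hp using hh
  set N := max Ng (Finset.univ.sup Nh) + 1 with hNdef
  have hNh : ∀ a, Nh a ≤ N := fun a => by
    have := Finset.le_sup (f := Nh) (Finset.mem_univ a)
    omega
  have hN : 0 < N := by omega
  refine of_frame (N := N)
    (P := .seq (save N) <| .seq Q <| .pop 0 fun o => o.elim .skip fun a =>
      if h : ∃ f : F, FinEnc.idx f = a then .seq (move N 0 (N + 1)) (P h.choose) else .skip)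
    (p := (6 * Polynomial.X + 2) + (q + (((6 * Polynomial.X + 2) + ∑ a, p a) + 1)))
    hN ?_ fun x s hs => ?_
  · refine ⟨bdd_save (by omega), hQ.mono (by omega), by omega, trivial, fun a => ?_⟩
    simp only [Option.elim]
    split_ifs with h
    · refine ⟨bdd_move (by omega) (by omega) (by omega), (hP _).mono ?_⟩
      have := hNh h.choose
      omega
    · trivial
  · have h₁ := runLE_save hN (frame s N (enc x) [] [] []) (frame_one hN _ _ _ _)
      (frame_two _ _ _ _)
    rw [update_frame_one hN, frame_zero] at h₁
    have h₂ := run_frame hq (by omega) x s hs (enc x) [] []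
    refine (h₁.seq <| h₂.seq (RunLE.pop (c := (6 * Polynomial.X + 2 + ∑ a, p a).eval (size x))
      ?_)).mono ?_
    · rw [frame_zero, update_frame_zero]
      have hex : ∃ f : F, FinEnc.idx f = FinEnc.idx (g x) := ⟨_, rfl⟩
      have he : hex.choose = g x := FinEnc.inj hex.choose_spec
      have h₄ := runLE_move (v := N) (w := 0) (t := N + 1) (by omega) (by omega) (by omega)
        (frame s N [] (enc x) [] []) (frame_two _ _ _ _)
      rw [update_frame_one hN, update_frame_zero, frame_one hN, frame_zero,
        List.append_nil] at h₄
      have h₅ := run_frame (hp (g x)) (hNh _) x s hs [] [] []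
      change RunLE (dite _ _ _) _ _ _
      rw [dif_pos hex, he]
      refine (h₄.seq h₅).mono ?_
      have := Finset.single_le_sum (f := fun a => (p a).eval (size x))
        (fun _ _ => Nat.zero_le _) (Finset.mem_univ (g x))
      simp only [Polynomial.eval_add, Polynomial.eval_mul, Polynomial.eval_finsetSum,
        Polynomial.eval_X, Polynomial.eval_ofNat]
      simp only [size] at *
      omega
    · simp only [Polynomial.eval_add, Polynomial.eval_mul, Polynomial.eval_finsetSum,
        Polynomial.eval_X, Polynomial.eval_ofNat, Polynomial.eval_one]
      simp only [size]
      omega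

/-- The unary code of `n x`, parked on the stack `N + 1`, drives the loop. The bound `b` for all
intermediate results is indispensable: a function that doubles the length would otherwise produce
exponentially long words. -/
theorem iterate {f : Y → Y} {n : X → ℕ} {y : X → Y} (hf : PolyTime f) (hn : PolyTime n)
    (hy : PolyTime y) {b : Polynomial ℕ}
    (hb : ∀ x, ∀ i ≤ n x, size (f^[i] (y x)) ≤ b.eval (size x)) :
    PolyTime (fun x => f^[n x] (y x)) := by
  obtain ⟨q', hq'⟩ := hn.size_le
  obtain ⟨R, Ny, r, hR, hr⟩ := hy
  obtain ⟨P, Nf, p, hP, hp⟩ := hf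
  obtain ⟨Q, Nn, q, hQ, hq⟩ := hn
  set N := max (max Nf Nn) Ny + 1 with hNdef
  have hN : 0 < N := by omega
  refine of_frame (N := N)
    (P := .seq (save N) <| .seq Q <| .seq (rev 0 (N + 1)) <| .seq (move N 0 (N + 2)) <|
      .seq R <| .loop (N + 1) fun _ => P)
    (p := (6 * Polynomial.X + 2) + (q + ((3 * q' + 1) + ((6 * Polynomial.X + 2) +
      (r + (q' * (p.comp b + 1) + 1))))))
    hN ?_ fun x s hs => ?_
  · exact ⟨bdd_save (by omega), hQ.mono (by omega), bdd_rev (by omega) (by omega),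
      bdd_move (by omega) (by omega) (by omega), hR.mono (by omega), by omega,
      fun a => hP.mono (by omega)⟩
  · have h₁ := runLE_save hN (frame s N (enc x) [] [] []) (frame_one hN _ _ _ _)
      (frame_two _ _ _ _)
    rw [update_frame_one hN, frame_zero] at h₁
    have h₂ := run_frame hq (by omega) x s hs (enc x) [] []
    have h₃ := runLE_rev (v := 0) (w := N + 1) (by omega) (frame s N (enc (n x)) (enc x) [] [])
    rw [update_frame_zero, update_frame_two hN, frame_zero, frame_two, List.append_nil] at h₃
    have h₄ := runLE_move (v := N) (w := 0) (t := N + 2) (by omega) (by omega) (by omega)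
      (frame s N [] (enc x) (enc (n x)).reverse []) (frame_three _ _ _ _)
    rw [update_frame_one hN, update_frame_zero, frame_one hN, frame_zero, List.append_nil] at h₄
    have key : ∀ j i, i + j = n x → RunLE (.loop (N + 1) fun _ => P)
        (frame s N (enc (f^[i] (y x))) [] (List.replicate j 1) [])
        (frame s N (enc (f^[i + j] (y x))) [] [] []) (j * ((p.comp b).eval (size x) + 1) + 1) := by
      intro j
      induction j with
      | zero => intro i _; exact (RunLE.loop_nil (frame_two _ _ _ _)).mono (by simp)
      | succ j ih =>
        intro i hi
        have h := run_frame hp (N := N) (by omega) (f^[i] (y x)) s hs [] (List.replicate j 1) []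
        have h' := ih (i + 1) (by omega)
        rw [iterate_succ_apply'] at h'
        have h0 : frame s N (enc (f^[i] (y x))) [] (List.replicate (j + 1) 1) [] (N + 1) =
          1 :: List.replicate j 1 := frame_two _ _ _ _
        rw [← update_frame_two (s := s) hN _ _ (List.replicate (j + 1) 1)] at h
        refine ((RunLE.loop_cons h0 h h').congr ?_).mono ?_
        · congr 3; omega
        · have := p.eval_mono_nat (hb x i (by omega))
          rw [Polynomial.eval_comp, Nat.succ_mul]
          omega
    have h₆ := run_frame hr (N := N) (by omega) x s hs [] (List.replicate (n x) 1) []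
    have h₅ := key (n x) 0 (by omega)
    rw [Nat.zero_add, iterate_zero, _root_.id] at h₅
    have hrev : (enc (n x)).reverse = List.replicate (n x) 1 := List.reverse_replicate
    rw [hrev] at h₃ h₄
    refine (h₁.seq <| h₂.seq <| h₃.seq <| h₄.seq <| h₆.seq h₅).mono ?_
    have h6 := hq' x
    have h7 := Nat.mul_le_mul_right ((p.comp b).eval (size x) + 1) h6
    rw [size_nat] at h6 h7
    have h8 : (enc (n x)).length = n x := size_nat _
    simp only [Polynomial.eval_add, Polynomial.eval_mul,
      Polynomial.eval_X, Polynomial.eval_ofNat, Polynomial.eval_one]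
    simp only [size] at *
    omega

/-- The first bit and the remaining bits. -/
def _root_.Bits.uncons (l : Bits) : Option (Bool × Bits) :=
  l.bits.head?.map fun a => (a, ⟨l.bits.tail⟩)

theorem bitsUncons : PolyTime Bits.uncons := by
  -- The code of `some (a, l)` consists of `1` for `some`, of `1, a, 0` for the first component, and
  -- of the code of `l`; the four symbols are pushed from right to left.
  refine ⟨.pop 0 fun o => o.elim .skip fun a => .seq (.push 0 0) <| .seq (.push 0 a) <|
    .seq (.push 0 1) (.push 0 1), 2, 5,
    ⟨by omega, trivial, fun a => ⟨⟨by omega, by omega⟩, ⟨by omega, by omega⟩, ⟨by omega, by omega⟩,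
      by omega, by omega⟩⟩, fun l s h0 hs => ?_⟩
  rcases l with ⟨_ | ⟨a, l⟩⟩
  · refine (RunLE.pop (c := 4) ?_).mono (by simp)
    rw [h0]
    refine ((RunLE.skip _).congr ?_).mono (by omega)
    rfl
  · refine (RunLE.pop (c := 4) ?_).mono (by simp)
    rw [h0]
    refine (((RunLE.push _ _ _).seq <| (RunLE.push _ _ _).seq <| (RunLE.push _ _ _).seq <|
      RunLE.push _ _ _).congr ?_).mono (by omega)
    simp [enc, encPair, Bits.uncons, FinEnc.idx]

theorem bitsCons {b : X → Bool} {l : X → Bits} (hb : PolyTime b) (hl : PolyTime l) :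
    PolyTime (fun x => (⟨b x :: (l x).bits⟩ : Bits)) := by
  have h : ∀ a : Bool, PolyTime (fun l : Bits => (⟨a :: l.bits⟩ : Bits)) := fun a =>
    of_enc_append [a.toNat] fun l => rfl
  exact finElim (h := fun a x => (⟨a :: (l x).bits⟩ : Bits)) hb fun a => (h a).comp hl

end PolyTime

/-! ## Programs that simulate stack machines -/

namespace Prog

open Function

section simulate

variable {K Λ σ : Type} {Γ : K → Type}

/-- The symbols that a statement may push. -/
def pushed : TM2.Stmt Γ Λ σ → Set ((k : K) × Γ k)
  | .push k f q => Set.range (fun v => (⟨k, f v⟩ : (k : K) × Γ k)) ∪ pushed q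
  | .peek _ _ q => pushed q
  | .pop _ _ q => pushed q
  | .load _ q => pushed q
  | .branch _ q₁ q₂ => pushed q₁ ∪ pushed q₂
  | .goto _ => ∅
  | .halt => ∅

/-- Only the alphabet of the input stack of a machine is required to be finite. Nevertheless only
finitely many symbols can occur in a computation, since a pushed symbol is a function of the
internal state. -/
theorem pushed_finite [Finite σ] (q : TM2.Stmt Γ Λ σ) : (pushed q).Finite := by
  induction q with
  | push k f q ih => exact (Set.finite_range _).union ih
  | peek _ _ q ih => exact ih
  | pop _ _ q ih => exact ih
  | load _ q ih => exact ih
  | branch _ q₁ q₂ h₁ h₂ => exact h₁.union h₂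
  | goto _ => exact Set.finite_empty
  | halt => exact Set.finite_empty

/-- A bound for the cost of simulating a statement. -/
def cost : TM2.Stmt Γ Λ σ → ℕ
  | .push _ _ q => cost q + 1
  | .peek _ _ q => cost q + 2
  | .pop _ _ q => cost q + 1
  | .load _ q => cost q
  | .branch _ q₁ q₂ => max (cost q₁) (cost q₂)
  | .goto _ => 1
  | .halt => 1

variable (V : K → ℕ) (L : ℕ) (cs : ∀ k, Γ k → ℕ) (ds : ∀ k, ℕ → Option (Γ k)) (cl : Λ × σ → ℕ)

/-- The program that simulates a statement in the given internal state. The stack `V k` holds the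
codes of the symbols on the stack `k`. The new label and internal state are pushed on the
stack `L`. -/
def simStmt : TM2.Stmt Γ Λ σ → σ → Prog
  | .push k f q, v => .seq (.push (V k) (cs k (f v))) (simStmt q v)
  | .peek k f q, v => .pop (V k) fun o => o.elim (simStmt q (f v none)) fun a =>
      .seq (.push (V k) a) (simStmt q (f v (ds k a)))
  | .pop k f q, v => .pop (V k) fun o => o.elim (simStmt q (f v none)) fun a =>
      simStmt q (f v (ds k a))
  | .load f q, v => simStmt q (f v)
  | .branch p q₁ q₂, v => if p v then simStmt q₁ v else simStmt q₂ v
  | .goto l, v => .push L (cl (l v, v))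
  | .halt, _ => .skip

theorem bdd_simStmt {N : ℕ} (hV : ∀ k, V k < N) (hL : L < N) (hcl : ∀ x, cl x < N)
    (q : TM2.Stmt Γ Λ σ) (hcs : ∀ x ∈ pushed q, cs x.1 x.2 < N) (v : σ) :
    (simStmt V L cs ds cl q v).Bdd N := by
  induction q generalizing v with
  | push k f q ih =>
    exact ⟨⟨hV k, hcs ⟨k, f v⟩ (Or.inl ⟨v, rfl⟩)⟩, ih (fun x hx => hcs x (Or.inr hx)) v⟩
  | peek k f q ih =>
    exact ⟨hV k, ih hcs _, fun a => ⟨⟨(hV k).trans_le (le_max_left _ _), by omega⟩,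
      (ih hcs _).mono (le_max_left _ _)⟩⟩
  | pop k f q ih => exact ⟨hV k, ih hcs _, fun a => (ih hcs _).mono (le_max_left _ _)⟩
  | load f q ih => exact ih hcs _
  | branch p q₁ q₂ h₁ h₂ =>
    simp only [simStmt]
    split_ifs
    · exact h₁ (fun x hx => hcs x (Or.inl hx)) v
    · exact h₂ (fun x hx => hcs x (Or.inr hx)) v
  | goto l => exact ⟨hL, hcl _⟩
  | halt => trivial

open Classical in
/-- The store that represents the stacks `S`. -/
noncomputable def simStore (s : Store) (S : ∀ k, List (Γ k)) (lab : List ℕ) : Store := fun i =>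
  if i = L then lab else if h : ∃ k, V k = i then (S h.choose).map (cs h.choose) else s i

variable {V L cs ds cl} (hV : Injective V) (hL : ∀ k, V k ≠ L)

theorem simStore_label (s : Store) (S : ∀ k, List (Γ k)) (lab : List ℕ) :
    simStore V L cs s S lab L = lab := if_pos rfl

theorem update_simStore_label (s : Store) (S : ∀ k, List (Γ k)) (lab lab' : List ℕ) :
    update (simStore V L cs s S lab) L lab' = simStore V L cs s S lab' := by
  funext i
  by_cases h : i = L
  · subst h; rw [update_self, simStore_label]
  · rw [update_of_ne h]; simp [simStore, h]

include hV hL in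
theorem simStore_stack (s : Store) (S : ∀ k, List (Γ k)) (lab : List ℕ) (k : K) :
    simStore V L cs s S lab (V k) = (S k).map (cs k) := by
  have h : ∃ k', V k' = V k := ⟨k, rfl⟩
  rw [simStore, if_neg (hL k), dif_pos h]
  exact congrArg (fun k => (S k).map (cs k)) (hV h.choose_spec)

theorem simStore_other (s : Store) (S : ∀ k, List (Γ k)) (lab : List ℕ) {i : ℕ} (hi : i ≠ L)
    (h : ∀ k, V k ≠ i) : simStore V L cs s S lab i = s i := by
  rw [simStore, if_neg hi, dif_neg (by simpa using h)]

include hV hL in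
theorem update_simStore_stack [DecidableEq K] (s : Store) (S : ∀ k, List (Γ k)) (lab : List ℕ)
    (k : K) (l : List (Γ k)) : update (simStore V L cs s S lab) (V k) (l.map (cs k)) =
      simStore V L cs s (update S k l) lab := by
  funext i
  by_cases h : i = V k
  · subst h; rw [update_self, simStore_stack hV hL, update_self]
  · rw [update_of_ne h]
    by_cases h' : i = L
    · subst h'; rw [simStore_label, simStore_label]
    · by_cases h'' : ∃ k', V k' = i
      · obtain ⟨k', rfl⟩ := h''
        rw [simStore_stack hV hL, simStore_stack hV hL,
          update_of_ne (show k' ≠ k from fun hk => h (by rw [hk]))]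
      · rw [simStore_other _ _ _ h' (by simpa using h''),
          simStore_other _ _ _ h' (by simpa using h'')]

variable {D : Set ((k : K) × Γ k)} (hds : ∀ x ∈ D, ds x.1 (cs x.1 x.2) = some x.2)

-- The internal state is a parameter of the program rather than data, so loading and branching cost
-- nothing. All symbols on the stacks stay in `D`, where `ds` inverts the coding `cs`; hence reading
-- a code is as good as reading the symbol. The stack `L` remains empty exactly if the statement
-- halts.
include hV hL hds in
theorem runLE_simStmt [DecidableEq K] (s : Store) (q : TM2.Stmt Γ Λ σ) (hq : pushed q ⊆ D) (v : σ)
    (S : ∀ k, List (Γ k)) (hS : ∀ k, ∀ a ∈ S k, (⟨k, a⟩ : (k : K) × Γ k) ∈ D) :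
    (∀ k, ∀ a ∈ (TM2.stepAux q v S).stk k, (⟨k, a⟩ : (k : K) × Γ k) ∈ D) ∧
    RunLE (simStmt V L cs ds cl q v) (simStore V L cs s S [])
      (simStore V L cs s (TM2.stepAux q v S).stk
        ((TM2.stepAux q v S).l.elim [] fun l => [cl (l, (TM2.stepAux q v S).var)])) (cost q) := by
  induction q generalizing v S with
  | push k f q ih =>
    obtain ⟨h₁, h₂⟩ := ih (fun x hx => hq (Or.inr hx)) v (update S k (f v :: S k)) (by
      intro k' a ha
      by_cases h : k' = k
      · subst h
        rw [update_self] at ha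
        rcases List.mem_cons.mp ha with rfl | ha
        · exact hq (Or.inl ⟨v, rfl⟩)
        · exact hS _ _ ha
      · rw [update_of_ne h] at ha
        exact hS _ _ ha)
    refine ⟨h₁, ?_⟩
    have h := RunLE.push (V k) (cs k (f v)) (simStore V L cs s S [])
    rw [simStore_stack hV hL, ← List.map_cons, update_simStore_stack hV hL] at h
    exact (h.seq h₂).mono (by rw [cost, add_comm])
  | peek k f q ih =>
    obtain ⟨h₁, h₂⟩ := ih hq (f v (S k).head?) S hS
    refine ⟨h₁, (RunLE.pop (c := cost q + 1) ?_).mono le_rfl⟩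
    rw [simStore_stack hV hL, ← List.map_tail, update_simStore_stack hV hL, List.head?_map]
    cases hk : S k with
    | nil =>
      have hh : (S k).head? = none := by rw [hk]; rfl
      have e : update S k ([] : List (Γ k)).tail = S := by
        rw [List.tail_nil, ← hk, update_eq_self]
      rw [hh] at h₂
      rw [e]
      simp only [TM2.stepAux, hh]
      exact h₂.mono (Nat.le_succ _)
    | cons a l =>
      have hh : (S k).head? = some a := by rw [hk]; rfl
      have had : ds k (cs k a) = some a := hds ⟨k, a⟩ (hS k a (by simp [hk]))
      have h := RunLE.push (V k) (cs k a) (simStore V L cs s (update S k l) [])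
      have e : update S k (a :: l) = S := by rw [← hk, update_eq_self]
      rw [simStore_stack hV hL, update_self, ← List.map_cons, update_simStore_stack hV hL,
        update_idem, e] at h
      rw [hh] at h₂
      simp only [TM2.stepAux, hh, List.tail_cons]
      change RunLE (.seq _ (simStmt V L cs ds cl q (f v (ds k (cs k a))))) _ _ _
      rw [had]
      exact (h.seq h₂).mono (by omega)
  | pop k f q ih =>
    obtain ⟨h₁, h₂⟩ := ih hq (f v (S k).head?) (update S k (S k).tail) (by
      intro k' a ha
      by_cases h : k' = k
      · subst h
        rw [update_self] at ha
        exact hS _ _ (List.mem_of_mem_tail ha)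
      · rw [update_of_ne h] at ha
        exact hS _ _ ha)
    refine ⟨h₁, (RunLE.pop (c := cost q) ?_).mono le_rfl⟩
    rw [simStore_stack hV hL, ← List.map_tail, update_simStore_stack hV hL]
    rw [List.head?_map]
    cases hh : (S k).head? with
    | none =>
      rw [hh] at h₂
      simp only [TM2.stepAux, hh]
      exact h₂
    | some a =>
      have had : ds k (cs k a) = some a := hds ⟨k, a⟩ (hS k a (List.mem_of_head? hh))
      rw [hh] at h₂
      simp only [TM2.stepAux, hh]
      change RunLE (simStmt V L cs ds cl q (f v (ds k (cs k a)))) _ _ _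
      rw [had]
      exact h₂
  | load f q ih => exact ih hq (f v) S hS
  | branch p q₁ q₂ ih₁ ih₂ =>
    simp only [TM2.stepAux, simStmt]
    cases hp : p v with
    | true =>
      obtain ⟨h₁, h₂⟩ := ih₁ (fun x hx => hq (Or.inl hx)) v S hS
      exact ⟨h₁, h₂.mono (le_max_left _ _)⟩
    | false =>
      obtain ⟨h₁, h₂⟩ := ih₂ (fun x hx => hq (Or.inr hx)) v S hS
      exact ⟨h₁, h₂.mono (le_max_right _ _)⟩
  | goto l =>
    refine ⟨hS, ?_⟩
    have h := RunLE.push L (cl (l v, v)) (simStore V L cs s S [])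
    rwa [simStore_label, update_simStore_label] at h
  | halt => exact ⟨hS, RunLE.skip _⟩

variable (V L cs ds cl) in
open Classical in
/-- The program that simulates a machine, given a label and an internal state on the stack `L`. -/
noncomputable def simMachine (m : Λ → TM2.Stmt Γ Λ σ) : Prog :=
  .loop L fun a => if h : ∃ x, cl x = a then simStmt V L cs ds cl (m h.choose.1) h.choose.2
    else .skip

variable (V L cs ds cl) in
theorem bdd_simMachine {N : ℕ} (hV : ∀ k, V k < N) (hL : L < N) (hcl : ∀ x, cl x < N)
    (m : Λ → TM2.Stmt Γ Λ σ) (hcs : ∀ l, ∀ x ∈ pushed (m l), cs x.1 x.2 < N) :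
    (simMachine V L cs ds cl m).Bdd N := by
  refine ⟨hL, fun a => ?_⟩
  beta_reduce
  split_ifs with h
  · exact (bdd_simStmt V L cs ds cl hV hL hcl _ (hcs _) _).mono (le_max_left _ _)
  · trivial

variable (hcl : Injective cl)

-- The stack `L` holds one symbol for label and internal state as long as the simulated machine
-- runs, and none once it has halted, so the loop ends at the right moment. Each round costs at most
-- `C` steps and one for the loop.
include hV hL hds hcl in
theorem runLE_simMachine [DecidableEq K] (s : Store) (m : Λ → TM2.Stmt Γ Λ σ)
    (hm : ∀ l, pushed (m l) ⊆ D) {C : ℕ} (hC : ∀ l, cost (m l) ≤ C) (n : ℕ) (l : Option Λ) (v : σ)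
    (S : ∀ k, List (Γ k)) (hS : ∀ k, ∀ a ∈ S k, (⟨k, a⟩ : (k : K) × Γ k) ∈ D)
    (v' : σ) (S' : ∀ k, List (Γ k)) (h : Steps m n ⟨l, v, S⟩ ⟨none, v', S'⟩) :
    (∀ k, ∀ a ∈ S' k, (⟨k, a⟩ : (k : K) × Γ k) ∈ D) ∧
    RunLE (simMachine V L cs ds cl m) (simStore V L cs s S (l.elim [] fun l => [cl (l, v)]))
      (simStore V L cs s S' []) (n * (C + 1) + 1) := by
  induction n generalizing l v S with
  | zero =>
    simp only [Steps, iterate_zero, _root_.id, Option.some.injEq, TM2.Cfg.mk.injEq] at h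
    obtain ⟨rfl, rfl, rfl⟩ := h
    exact ⟨hS, (RunLE.loop_nil (simStore_label _ _ _)).mono (by omega)⟩
  | succ n ih =>
    rw [Steps, iterate_succ_apply] at h
    cases l with
    | none =>
      -- A halted configuration has no successor, so no run of exactly `n + 1` steps starts there.
      have : ∀ n, (flip bind (TM2.step m))^[n] none = none := fun n =>
        iterate_fixed rfl n
      exact absurd (this n ▸ h : none = some _) (by simp)
    | some l =>
      obtain ⟨h₁, h₂⟩ := runLE_simStmt (cl := cl) hV hL hds s (m l) (hm l) v S hS
      obtain ⟨h₃, h₄⟩ := ih (TM2.stepAux (m l) v S).l (TM2.stepAux (m l) v S).var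
        (TM2.stepAux (m l) v S).stk h₁ h
      refine ⟨h₃, ?_⟩
      have hex : ∃ x, cl x = cl (l, v) := ⟨_, rfl⟩
      have he : hex.choose = (l, v) := hcl hex.choose_spec
      refine (RunLE.loop_cons (simStore_label _ _ _) ?_ h₄).mono
        (c := C + (n * (C + 1) + 1) + 1) (by rw [Nat.succ_mul]; omega)
      rw [update_simStore_label]
      rw [dif_pos hex, he]
      exact h₂.mono (hC l)

end simulate

end Prog

theorem unaryEncodeNat_eq (n : ℕ) : unaryEncodeNat n = List.replicate n true := by
  induction n with
  | zero => rfl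
  | succ n ih => rw [unaryEncodeNat, ih, List.replicate_succ]

open Prog Function in
/-- A function of unary numbers that is computed by a stack machine in polynomial time. -/
theorem PolyTime.of_stackMachine {v : ℕ → List Bool}
    (h : TM2ComputableInPolyTime unaryEncodingNat.encode (fun l : List Bool => l) v) :
    PolyTime (fun n : ℕ => (⟨v n⟩ : Bits)) := by
  classical
  obtain ⟨⟨tm, α, β⟩, time, hout⟩ := h
  have := tm.kFin
  have := tm.ΛFin
  have := tm.σFin
  -- The symbols that can occur: those pushed by some statement and those of the input.
  set D : Set ((k : tm.K) × tm.Γ k) :=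
    (⋃ l, pushed (tm.m l)) ∪ Set.range fun b => ⟨tm.k₀, α.symm b⟩ with hD
  have hDf : D.Finite :=
    (Set.finite_iUnion fun l => pushed_finite (tm.m l)).union (Set.finite_range _)
  obtain ⟨f, hf⟩ := Set.countable_iff_exists_injOn.mp hDf.countable
  let cs : ∀ k, tm.Γ k → ℕ := fun k a => f ⟨k, a⟩
  let ds : ∀ k, ℕ → Option (tm.Γ k) := fun k a =>
    if h : ∃ γ : tm.Γ k, (⟨k, γ⟩ : (k : tm.K) × tm.Γ k) ∈ D ∧ f ⟨k, γ⟩ = a then some h.choose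
    else none
  have hds : ∀ x ∈ D, ds x.1 (cs x.1 x.2) = some x.2 := by
    rintro ⟨k, γ⟩ hx
    have hex : ∃ γ' : tm.Γ k, (⟨k, γ'⟩ : (k : tm.K) × tm.Γ k) ∈ D ∧ f ⟨k, γ'⟩ = f ⟨k, γ⟩ :=
      ⟨γ, hx, rfl⟩
    have he := hf hex.choose_spec.1 hx hex.choose_spec.2
    exact (dif_pos hex).trans (congrArg some (sigma_mk_injective he))
  -- The stacks below `3` are reserved: `0` for input and output, `1` for reversing the output, `2`
  -- for the label.
  let V : tm.K → ℕ := fun k => 3 + (Fintype.equivFin tm.K k).val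
  have hV : Injective V := fun k k' h => by
    have : (Fintype.equivFin tm.K k).val = (Fintype.equivFin tm.K k').val := by
      simp only [V] at h; omega
    exact (Fintype.equivFin tm.K).injective (Fin.ext this)
  have hL : ∀ k, V k ≠ 2 := fun k => by simp only [V]; omega
  let cl : tm.Λ × tm.σ → ℕ := fun x => (Fintype.equivFin (tm.Λ × tm.σ) x).val
  have hcl : Injective cl := fun x y h => (Fintype.equivFin _).injective (Fin.ext h)
  obtain ⟨B, hB⟩ : ∃ B, ∀ x ∈ D, f x < B := by
    obtain ⟨B, hB⟩ := (hDf.image f).bddAbove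
    exact ⟨B + 1, fun x hx => Nat.lt_succ_of_le (hB ⟨x, hx, rfl⟩)⟩
  set N := 3 + Fintype.card tm.K + Fintype.card (tm.Λ × tm.σ) + B + 2 with hN
  have hVN : ∀ k, V k < N := fun k => by
    have := (Fintype.equivFin tm.K k).isLt
    simp only [V]; omega
  have hclN : ∀ x, cl x < N := fun x => by
    have := (Fintype.equivFin (tm.Λ × tm.σ) x).isLt
    simp only [cl]; omega
  have hpush : ∀ l, pushed (tm.m l) ⊆ D := fun l x hx => Or.inl (Set.mem_iUnion.mpr ⟨l, hx⟩)
  have hin : ∀ b, (⟨tm.k₀, α.symm b⟩ : (k : tm.K) × tm.Γ k) ∈ D := fun b => Or.inr ⟨b, rfl⟩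
  let c₀ := cs tm.k₀ (α.symm true)
  let out : ℕ → ℕ := fun a => (ds tm.k₁ a).elim 0 fun γ => (β γ).toNat
  have hout2 : ∀ a, out a < 2 := fun a => by
    cases h : ds tm.k₁ a with
    | none => simp [out, h]
    | some γ => simp only [out, h, Option.elim]; exact Bool.toNat_lt _
  obtain ⟨C, hC⟩ : ∃ C, ∀ l, cost (tm.m l) ≤ C :=
    ⟨Finset.univ.sup fun l => cost (tm.m l), fun l =>
      Finset.le_sup (f := fun l => cost (tm.m l)) (Finset.mem_univ l)⟩
  refine ⟨.seq (pour 0 (V tm.k₀) fun _ => [c₀]) <| .seq (.push 2 (cl (tm.main, tm.initialState))) <|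
    .seq (simMachine V 2 cs ds cl tm.m) <| .seq (pour (V tm.k₁) 1 fun a => [out a]) (rev 1 0), N,
    (3 * Polynomial.X + 1) + (1 + ((time * ((C + 1 : ℕ) : Polynomial ℕ) + 1) +
      ((3 * (3 * Polynomial.X + 2 + (time * ((C + 1 : ℕ) : Polynomial ℕ) + 1)) + 1) +
        (3 * (3 * Polynomial.X + 2 + (time * ((C + 1 : ℕ) : Polynomial ℕ) + 1)) + 1)))),
    ⟨bdd_pour (by omega) (hVN _) ?_, ⟨by omega, hclN _⟩,
      bdd_simMachine V 2 cs ds cl hVN (by omega) hclN _ ?_, bdd_pour (hVN _) (by omega) ?_,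
      bdd_rev (by omega) (by omega)⟩, fun n s h0 hs => ?_⟩
  · intro a b hb
    rw [List.mem_singleton] at hb
    subst hb
    exact ((hB _ (hin true)).trans_le (by omega)).trans_le (le_max_left _ _)
  · intro l x hx
    exact (hB _ (hpush l hx)).trans_le (by omega)
  · intro a b hb
    rw [List.mem_singleton] at hb
    subst hb
    exact (hout2 a).trans_le (by omega)
  · set s₀ : Store := update s 0 [] with hs₀
    have hs₀' : ∀ i, i < N → s₀ i = [] := fun i hi => by
      by_cases h : i = 0
      · subst h; simp [hs₀]
      · rw [hs₀, update_of_ne h, hs i (by omega) hi]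
    have hempty : simStore V 2 cs s₀ (fun _ => []) [] = s₀ := by
      funext i
      by_cases h : i = 2
      · subst h; rw [simStore_label, hs₀' 2 (by omega)]
      · by_cases h' : ∃ k, V k = i
        · obtain ⟨k, rfl⟩ := h'
          rw [simStore_stack hV hL, hs₀' _ (hVN k), List.map_nil]
        · rw [simStore_other _ _ _ h (by simpa using h')]
    have hstk : ∀ (k₀ : tm.K) (l : List (tm.Γ k₀)),
        update s₀ (V k₀) (l.map (cs k₀)) = simStore V 2 cs s₀ (update (fun _ => []) k₀ l) [] := by
      intro k₀ l
      rw [← update_simStore_stack hV hL, hempty]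
    have hn : (enc n).reverse.flatMap (fun _ => [c₀]) =
        (List.replicate n (α.symm true)).map (cs tm.k₀) := by
      have : (enc n).reverse = List.replicate n 1 := List.reverse_replicate
      rw [this, List.map_replicate]
      clear * -
      induction n with
      | zero => rfl
      | succ n ih => rw [List.replicate_succ, List.replicate_succ, List.flatMap_cons, ih]; rfl
    have h₁ := runLE_pour (v := 0) (w := V tm.k₀) (by simp only [V]; omega) (fun _ => [c₀]) 1
      (by simp) s
    rw [h0, hn, hs _ (by simp only [V]; omega) (hVN _), List.append_nil, ← hs₀, hstk] at h₁
    have h₂ := RunLE.push 2 (cl (tm.main, tm.initialState))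
      (simStore V 2 cs s₀ (update (fun _ => []) tm.k₀ (List.replicate n (α.symm true))) [])
    rw [simStore_label, update_simStore_label] at h₂
    obtain ⟨⟨steps, hsteps⟩, hle⟩ := hout n
    have hi : initList tm ((unaryEncodingNat.encode n).map α.invFun) =
        (⟨some tm.main, tm.initialState,
          update (fun _ => []) tm.k₀ (List.replicate n (α.symm true))⟩ : TM2.Cfg _ _ _) := by
      refine congrArg (TM2.Cfg.mk _ _) ?_
      have : (unaryEncodingNat.encode n).map α.invFun = List.replicate n (α.symm true) := by
        change (unaryEncodeNat n).map α.symm = _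
        rw [unaryEncodeNat_eq, List.map_replicate]
      rw [this]
      funext k
      by_cases h : k = tm.k₀
      · subst h; simp
      · simp [h]
    have ho : haltList tm ((v n).map β.invFun) =
        (⟨none, tm.initialState, update (fun _ => []) tm.k₁ ((v n).map β.symm)⟩ :
          TM2.Cfg _ _ _) := by
      refine congrArg (TM2.Cfg.mk _ _) ?_
      funext k
      by_cases h : k = tm.k₁
      · subst h; simp
      · simp [h]
    rw [Option.map_some, hi, ho] at hsteps
    obtain ⟨hD', h₃⟩ := runLE_simMachine hV hL hds hcl s₀ tm.m hpush hC steps (some tm.main)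
      tm.initialState _ (fun k a ha => by
        by_cases h : k = tm.k₀
        · subst h
          rw [update_self] at ha
          rw [List.eq_of_mem_replicate ha]
          exact hin true
        · rw [update_of_ne h] at ha
          simp at ha) _ _ hsteps
    rw [← hstk] at h₃
    have h₄ := runLE_pour (v := V tm.k₁) (w := 1) (by simp only [V]; omega) (fun a => [out a]) 1
      (by simp) (update s₀ (V tm.k₁) (((v n).map β.symm).map (cs tm.k₁)))
    have hV1 : (1 : ℕ) ≠ V tm.k₁ := by simp only [V]; omega
    rw [update_idem, update_self, update_of_ne hV1, hs₀' 1 (by omega), List.append_nil] at h₄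
    have h₅ := runLE_rev (v := 1) (w := 0) (by omega) (update (update s₀ (V tm.k₁) []) 1
      ((((v n).map β.symm).map (cs tm.k₁)).reverse.flatMap fun a => [out a]))
    -- The time for copying the output depends on its length, which is bounded by the time used so
    -- far.
    have hlen : (v n).length ≤ 3 * n + 2 + (steps * (C + 1) + 1) := by
      obtain ⟨c, hc, hr⟩ := h₁.seq (h₂.seq h₃)
      have := hr.length_le (V tm.k₁)
      rw [update_self, hs _ (by simp only [V]; omega) (hVN _), List.length_map, List.length_map,
        List.length_nil] at this
      have h6 : (enc n).length = n := size_nat n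
      omega
    have hD'' : ∀ b ∈ v n, out (cs tm.k₁ (β.symm b)) = b.toNat := fun b hb => by
      have h6 := hD' tm.k₁ (β.symm b) (by
        rw [update_self]; exact List.mem_map_of_mem hb)
      have h7 : ds tm.k₁ (cs tm.k₁ (β.symm b)) = some (β.symm b) := hds _ h6
      simp only [out, h7, Option.elim, Equiv.apply_symm_apply]
    have hW : ((((v n).map β.symm).map (cs tm.k₁)).reverse.flatMap fun a => [out a]) =
        ((v n).map Bool.toNat).reverse := by
      rw [← List.map_eq_flatMap, List.map_reverse, List.map_map, List.map_map]
      congr 1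
      exact List.map_congr_left hD''
    rw [hW] at h₄ h₅
    refine ((h₁.seq <| h₂.seq <| h₃.seq <| h₄.seq h₅).congr ?_).mono ?_
    · have hV0 : (0 : ℕ) ≠ V tm.k₁ := by simp only [V]; omega
      have e : update s₀ (V tm.k₁) [] = s₀ := by
        rw [← hs₀' _ (hVN tm.k₁), update_eq_self]
      have e' : update s₀ 1 [] = s₀ := by
        rw [← hs₀' 1 (by omega), update_eq_self]
      rw [e, update_idem, update_self, e', update_of_ne (by omega), hs₀' 0 (by omega),
        List.append_nil, List.reverse_reverse, hs₀, update_idem]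
      rfl
    · have h6 : (enc n).length = n := size_nat n
      have h7 : (unaryEncodingNat.encode n).length = n := by
        change (unaryEncodeNat n).length = n
        rw [unaryEncodeNat_eq, List.length_replicate]
      rw [h7] at hle
      change steps ≤ _ at hle
      have h8 := Nat.mul_le_mul_right (C + 1) hle
      simp only [Polynomial.eval_add, Polynomial.eval_mul, Polynomial.eval_X,
        Polynomial.eval_ofNat, Polynomial.eval_one, Polynomial.eval_natCast, update_self,
        List.length_map, List.length_reverse, size_nat, h6, Nat.cast_id]
      omega

/-! ## A library of functions computable in polynomial time -/

/-- `f` is bounded by a polynomial in the length of the code. -/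
def PolyBdd {X : Type} [Enc X] (f : X → ℕ) : Prop := ∃ p : Polynomial ℕ, ∀ x, f x ≤ p.eval (size x)

namespace PolyBdd

variable {X Y : Type} [Enc X] [Enc Y] {f g : X → ℕ}

theorem mono (hg : PolyBdd g) (h : ∀ x, f x ≤ g x) : PolyBdd f :=
  let ⟨p, hp⟩ := hg
  ⟨p, fun x => (h x).trans (hp x)⟩

theorem const (n : ℕ) : PolyBdd (fun _ : X => n) := ⟨(n : Polynomial ℕ), fun x => by simp⟩

theorem add (hf : PolyBdd f) (hg : PolyBdd g) : PolyBdd (fun x => f x + g x) :=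
  let ⟨p, hp⟩ := hf
  let ⟨q, hq⟩ := hg
  ⟨p + q, fun x => by rw [Polynomial.eval_add]; exact Nat.add_le_add (hp x) (hq x)⟩

theorem mul (hf : PolyBdd f) (hg : PolyBdd g) : PolyBdd (fun x => f x * g x) :=
  let ⟨p, hp⟩ := hf
  let ⟨q, hq⟩ := hg
  ⟨p * q, fun x => by rw [Polynomial.eval_mul]; exact Nat.mul_le_mul (hp x) (hq x)⟩

theorem size {h : X → Y} (hh : PolyTime h) : PolyBdd (fun x => size (h x)) := hh.size_le

theorem nat (hf : PolyTime f) : PolyBdd f := (size hf).mono fun x => by simp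

theorem poly (hf : PolyBdd f) (p : Polynomial ℕ) : PolyBdd (fun x => p.eval (f x)) :=
  let ⟨q, hq⟩ := hf
  ⟨p.comp q, fun x => by rw [Polynomial.eval_comp]; exact p.eval_mono_nat (hq x)⟩

end PolyBdd

namespace PolyTime

variable {X Y Z S A : Type} [Enc X] [Enc Y] [Enc Z] [Enc S] [Enc A]

theorem of_enc_congr {f : X → Y} {g : X → Z} (hg : PolyTime g) (h : ∀ x, enc (f x) = enc (g x)) :
    PolyTime f := by
  obtain ⟨P, N, p, hP, hp⟩ := hg
  exact ⟨P, N, p, hP, fun x s h0 hs => by rw [h]; exact hp x s h0 hs⟩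

theorem some {f : X → Y} (hf : PolyTime f) : PolyTime (fun x => some (f x)) :=
  (of_enc_append (f := fun y : Y => Option.some y) [1] fun _ => rfl).comp hf

theorem cons {f : X → A} {g : X → List A} (hf : PolyTime f) (hg : PolyTime g) :
    PolyTime (fun x => f x :: g x) :=
  (of_enc_append (f := fun y : A × List A => y.1 :: y.2) [1] fun _ => rfl).comp (hf.pair hg)

theorem succ {f : X → ℕ} (hf : PolyTime f) : PolyTime (fun x => f x + 1) :=
  (of_enc_append (f := fun n : ℕ => n + 1) [1] fun _ => rfl).comp hf

theorem elim {f : X → Y} {o : X → Option Z} {g : X → Z → Y} (ho : PolyTime o) (hf : PolyTime f)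
    (hg : PolyTime fun p : X × Z => g p.1 p.2) :
    PolyTime (fun x => (o x).elim (f x) (g x)) := optionElim hf ho hg

theorem natCases {n : X → ℕ} {f : X → Y} {g : X → ℕ → Y} (hn : PolyTime n) (hf : PolyTime f)
    (hg : PolyTime fun p : X × ℕ => g p.1 p.2) :
    PolyTime (fun x => Nat.casesOn (motive := fun _ => Y) (n x) (f x) (g x)) := by
  have h : PolyTime (fun n : ℕ => Nat.casesOn (motive := fun _ => Option ℕ) n none Option.some) :=
    of_enc_eq fun n => by cases n <;> rfl
  exact (elim (h.comp hn) hf hg).congr fun x => by cases n x <;> rfl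

theorem listCases {l : X → List A} {f : X → Y} {g : X → A → List A → Y} (hl : PolyTime l)
    (hf : PolyTime f) (hg : PolyTime fun p : X × (A × List A) => g p.1 p.2.1 p.2.2) :
    PolyTime (fun x => List.casesOn (motive := fun _ => Y) (l x) (f x) (g x)) := by
  have h : PolyTime (fun l : List A =>
      List.casesOn (motive := fun _ => Option (A × List A)) l none fun a l => Option.some (a, l)) :=
    of_enc_eq fun n => by cases n <;> rfl
  exact (elim (g := fun x p => g x p.1 p.2) (h.comp hl) hf hg).congr fun x => by cases l x <;> rfl

theorem finFun {F : Type} [Fintype F] [FinEnc F] {f : X → F} (hf : PolyTime f) (g : F → Y) :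
    PolyTime (fun x => g (f x)) :=
  finElim (h := fun a _ => g a) hf fun a => const (g a)

theorem finFun₂ {F G : Type} [Fintype F] [FinEnc F] [Fintype G] [FinEnc G] {f : X → F} {f' : X → G}
    (hf : PolyTime f) (hf' : PolyTime f') (g : F → G → Y) :
    PolyTime (fun x => g (f x) (f' x)) :=
  finElim (h := fun a x => g a (f' x)) hf fun a => finFun hf' (g a)

theorem cond {c : X → Bool} {f g : X → Y} (hc : PolyTime c) (hf : PolyTime f) (hg : PolyTime g) :
    PolyTime (fun x => bif c x then f x else g x) :=
  finElim (h := fun a x => bif a then f x else g x) hc fun a => by cases a <;> assumption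

theorem and {f g : X → Bool} (hf : PolyTime f) (hg : PolyTime g) :
    PolyTime (fun x => f x && g x) := finFun₂ hf hg _

theorem not {f : X → Bool} (hf : PolyTime f) : PolyTime (fun x => !f x) := finFun hf _

theorem xor {f g : X → Bool} (hf : PolyTime f) (hg : PolyTime g) :
    PolyTime (fun x => Bool.xor (f x) (g x)) := finFun₂ hf hg _

open Prog Function in
/-- The length of the code, in unary. -/
theorem sizeFun : PolyTime (fun x : X => size x) := by
  refine ⟨.seq (pour 0 1 fun _ => [1]) (rev 1 0), 2, 6 * Polynomial.X + 2,
    ⟨bdd_pour (by omega) (by omega) (by simp), bdd_rev (by omega) (by omega)⟩,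
    fun x s h0 hs => (((runLE_pour (by omega) _ 1 (by simp) s).seq
      (runLE_rev (by omega) _)).congr ?_).mono ?_⟩
  · have h1 := hs 1 (by omega) (by omega)
    have e : ((enc x).reverse.flatMap fun _ => [1]).reverse = enc (size x) := by
      rw [← List.map_eq_flatMap, List.map_const', List.reverse_replicate, List.length_reverse]
      rfl
    rw [h0, h1, List.append_nil]
    funext i
    by_cases hi : i = 0
    · subst hi; simp only [update_self, ne_eq, zero_ne_one, not_false_eq_true, update_of_ne, e,
        List.append_nil]
    · by_cases hi1 : i = 1
      · subst hi1; simp [h1]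
      · simp [hi, hi1]
  · have h1 := hs 1 (by omega) (by omega)
    rw [h0, h1]
    simp only [List.append_nil, update_self, ← List.map_eq_flatMap, List.length_map,
      List.length_reverse, Polynomial.eval_add, Polynomial.eval_mul, Polynomial.eval_X,
      Polynomial.eval_ofNat, size]
    omega

/-- In contrast to `iterate`, the body may depend on the input, which is carried along as an
unchanged first component. -/
theorem loop {f : X → S → S} {n : X → ℕ} {s : X → S} (hf : PolyTime fun p : X × S => f p.1 p.2)
    (hn : PolyTime n) (hs : PolyTime s) {B : X → ℕ} (hB : PolyBdd B)
    (hb : ∀ x, ∀ i ≤ n x, size ((f x)^[i] (s x)) ≤ B x) :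
    PolyTime (fun x => (f x)^[n x] (s x)) := by
  obtain ⟨b, hB⟩ := hB
  have key : ∀ (i : ℕ) (x : X) (y : S),
      (fun p : X × S => (p.1, f p.1 p.2))^[i] (x, y) = (x, (f x)^[i] y) := by
    intro i
    induction i with
    | zero => intro x y; rfl
    | succ i ih => intro x y; rw [Function.iterate_succ_apply, ih]; rfl
  have h := iterate (X := X) (Y := X × S) (f := fun p => (p.1, f p.1 p.2)) (n := n)
    (fst.pair hf) hn (id.pair hs) (b := 2 * Polynomial.X + b + 1) fun x i hi => by
      have h₁ := hb x i hi
      have h₂ := hB x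
      rw [key, size_pair]
      simp only [Polynomial.eval_add, Polynomial.eval_mul, Polynomial.eval_X,
        Polynomial.eval_ofNat, Polynomial.eval_one]
      omega
  exact (snd.comp h).congr fun x => by rw [key]

/-- The sum of the codes of the entries of a list bounds the code of every part of the list. -/
theorem _root_.size_append (l l' : List A) : size (l ++ l') = size l + size l' := by
  induction l with
  | nil => simp
  | cons a l ih => rw [List.cons_append, size_cons, size_cons, ih]; omega

theorem _root_.length_le_size (l : List A) : l.length ≤ size l := by
  induction l with
  | nil => simp
  | cons a l ih => rw [List.length_cons, size_cons]; omega

theorem _root_.size_drop_le (l : List A) (i : ℕ) : size (l.drop i) ≤ size l := by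
  conv_rhs => rw [← List.take_append_drop i l, size_append]
  omega

theorem _root_.size_le_of_mem {a : A} {l : List A} (h : a ∈ l) : size a ≤ size l := by
  obtain ⟨l₁, l₂, rfl⟩ := List.append_of_mem h
  rw [size_append, size_cons]
  omega

/-- The state of the loop consists of the remaining list and the accumulated value. The number of
rounds is the size of the list, which is at least its length; superfluous rounds find the empty list
and do nothing. -/
theorem foldl {l : X → List A} {f : X → S → A → S} {s : X → S} (hl : PolyTime l)
    (hf : PolyTime fun p : X × S × A => f p.1 p.2.1 p.2.2) (hs : PolyTime s) {B : X → ℕ}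
    (hB : PolyBdd B) (hb : ∀ x, ∀ i, size (((l x).take i).foldl (f x) (s x)) ≤ B x) :
    PolyTime (fun x => (l x).foldl (f x) (s x)) := by
  let g : X → List A × S → List A × S := fun x p =>
    List.casesOn (motive := fun _ => List A × S) p.1 p fun a l => (l, f x p.2 a)
  have hg : PolyTime fun p : X × (List A × S) => g p.1 p.2 :=
    listCases (fst.comp snd) snd ((snd.comp snd).pair
      (hf.comp ((fst.comp fst).pair ((snd.comp (snd.comp fst)).pair (fst.comp snd)))))
  have key : ∀ (x : X) (i : ℕ) (l : List A) (y : S),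
      (g x)^[i] (l, y) = (l.drop i, (l.take i).foldl (f x) y) := by
    intro x i
    induction i with
    | zero => intro l y; rfl
    | succ i ih =>
      intro l y
      rw [Function.iterate_succ_apply]
      cases l with
      | nil => simpa using ih [] y
      | cons a l => exact ih l _
  have h := loop (n := fun x => size (l x)) (s := fun x => (l x, s x)) hg (sizeFun.comp hl)
    (hl.pair hs) (B := fun x => 2 * size (l x) + B x + 1)
    ((((PolyBdd.const 2).mul (.size hl)).add hB).add (.const 1)) fun x i _ => by
      rw [key, size_pair]
      have h₁ := size_drop_le (l x) i
      have h₂ := hb x i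
      simp only
      omega
  exact (snd.comp h).congr fun x => by
    rw [key, List.take_of_length_le (length_le_size _)]

/-- A fold where each step increases the length of the code by at most `C`. -/
theorem foldl_of_le {l : X → List A} {f : X → S → A → S} {s : X → S} (hl : PolyTime l)
    (hf : PolyTime fun p : X × S × A => f p.1 p.2.1 p.2.2) (hs : PolyTime s) {C : X → ℕ}
    (hC : PolyBdd C) (hb : ∀ x y, ∀ a ∈ l x, size (f x y a) ≤ size y + C x) :
    PolyTime (fun x => (l x).foldl (f x) (s x)) := by
  refine foldl hl hf hs (B := fun x => size (s x) + size (l x) * C x)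
    ((PolyBdd.size hs).add ((PolyBdd.size hl).mul hC)) fun x i => ?_
  have : ∀ (l' : List A) (y : S), (∀ a ∈ l', a ∈ l x) →
      size (l'.foldl (f x) y) ≤ size y + l'.length * C x := by
    intro l'
    induction l' with
    | nil => intro y _; simp
    | cons a l' ih =>
      intro y h
      have h₁ := ih (f x y a) fun b hb => h b (List.mem_cons_of_mem _ hb)
      have h₂ := hb x y a (h a List.mem_cons_self)
      rw [List.foldl_cons, List.length_cons, Nat.succ_mul]
      omega
  refine (this _ _ fun a ha => List.mem_of_mem_take ha).trans ?_
  have h₁ := (List.length_take_le' i (l x)).trans (length_le_size (l x))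
  have := Nat.mul_le_mul_right (C x) h₁
  omega

theorem reverse {f : X → List A} (hf : PolyTime f) : PolyTime (fun x => (f x).reverse) := by
  have h := foldl_of_le (f := fun _ (s : List A) a => a :: s) (s := fun _ : X => ([] : List A)) hf
    (cons (snd.comp snd) (fst.comp snd)) (const [])
    (C := fun x => 2 * size (f x) + 2) (((PolyBdd.const 2).mul (.size hf)).add (.const 2))
    fun x y a ha => by
      have := size_le_of_mem ha
      rw [size_cons]; omega
  exact h.congr fun x => by simp

theorem append {f g : X → List A} (hf : PolyTime f) (hg : PolyTime g) :
    PolyTime (fun x => f x ++ g x) := by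
  have h := foldl_of_le (f := fun _ (s : List A) a => a :: s) (s := g) (reverse hf)
    (cons (snd.comp snd) (fst.comp snd)) hg
    (C := fun x => 2 * size (f x) + 2) (((PolyBdd.const 2).mul (.size hf)).add (.const 2))
    fun x y a ha => by
      have := size_le_of_mem (List.mem_reverse.mp ha)
      rw [size_cons]; omega
  exact h.congr fun x => by rw [List.foldl_reverse, List.foldr_cons_eq_append']

/-- A loop where each step increases the length of the code by at most `C`. -/
theorem loop_of_le {f : X → S → S} {n : X → ℕ} {s : X → S}
    (hf : PolyTime fun p : X × S => f p.1 p.2) (hn : PolyTime n) (hs : PolyTime s) {C : X → ℕ}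
    (hC : PolyBdd C) (hb : ∀ x y, size (f x y) ≤ size y + C x) :
    PolyTime (fun x => (f x)^[n x] (s x)) := by
  refine loop hf hn hs (B := fun x => size (s x) + n x * C x)
    ((PolyBdd.size hs).add ((PolyBdd.nat hn).mul hC)) fun x i hi => ?_
  have : size ((f x)^[i] (s x)) ≤ size (s x) + i * C x := by
    clear hi
    induction i with
    | zero => simp
    | succ i ih =>
      rw [Function.iterate_succ_apply']
      have := hb x ((f x)^[i] (s x))
      rw [Nat.succ_mul]; omega
  have h := Nat.mul_le_mul_right (C x) hi
  omega

theorem add {f g : X → ℕ} (hf : PolyTime f) (hg : PolyTime g) : PolyTime (fun x => f x + g x) := by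
  have h := loop_of_le (f := fun _ (s : ℕ) => s + 1) (succ snd) hf hg (.const 1)
    fun x y => by simp
  refine h.congr fun x => ?_
  rw [Nat.add_comm]
  generalize f x = m
  induction m with
  | zero => rfl
  | succ m ih => rw [Function.iterate_succ_apply', ← ih]; rfl

theorem mul {f g : X → ℕ} (hf : PolyTime f) (hg : PolyTime g) : PolyTime (fun x => f x * g x) := by
  have h := loop_of_le (f := fun x (s : ℕ) => s + g x) (s := fun _ => 0)
    (add snd (hg.comp fst)) hf (const 0) (.nat hg) fun x y => by simp
  refine h.congr fun x => ?_
  generalize f x = m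
  induction m with
  | zero => simp
  | succ m ih => rw [Function.iterate_succ_apply', ← ih, Nat.succ_mul]

theorem sub {f g : X → ℕ} (hf : PolyTime f) (hg : PolyTime g) : PolyTime (fun x => f x - g x) := by
  have h := loop_of_le (f := fun _ (s : ℕ) => s - 1) (s := f)
    ((natCases (g := fun _ k => k) snd (const 0) snd).congr fun p => by cases p.2 <;> simp)
    hg hf (.const 0)
    fun x y => by simp
  refine h.congr fun x => ?_
  generalize g x = m
  induction m with
  | zero => rfl
  | succ m ih => rw [Function.iterate_succ_apply', ← ih]; rfl

theorem polyEval {f : X → ℕ} (hf : PolyTime f) (p : Polynomial ℕ) :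
    PolyTime (fun x => p.eval (f x)) := by
  induction p using Polynomial.induction_on with
  | C a => simpa using const a
  | add p q hp hq => simpa using add hp hq
  | monomial n a h =>
    have := mul h hf
    refine this.congr fun x => ?_
    simp [pow_succ, mul_assoc]

theorem isZero {f : X → ℕ} (hf : PolyTime f) : PolyTime (fun x => decide (f x = 0)) :=
  (natCases (g := fun _ _ => false) hf (const true) (const false)).congr fun x => by
    cases h : f x <;> simp

theorem le {f g : X → ℕ} (hf : PolyTime f) (hg : PolyTime g) :
    PolyTime (fun x => decide (f x ≤ g x)) :=
  (isZero (sub hf hg)).congr fun x => by simp [Nat.sub_eq_zero_iff_le]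

theorem length {f : X → List A} (hf : PolyTime f) : PolyTime (fun x => (f x).length) := by
  have h := foldl_of_le (f := fun _ (s : ℕ) _ => s + 1) (s := fun _ : X => 0) hf
    (succ (fst.comp snd)) (const 0) (.const 1) fun x y a _ => by simp
  exact h.congr fun x => by simp

theorem replicate {n : X → ℕ} {a : X → A} (hn : PolyTime n) (ha : PolyTime a) :
    PolyTime (fun x => List.replicate (n x) (a x)) := by
  have h := loop_of_le (f := fun x (s : List A) => a x :: s) (s := fun _ => [])
    (cons (ha.comp fst) snd) hn (const []) (C := fun x => 2 * size (a x) + 2)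
    (((PolyBdd.const 2).mul (.size ha)).add (.const 2)) fun x y => by rw [size_cons]; omega
  refine h.congr fun x => ?_
  generalize n x = m
  induction m with
  | zero => rfl
  | succ m ih => rw [Function.iterate_succ_apply', ← ih]; rfl

theorem tail {f : X → List A} (hf : PolyTime f) : PolyTime (fun x => (f x).tail) :=
  (listCases hf (const []) (g := fun _ _ l => l) (snd.comp snd)).congr fun x => by
    cases f x <;> rfl

theorem drop {f : X → List A} {n : X → ℕ} (hf : PolyTime f) (hn : PolyTime n) :
    PolyTime (fun x => (f x).drop (n x)) := by
  have h := loop_of_le (f := fun _ (s : List A) => s.tail) (s := f) (tail snd) hn hf (.const 0)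
    fun x y => by simpa using size_drop_le y 1
  refine h.congr fun x => ?_
  generalize n x = m
  induction m with
  | zero => rfl
  | succ m ih => rw [Function.iterate_succ_apply', ← ih, List.tail_drop]

theorem take {f : X → List A} {n : X → ℕ} (hf : PolyTime f) (hn : PolyTime n) :
    PolyTime (fun x => (f x).take (n x)) :=
  (reverse (drop (reverse hf) (sub (length hf) hn))).congr fun x => by
    rw [← List.reverse_inj, List.reverse_reverse, List.reverse_take]

theorem map {l : X → List A} {f : X → A → Y} (hl : PolyTime l)
    (hf : PolyTime fun p : X × A => f p.1 p.2) : PolyTime (fun x => (l x).map (f x)) := by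
  obtain ⟨q, hq⟩ := hf.size_le
  have h := foldl_of_le (f := fun x (s : List Y) a => f x a :: s) (s := fun _ : X => ([] : List Y))
    hl
    (cons (hf.comp (fst.pair (snd.comp snd))) (fst.comp snd)) (const [])
    (C := fun x => 2 * q.eval (2 * size x + size (l x) + 1) + 2)
    (((PolyBdd.const 2).mul ((((PolyBdd.const 2).mul (.size id)).add (.size hl)).add
      (.const 1) |>.poly q)).add (.const 2)) fun x y a ha => by
      have h₁ := hq (x, a)
      have h₂ := q.eval_mono_nat (show size (x, a) ≤ 2 * size x + size (l x) + 1 by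
        have := size_le_of_mem ha
        rw [size_pair]; simp only; omega)
      simp only at h₁
      rw [size_cons]; omega
  refine (reverse h).congr fun x => ?_
  rw [← List.reverse_inj, List.reverse_reverse, ← List.foldr_reverse, List.foldr_reverse]
  have : ∀ (l : List A) (s : List Y), l.foldl (fun s a => f x a :: s) s =
      (l.map (f x)).reverse ++ s := by
    intro l
    induction l with
    | nil => intro s; rfl
    | cons a l ih => intro s; rw [List.foldl_cons, ih]; simp
  rw [this, List.append_nil]

theorem flatten {l : X → List (List A)} (hl : PolyTime l) :
    PolyTime (fun x => (l x).flatten) := by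
  have h := foldl_of_le (f := fun _ (s : List A) a => s ++ a) (s := fun _ : X => ([] : List A)) hl
    (append (fst.comp snd) (snd.comp snd)) (const []) (C := fun x => size (l x)) (.size hl)
    fun x y a ha => by
      have := size_le_of_mem ha
      rw [size_append]; omega
  refine h.congr fun x => ?_
  have : ∀ (l : List (List A)) (s : List A), l.foldl (fun s a => s ++ a) s = s ++ l.flatten := by
    intro l
    induction l with
    | nil => intro s; simp
    | cons a l ih => intro s; rw [List.foldl_cons, ih]; simp
  rw [this, List.nil_append]

theorem finEq {F : Type} [Fintype F] [FinEnc F] [DecidableEq F] {f g : X → F} (hf : PolyTime f)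
    (hg : PolyTime g) : PolyTime (fun x => decide (f x = g x)) :=
  finFun₂ hf hg fun a b => decide (a = b)

/-- A fold over the first list consumes the second one and keeps a flag. The lists are equal if and
only if the flag is still set and nothing remains of the second list. -/
theorem listEq {F : Type} [Fintype F] [FinEnc F] [DecidableEq F] {f g : X → List F}
    (hf : PolyTime f) (hg : PolyTime g) : PolyTime (fun x => decide (f x = g x)) := by
  let st : X → List F × Bool → F → List F × Bool := fun _ s a =>
    List.casesOn (motive := fun _ => List F × Bool) s.1 (s.1, false)
      fun b l => (l, s.2 && decide (a = b))
  have hst : PolyTime fun p : X × (List F × Bool) × F => st p.1 p.2.1 p.2.2 :=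
    listCases (fst.comp (fst.comp snd)) ((fst.comp (fst.comp snd)).pair (const false))
      ((snd.comp snd).pair (and (snd.comp (fst.comp (snd.comp fst)))
        (finEq (snd.comp (snd.comp fst)) (fst.comp snd))))
  have h := foldl_of_le (f := st) (s := fun x => (g x, true)) hf hst (hg.pair (const true))
    (.const 0) fun x y a _ => by
      obtain ⟨_ | ⟨b, l⟩, c⟩ := y
      · simp [st]
      · simp [st]; omega
  have key : ∀ (x : X) (l l' : List F) (c : Bool),
      ((l.foldl (st x) (l', c)).2 && decide ((l.foldl (st x) (l', c)).1.length = 0)) =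
        (c && decide (l = l')) := by
    intro x l
    induction l with
    | nil => intro l' c; cases l' <;> simp
    | cons a l ih =>
      intro l' c
      cases l' with
      | nil => rw [List.foldl_cons]; simp only [st]; rw [ih]; simp
      | cons b l' => rw [List.foldl_cons]; simp only [st]; rw [ih]; simp [Bool.and_assoc]
  refine (and (snd.comp h) (isZero (length (fst.comp h)))).congr fun x => ?_
  rw [key x, Bool.true_and]

end PolyTime

/-! ## Binary arithmetic in polynomial time -/

/-- Natural numbers in binary. -/
@[ext]
structure Bin where
  val : ℕ

instance : Enc Bin := ⟨fun n => (encodeNat n.val).map Bool.toNat⟩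

/-- The digits come with the least significant one first and without superfluous zeros; therefore
zero, with the empty code, is exceptional. The proof passes to `Num`, whose constructors are the
digits. -/
theorem encodeNat_bit (b : Bool) (n : ℕ) :
    encodeNat (Nat.bit b n) = if b = false ∧ n = 0 then [] else b :: encodeNat n := by
  have h0 : encodeNat 0 = [] := rfl
  have key : ∀ m : Num, encodeNat (m : ℕ) = encodeNum m := fun m => by
    rw [encodeNat, Num.of_to_nat]
  obtain ⟨m, rfl⟩ : ∃ m : Num, n = (m : ℕ) := ⟨(n : Num), (Num.to_of_nat n).symm⟩
  cases b with
  | false =>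
    cases m with
    | zero => simp [h0]
    | pos m =>
      have : Nat.bit false ((Num.pos m : Num) : ℕ) = ((Num.pos (PosNum.bit0 m) : Num) : ℕ) := by
        simp [Nat.bit]; omega
      have hm : (m : ℕ) ≠ 0 := (PosNum.to_nat_pos m).ne'
      have : Nat.bit false (m : ℕ) = ((Num.pos (PosNum.bit0 m) : Num) : ℕ) := this
      rw [if_neg (fun h => hm h.2)]
      change encodeNat (Nat.bit false (m : ℕ)) = _
      rw [this, key, key]
      simp [encodeNum, encodePosNum]
  | true =>
    cases m with
    | zero => rfl
    | pos m =>
      have : Nat.bit true ((Num.pos m : Num) : ℕ) = ((Num.pos (PosNum.bit1 m) : Num) : ℕ) := by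
        simp [Nat.bit]; omega
      rw [this, key, key]
      simp [encodeNum, encodePosNum]

namespace Bin

theorem lt_two_pow_size (n : Bin) : n.val < 2 ^ size n := by
  obtain ⟨n⟩ := n
  have : ∀ n : ℕ, n < 2 ^ (encodeNat n).length := by
    intro n
    induction n using Nat.binaryRec' with
    | zero => simp
    | bit b n h ih =>
      rw [encodeNat_bit]
      split_ifs with hb
      · simp [hb.1, hb.2]
      · rw [List.length_cons, pow_succ]
        cases b <;> simp [Nat.bit] <;> omega
  simpa [size, enc] using this n

/-- There are no leading zeros in the code. Together with `lt_two_pow_size` this reduces estimates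
of lengths to inequalities between numbers. -/
theorem size_le {n : Bin} {s : ℕ} (h : n.val < 2 ^ s) : size n ≤ s := by
  obtain ⟨n⟩ := n
  have : ∀ (n s : ℕ), n < 2 ^ s → (encodeNat n).length ≤ s := by
    intro n
    induction n using Nat.binaryRec' with
    | zero => intro s _; simp [show encodeNat 0 = [] from rfl]
    | bit b n h ih =>
      intro s hs
      rw [encodeNat_bit]
      split_ifs with hb
      · simp
      · cases s with
        | zero => cases b <;> simp [Nat.bit] at hs hb; omega
        | succ s =>
          rw [List.length_cons]
          have := ih s (by rw [pow_succ] at hs; cases b <;> simp [Nat.bit] at hs <;> omega)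
          omega
  simpa [size, enc] using this n s h

theorem size_mono {m n : Bin} (h : m.val ≤ n.val) : size m ≤ size n :=
  size_le (h.trans_lt n.lt_two_pow_size)

end Bin

namespace PolyTime

variable {X : Type} [Enc X]

theorem binToBits {f : X → Bin} (hf : PolyTime f) :
    PolyTime (fun x => (⟨encodeNat (f x).val⟩ : Bits)) :=
  (of_enc_eq (f := fun n : Bin => (⟨encodeNat n.val⟩ : Bits)) fun _ => rfl).comp hf

theorem encodeNat_uncons (n : ℕ) : Bits.uncons ⟨encodeNat n⟩ =
    if n = 0 then none else Option.some (n.bodd, ⟨encodeNat n.div2⟩) := by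
  conv_lhs => rw [← Nat.bit_bodd_div2 n, encodeNat_bit]
  by_cases hn : n = 0
  · subst hn; rfl
  · have : ¬ (n.bodd = false ∧ n.div2 = 0) := by
      rintro ⟨h₁, h₂⟩
      rw [← Nat.bit_bodd_div2 n, h₁, h₂] at hn
      exact hn rfl
    rw [if_neg this, if_neg hn]
    rfl

theorem bodd {f : X → Bin} (hf : PolyTime f) : PolyTime (fun x => (f x).val.bodd) :=
  (elim (g := fun _ (p : Bool × Bits) => p.1) (bitsUncons.comp (binToBits hf)) (const false)
    (fst.comp snd)).congr fun x => by
      rw [encodeNat_uncons]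
      split_ifs with h
      · rw [h]; rfl
      · rfl

theorem div2 {f : X → Bin} (hf : PolyTime f) : PolyTime (fun x => (⟨(f x).val / 2⟩ : Bin)) :=
  of_enc_congr (elim (g := fun _ (p : Bool × Bits) => p.2) (bitsUncons.comp (binToBits hf))
    (const ⟨[]⟩) (snd.comp snd)) fun x => by
      rw [encodeNat_uncons, ← Nat.div2_val]
      split_ifs with h
      · rw [h]; rfl
      · rfl

theorem bit {b : X → Bool} {f : X → Bin} (hb : PolyTime b) (hf : PolyTime f) :
    PolyTime (fun x => (⟨Nat.bit (b x) (f x).val⟩ : Bin)) := by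
  have h0 := isZero (sizeFun.comp hf)
  refine of_enc_congr (cond (and (not hb) h0) (const (⟨[]⟩ : Bits)) (bitsCons hb (binToBits hf)))
    fun x => ?_
  have hs : size (f x) = 0 ↔ (f x).val = 0 := by
    constructor
    · intro h
      have := (f x).lt_two_pow_size
      rw [h] at this; omega
    · intro h
      exact Nat.le_zero.mp (Bin.size_le (by rw [h]; simp))
  change (encodeNat _).map _ = _
  rw [encodeNat_bit]
  by_cases h : b x = false ∧ (f x).val = 0
  · rw [if_pos h]; simp [h.1, hs.mpr h.2]; rfl
  · rw [if_neg h]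
    have : (!b x && decide (size (f x) = 0)) = false := by
      rw [Bool.eq_false_iff]
      intro h'
      simp [hs] at h'
      exact h h'
    rw [this]; rfl

/-- The number with the given binary digits (most significant first) after those of `n`. -/
def _root_.Bin.ofDigits (n : ℕ) (l : List Bool) : ℕ := l.foldl (fun r d => Nat.bit d r) n

theorem ofDigits {f : X → List Bool} (hf : PolyTime f) :
    PolyTime (fun x => (⟨Bin.ofDigits 0 (f x)⟩ : Bin)) := by
  have h := foldl_of_le (f := fun _ (r : Bin) d => ⟨Nat.bit d r.val⟩) (s := fun _ : X => ⟨0⟩) hf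
    (bit (snd.comp snd) (fst.comp snd)) (const _) (.const 1) fun x y a _ => by
      refine Bin.size_le ?_
      have := y.lt_two_pow_size
      rw [pow_succ]
      cases a <;> simp [Nat.bit] <;> omega
  refine h.congr fun x => ?_
  generalize f x = l
  suffices ∀ n : ℕ, (⟨Bin.ofDigits n l⟩ : Bin) = l.foldl (fun r d => ⟨Nat.bit d r.val⟩) ⟨n⟩ from
    this 0
  induction l with
  | nil => intro n; rfl
  | cons a l ih => intro n; exact ih _

/-- One step of the addition of two numbers: the remaining summands, the carry and the digits. -/
def addStep (s : Bin × Bin × Bool × List Bool) : Bin × Bin × Bool × List Bool :=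
  (⟨s.1.val / 2⟩, ⟨s.2.1.val / 2⟩,
    (s.1.val.bodd && s.2.1.val.bodd) || (s.2.2.1 && (s.1.val.bodd || s.2.1.val.bodd)),
    Bool.xor (Bool.xor s.1.val.bodd s.2.1.val.bodd) s.2.2.1 :: s.2.2.2)

theorem polyTime_addStep : PolyTime addStep := by
  have a : PolyTime fun s : Bin × Bin × Bool × List Bool => s.1 := fst
  have b : PolyTime fun s : Bin × Bin × Bool × List Bool => s.2.1 := fst.comp snd
  have c : PolyTime fun s : Bin × Bin × Bool × List Bool => s.2.2.1 := fst.comp (snd.comp snd)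
  have d : PolyTime fun s : Bin × Bin × Bool × List Bool => s.2.2.2 := snd.comp (snd.comp snd)
  exact (div2 a).pair ((div2 b).pair ((finFun₂ (finFun₂ (bodd a) (bodd b) Bool.and)
    (finFun₂ c (finFun₂ (bodd a) (bodd b) Bool.or) Bool.and) Bool.or).pair
      (cons (xor (xor (bodd a) (bodd b)) c) d)))

/-- The digits are found from the least significant one on and put in front of the list. So
`Bin.ofDigits`, started with what remains to be added, is invariant. The first part shows when
nothing remains. -/
theorem addStep_spec (s : Bin × Bin × Bool × List Bool) (i : ℕ) :
    (addStep^[i] s).1.val + (addStep^[i] s).2.1.val + (addStep^[i] s).2.2.1.toNat =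
      (s.1.val + s.2.1.val + s.2.2.1.toNat) / 2 ^ i ∧
    Bin.ofDigits ((addStep^[i] s).1.val + (addStep^[i] s).2.1.val +
      (addStep^[i] s).2.2.1.toNat) (addStep^[i] s).2.2.2 =
      Bin.ofDigits (s.1.val + s.2.1.val + s.2.2.1.toNat) s.2.2.2 := by
  induction i with
  | zero => simp
  | succ i ih =>
    rw [Function.iterate_succ_apply']
    generalize addStep^[i] s = r at ih
    obtain ⟨⟨a⟩, ⟨b⟩, c, l⟩ := r
    have h : ∃ d : Bool, Bool.xor (Bool.xor a.bodd b.bodd) c = d ∧ a + b + c.toNat = Nat.bit d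
        (a / 2 + b / 2 + ((a.bodd && b.bodd) || (c && (a.bodd || b.bodd))).toNat) := by
      refine ⟨_, rfl, ?_⟩
      have ha := Nat.bit_bodd_div2 a
      have hb := Nat.bit_bodd_div2 b
      rw [Nat.div2_val] at ha hb
      cases h1 : a.bodd <;> cases h2 : b.bodd <;> cases c <;> rw [h1] at ha <;> rw [h2] at hb <;>
        simp [Nat.bit] at ha hb ⊢ <;> omega
    obtain ⟨d, hd, h⟩ := h
    constructor
    · rw [pow_succ, ← Nat.div_div_eq_div_mul, ← ih.1]
      simp only [addStep]
      simp only at ih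
      rw [h]
      cases d
      · simp [Nat.bit]
      · simp [Nat.bit]; omega
    · rw [← ih.2]
      simp only [addStep]
      rw [hd, h]
      rfl

theorem binAdd {f g : X → Bin} (hf : PolyTime f) (hg : PolyTime g) :
    PolyTime (fun x => (⟨(f x).val + (g x).val⟩ : Bin)) := by
  -- The sum is less than `2 ^ (size (f x) + size (g x) + 1)`, so this number of steps consumes
  -- everything including the carry. Each step adds one digit, which has 4 symbols in the code of a
  -- list.
  have h := loop_of_le (f := fun _ => addStep) (n := fun x => size (f x) + size (g x) + 1)
    (s := fun x => (f x, g x, false, []))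
    (polyTime_addStep.comp snd) (succ (add (sizeFun.comp hf) (sizeFun.comp hg)))
    (hf.pair (hg.pair (const _))) (.const 4) fun x s => by
      obtain ⟨a, b, c, l⟩ := s
      have h1 := Bin.size_mono (show (⟨a.val / 2⟩ : Bin).val ≤ a.val from Nat.div_le_self _ _)
      have h2 := Bin.size_mono (show (⟨b.val / 2⟩ : Bin).val ≤ b.val from Nat.div_le_self _ _)
      simp [addStep]
      omega
  refine (ofDigits (snd.comp (snd.comp (snd.comp h)))).congr fun x => ?_
  obtain ⟨h₁, h₂⟩ := addStep_spec (f x, g x, false, []) (size (f x) + size (g x) + 1)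
  have h₃ := (f x).lt_two_pow_size
  have h₄ := (g x).lt_two_pow_size
  rw [Nat.div_eq_of_lt] at h₁
  · rw [h₁] at h₂
    rw [h₂]
    rfl
  · have h₅ := Nat.pow_le_pow_right (n := 2) (by omega) (Nat.le_add_right (size (f x)) (size (g x)))
    have h₆ := Nat.pow_le_pow_right (n := 2) (by omega) (Nat.le_add_left (size (g x)) (size (f x)))
    rw [pow_succ]
    simp
    omega

/-- One step of the multiplication of two numbers: the remaining factors and the sum. -/
def mulStep (s : Bin × Bin × Bin) : Bin × Bin × Bin :=
  (⟨s.1.val / 2⟩, ⟨Nat.bit false s.2.1.val⟩,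
    bif s.1.val.bodd then ⟨s.2.2.val + s.2.1.val⟩ else s.2.2)

theorem polyTime_mulStep : PolyTime mulStep := by
  have a : PolyTime fun s : Bin × Bin × Bin => s.1 := fst
  have b : PolyTime fun s : Bin × Bin × Bin => s.2.1 := fst.comp snd
  have c : PolyTime fun s : Bin × Bin × Bin => s.2.2 := snd.comp snd
  exact (div2 a).pair ((bit (const false) b).pair (cond (bodd a) (binAdd c b) c))

/-- One factor is halved and the other one doubled, where an odd first factor contributes the second
one to the sum. The sum plus the product of the factors is invariant, and the first factor
eventually vanishes. -/
theorem mulStep_spec (s : Bin × Bin × Bin) (i : ℕ) :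
    (mulStep^[i] s).1.val = s.1.val / 2 ^ i ∧ (mulStep^[i] s).2.1.val = s.2.1.val * 2 ^ i ∧
    (mulStep^[i] s).2.2.val + (mulStep^[i] s).1.val * (mulStep^[i] s).2.1.val =
      s.2.2.val + s.1.val * s.2.1.val := by
  induction i with
  | zero => simp
  | succ i ih =>
    rw [Function.iterate_succ_apply']
    generalize mulStep^[i] s = r at ih
    obtain ⟨⟨a⟩, ⟨b⟩, ⟨c⟩⟩ := r
    obtain ⟨h₁, h₂, h₃⟩ := ih
    simp only at h₁ h₂ h₃
    refine ⟨?_, ?_, ?_⟩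
    · rw [pow_succ, ← Nat.div_div_eq_div_mul, ← h₁]; rfl
    · simp only [mulStep]
      rw [h₂, pow_succ]; simp [Nat.bit]; ring
    · rw [← h₃]
      have ha := Nat.bit_bodd_div2 a
      rw [Nat.div2_val] at ha
      simp only [mulStep]
      cases h : a.bodd <;> rw [h] at ha <;> simp [Nat.bit] at ha ⊢
      · conv_rhs => rw [← ha]
        ring
      · conv_rhs => rw [← ha]
        ring

theorem binMul {f g : X → Bin} (hf : PolyTime f) (hg : PolyTime g) :
    PolyTime (fun x => (⟨(f x).val * (g x).val⟩ : Bin)) := by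
  have h := loop (f := fun _ => mulStep) (n := fun x => size (f x))
    (s := fun x => (f x, g x, ⟨0⟩)) (polyTime_mulStep.comp snd) (sizeFun.comp hf)
    (hf.pair (hg.pair (const _)))
    (B := fun x => 2 * size (f x) + 2 * (size (g x) + size (f x)) +
      (size (f x) + size (g x)) + 2)
    ((((((PolyBdd.const 2).mul (.size hf)).add ((PolyBdd.const 2).mul ((PolyBdd.size hg).add
      (.size hf)))).add ((PolyBdd.size hf).add (.size hg))).add (.const 2))) fun x i hi => by
      obtain ⟨h₁, h₂, h₃⟩ := mulStep_spec (f x, g x, ⟨0⟩) i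
      simp only at h₁ h₂ h₃
      have e₁ : size (mulStep^[i] (f x, g x, ⟨0⟩)).1 ≤ size (f x) :=
        Bin.size_mono (by rw [h₁]; exact Nat.div_le_self _ _)
      have e₂ : size (mulStep^[i] (f x, g x, ⟨0⟩)).2.1 ≤ size (g x) + size (f x) :=
        Bin.size_le (by
          rw [h₂, pow_add]
          exact Nat.mul_lt_mul_of_lt_of_le (g x).lt_two_pow_size
            (Nat.pow_le_pow_right (by omega) hi) (by positivity))
      -- By the invariant, a partial sum never exceeds the final product.
      have e₃ : size (mulStep^[i] (f x, g x, ⟨0⟩)).2.2 ≤ size (f x) + size (g x) :=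
        Bin.size_le (by
          rw [pow_add]
          exact (Nat.le_of_add_right_le h₃.le).trans_lt (by
            rw [zero_add]
            exact Nat.mul_lt_mul'' (f x).lt_two_pow_size (g x).lt_two_pow_size))
      rw [size_pair, size_pair]
      omega
  refine (snd.comp (snd.comp h)).congr fun x => ?_
  obtain ⟨h₁, h₂, h₃⟩ := mulStep_spec (f x, g x, ⟨0⟩) (size (f x))
  simp only at h₁ h₂ h₃
  rw [Nat.div_eq_of_lt (f x).lt_two_pow_size] at h₁
  rw [h₁, Nat.zero_mul, Nat.add_zero, Nat.zero_add] at h₃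
  rw [← h₃]

/-- One step of a subtraction: the remaining numbers, the borrow and the digits. -/
def subStep (s : Bin × Bin × Bool × List Bool) : Bin × Bin × Bool × List Bool :=
  (⟨s.1.val / 2⟩, ⟨s.2.1.val / 2⟩,
    (!s.1.val.bodd && (s.2.1.val.bodd || s.2.2.1)) || (s.2.1.val.bodd && s.2.2.1),
    Bool.xor (Bool.xor s.1.val.bodd s.2.1.val.bodd) s.2.2.1 :: s.2.2.2)

theorem polyTime_subStep : PolyTime subStep := by
  have a : PolyTime fun s : Bin × Bin × Bool × List Bool => s.1 := fst
  have b : PolyTime fun s : Bin × Bin × Bool × List Bool => s.2.1 := fst.comp snd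
  have c : PolyTime fun s : Bin × Bin × Bool × List Bool => s.2.2.1 := fst.comp (snd.comp snd)
  have d : PolyTime fun s : Bin × Bin × Bool × List Bool => s.2.2.2 := snd.comp (snd.comp snd)
  exact (div2 a).pair ((div2 b).pair ((finFun₂ (finFun₂ (not (bodd a))
    (finFun₂ (bodd b) c Bool.or) Bool.and) (finFun₂ (bodd b) c Bool.and) Bool.or).pair
      (cons (xor (xor (bodd a) (bodd b)) c) d)))

/-- As for the addition, but the invariant is an integer, since the difference of what remains,
including the borrow, may be negative. -/
theorem subStep_spec (s : Bin × Bin × Bool × List Bool) (i : ℕ) :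
    (subStep^[i] s).1.val = s.1.val / 2 ^ i ∧ (subStep^[i] s).2.1.val = s.2.1.val / 2 ^ i ∧
    ((subStep^[i] s).2.2.2.foldl (fun (r : ℤ) d => 2 * r + d.toNat)
      ((subStep^[i] s).1.val - (subStep^[i] s).2.1.val - (subStep^[i] s).2.2.1.toNat : ℤ)) =
    (s.2.2.2.foldl (fun (r : ℤ) d => 2 * r + d.toNat)
      (s.1.val - s.2.1.val - s.2.2.1.toNat : ℤ)) := by
  induction i with
  | zero => simp
  | succ i ih =>
    rw [Function.iterate_succ_apply']
    generalize subStep^[i] s = r at ih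
    obtain ⟨⟨a⟩, ⟨b⟩, c, l⟩ := r
    obtain ⟨h₁, h₂, h₃⟩ := ih
    simp only at h₁ h₂ h₃
    refine ⟨?_, ?_, ?_⟩
    · rw [pow_succ, ← Nat.div_div_eq_div_mul, ← h₁]; rfl
    · rw [pow_succ, ← Nat.div_div_eq_div_mul, ← h₂]; rfl
    · rw [← h₃]
      simp only [subStep, List.foldl_cons]
      congr 1
      have ha := Nat.bit_bodd_div2 a
      have hb := Nat.bit_bodd_div2 b
      rw [Nat.div2_val] at ha hb
      cases h1 : a.bodd <;> cases h2 : b.bodd <;> cases c <;> rw [h1] at ha <;> rw [h2] at hb <;>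
        simp [Nat.bit] at ha hb ⊢ <;> omega

theorem foldl_digits (l : List Bool) (z : ℤ) :
    l.foldl (fun (r : ℤ) d => 2 * r + d.toNat) z = z * 2 ^ l.length + Bin.ofDigits 0 l ∧
      Bin.ofDigits 0 l < 2 ^ l.length := by
  induction l using List.reverseRecOn with
  | nil => simp [Bin.ofDigits]
  | append_singleton l a ih =>
    have h : Bin.ofDigits 0 (l ++ [a]) = Nat.bit a (Bin.ofDigits 0 l) := by
      simp [Bin.ofDigits]
    rw [List.foldl_append, ih.1, h, List.length_append, List.length_singleton, pow_succ, pow_succ]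
    have := ih.2
    cases a <;> simp [Nat.bit] <;> constructor <;> first | ring1 | omega

/-- When both numbers are used up, their difference is the number formed by the digits, reduced by
`2 ^ l.length` if a borrow is left. As the digits form a smaller number than this power, a borrow is
left exactly if the difference is negative, and then truncated subtraction gives `0`. -/
theorem binSub {f g : X → Bin} (hf : PolyTime f) (hg : PolyTime g) :
    PolyTime (fun x => (⟨(f x).val - (g x).val⟩ : Bin)) := by
  have h := loop_of_le (f := fun _ => subStep) (n := fun x => size (f x) + size (g x))
    (s := fun x => (f x, g x, false, []))
    (polyTime_subStep.comp snd) (add (sizeFun.comp hf) (sizeFun.comp hg))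
    (hf.pair (hg.pair (const _))) (.const 4) fun x s => by
      obtain ⟨a, b, c, l⟩ := s
      have h1 := Bin.size_mono (show (⟨a.val / 2⟩ : Bin).val ≤ a.val from Nat.div_le_self _ _)
      have h2 := Bin.size_mono (show (⟨b.val / 2⟩ : Bin).val ≤ b.val from Nat.div_le_self _ _)
      simp [subStep]
      omega
  refine (cond (fst.comp (snd.comp (snd.comp h))) (const ⟨0⟩)
    (ofDigits (snd.comp (snd.comp (snd.comp h))))).congr fun x => ?_
  obtain ⟨h₁, h₂, h₃⟩ := subStep_spec (f x, g x, false, []) (size (f x) + size (g x))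
  simp only at h₁ h₂ h₃
  have h₄ := (f x).lt_two_pow_size
  have h₅ := (g x).lt_two_pow_size
  rw [Nat.div_eq_of_lt (h₄.trans_le (Nat.pow_le_pow_right (by omega) (by omega)))] at h₁
  rw [Nat.div_eq_of_lt (h₅.trans_le (Nat.pow_le_pow_right (by omega) (by omega)))] at h₂
  rw [h₁, h₂] at h₃
  generalize subStep^[size (f x) + size (g x)] (f x, g x, false, []) = r at h₃ ⊢
  obtain ⟨a, b, c, l⟩ := r
  obtain ⟨h₆, h₇⟩ := foldl_digits l (((0 : ℕ) : ℤ) - ((0 : ℕ) : ℤ) - c.toNat)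
  simp only at h₃
  rw [h₆] at h₃
  ext
  cases c with
  | false => simp at h₃ ⊢; omega
  | true =>
    have : ((Bin.ofDigits 0 l : ℕ) : ℤ) < 2 ^ l.length := by exact_mod_cast h₇
    simp at h₃ ⊢; omega

theorem binZero {f : X → Bin} (hf : PolyTime f) : PolyTime (fun x => decide ((f x).val = 0)) :=
  (isZero (sizeFun.comp hf)).congr fun x => by
    congr 1
    apply propext
    constructor
    · intro h
      exact Nat.le_zero.mp (Bin.size_le (by rw [h]; simp))
    · intro h
      have := (f x).lt_two_pow_size
      rw [h] at this; omega

theorem binShift {f : X → Bin} {n : X → ℕ} (hf : PolyTime f) (hn : PolyTime n) :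
    PolyTime (fun x => (⟨(f x).val / 2 ^ n x⟩ : Bin)) := by
  have h := loop_of_le (f := fun _ (s : Bin) => ⟨s.val / 2⟩) (s := f) (div2 snd) hn hf
    (.const 0) fun x y => Bin.size_mono (Nat.div_le_self _ _)
  refine h.congr fun x => ?_
  generalize n x = m
  induction m with
  | zero => simp
  | succ m ih =>
    rw [Function.iterate_succ_apply', ← ih, pow_succ, Nat.div_div_eq_div_mul]

theorem binPow {n : X → ℕ} (hn : PolyTime n) : PolyTime (fun x => (⟨2 ^ n x⟩ : Bin)) := by
  have h := loop_of_le (f := fun _ (s : Bin) => ⟨Nat.bit false s.val⟩) (s := fun _ => ⟨1⟩)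
    (bit (const false) snd) hn (const _)
    (.const 1) fun x y => Bin.size_le (by
      have := y.lt_two_pow_size
      rw [pow_succ]; simp [Nat.bit]; omega)
  refine h.congr fun x => ?_
  generalize n x = m
  induction m with
  | zero => simp
  | succ m ih =>
    rw [Function.iterate_succ_apply', ← ih, pow_succ]; simp [Nat.bit]; ring

end PolyTime

/-! ## From programs to machines -/

namespace PolyTime

open Prog Function

variable {X : Type} [Enc X]

theorem _root_.enc_list_fin {α : Type} [FinEnc α] (l : List α) :
    enc l = (l.map FinEnc.idx).flatMap fun a => [1, 1, a, 0] := by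
  induction l with
  | nil => rfl
  | cons a l ih => rw [List.map_cons, List.flatMap_cons, ← ih]; rfl

/-- The machine of `polyTime_of_run` supplies the input reversed and expects the output reversed.
Pouring the input corrects its order and at the same time replaces each symbol by its contribution
`1, 1, a, 0` to the code of a list; the output is reversed at the end. -/
theorem toStackMachine {α X Y : Type} [Fintype α] [FinEnc α] (ea : X → List α)
    (eb : Y → List Bool) {f : X → Y} {g : List α → Bits} (hg : PolyTime g)
    (h : ∀ x, (g (ea x)).bits = eb (f x)) : Nonempty (TM2ComputableInPolyTime ea eb f) := by
  obtain ⟨r, hr⟩ := hg.size_le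
  obtain ⟨P, N, p, hB, hP⟩ := hg
  refine polyTime_of_run ea eb f
    (.seq (pour 0 1 fun a => [1, 1, a, 0]) <| .seq (move 1 0 2) <| .seq P <|
      .seq (rev 0 1) (move 1 0 2)) FinEnc.idx (fun a => decide (a = 1))
    ((4 + 2) * Polynomial.X + 1 + (6 * (4 * Polynomial.X) + 2) + p.comp (4 * Polynomial.X) +
      (3 * r.comp (4 * Polynomial.X) + 1) + (6 * r.comp (4 * Polynomial.X) + 2))
    (N₀ := N + 3) ⟨bdd_pour (by omega) (by omega) (by simp),
      bdd_move (by omega) (by omega) (by omega),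
      hB.mono (by omega), bdd_rev (by omega) (by omega), bdd_move (by omega) (by omega) (by omega)⟩
    fun x => ?_
  have hs : size (ea x) = 4 * (ea x).length := by
    rw [size, enc_list_fin]
    rw [List.length_flatMap, List.map_map, Function.comp_def]
    simp [mul_comm]
  have h₁ := runLE_pour (v := 0) (w := 1) (by omega) (fun a => [1, 1, a, 0]) 4 (by simp)
    (single ((ea x).map FinEnc.idx).reverse)
  have e₁ : update (update (single ((ea x).map FinEnc.idx).reverse) 0 []) 1
      ((single ((ea x).map FinEnc.idx).reverse 0).reverse.flatMap (fun a => [1, 1, a, 0]) ++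
        single ((ea x).map FinEnc.idx).reverse 1) = update (fun _ => []) 1 (enc (ea x)) := by
    rw [enc_list_fin]
    funext i
    by_cases hi : i = 1
    · subst hi; simp [single]
    · by_cases hi' : i = 0
      · subst hi'; simp
      · simp [hi, single]
  have h₂ := runLE_move (v := 1) (w := 0) (t := 2) (by omega) (by omega) (by omega)
    (update (fun _ => []) 1 (enc (ea x))) (by simp)
  have e₂ : ∀ l : List ℕ, update (update (update (fun _ => []) 1 l) 1 []) 0
      (update (fun _ => []) 1 l 1 ++ update (fun _ => []) 1 l 0) = single l := by
    intro l
    funext i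
    by_cases hi : i = 0
    · subst hi; simp [single]
    · by_cases hi' : i = 1
      · subst hi'; simp [single]
      · simp [hi, single]
  have h₃ := hP (ea x) (single (enc (ea x))) (by simp [single])
    (fun i hi _ => by simp [single, hi.ne'])
  have e₃ : update (single (enc (ea x))) 0 (enc (g (ea x))) = single (enc (g (ea x))) := by
    simp [single]
  have h₄ := runLE_rev (v := 0) (w := 1) (by omega) (single (enc (g (ea x))))
  have e₄ : update (update (single (enc (g (ea x)))) 0 []) 1
      ((single (enc (g (ea x))) 0).reverse ++ single (enc (g (ea x))) 1) =
      update (fun _ => []) 1 (enc (g (ea x))).reverse := by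
    funext i
    by_cases hi : i = 1
    · subst hi; simp [single]
    · by_cases hi' : i = 0
      · subst hi'; simp
      · simp [hi, single]
  have h₅ := runLE_move (v := 1) (w := 0) (t := 2) (by omega) (by omega) (by omega)
    (update (fun _ => []) 1 (enc (g (ea x))).reverse) (by simp)
  obtain ⟨c, hc, hrun⟩ := (h₁.congr e₁).seq ((h₂.congr (e₂ _)).seq ((h₃.congr e₃).seq
    ((h₄.congr e₄).seq (h₅.congr (e₂ _)))))
  refine ⟨c, hc.trans ?_, _, ?_, hrun⟩
  · have h₆ := hr (ea x)
    have h₇ : (enc (ea x)).length = 4 * (ea x).length := hs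
    simp only [size] at h₆
    simp [single, h₇, hs]
    rw [h₇] at h₆
    omega
  · rw [← h x]
    change List.reverse (List.map _ (List.map Bool.toNat _).reverse) = _
    rw [List.map_reverse, List.reverse_reverse, List.map_map]
    conv_rhs => rw [← List.map_id (g (ea x)).bits]
    congr 1
    funext b
    cases b <;> rfl

/-- Encoded triples are decoded in polynomial time. -/
theorem toStackMachine_triple {v : List Bool × List Bool × ℕ → ℤ}
    {g : List Bool × List Bool × ℕ → Bool × Bin} (hg : PolyTime g)
    (h : ∀ y, (g y).1 = decide (v y < 0) ∧ (g y).2.val = (v y).natAbs) :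
    Nonempty (TM2ComputableInPolyTime encodingTriple.encode encodingInt.encode v) := by
  let _ : FinEnc (Bool ⊕ (Bool ⊕ Bool)) :=
    ⟨fun a => (Fintype.equivFin _ a).val, fun a b h => by simpa [Fin.val_inj] using h⟩
  -- The symbols of the three components carry different tags in the sum type, so that each
  -- component is found by filtering; `b`, being unary, is the number of its symbols.
  have hx : PolyTime fun l : List (Bool ⊕ (Bool ⊕ Bool)) =>
      (l.map (Sum.elim (fun a => [a]) fun _ => [])).flatten :=
    flatten (map id (finFun snd _))
  have hu : PolyTime fun l : List (Bool ⊕ (Bool ⊕ Bool)) =>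
      (l.map (Sum.elim (fun _ => []) (Sum.elim (fun a => [a]) fun _ => []))).flatten :=
    flatten (map id (finFun snd _))
  have hb : PolyTime fun l : List (Bool ⊕ (Bool ⊕ Bool)) =>
      (l.map (Sum.elim (fun _ => []) (Sum.elim (fun _ => []) fun a => [a]))).flatten.length :=
    length (flatten (map id (finFun snd _)))
  have ht := hg.comp (hx.pair (hu.pair hb))
  refine toStackMachine _ _ (bitsCons (fst.comp ht) (binToBits (snd.comp ht))) fun y => ?_
  obtain ⟨x, u, b⟩ := y
  have e : ∀ {α β : Type} (l : List α), (l.map fun _ => ([] : List β)).flatten = [] := by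
    intro α β l; induction l <;> simp_all
  have e' : ∀ {α : Type} (l : List α), (l.map fun a => [a]).flatten = l := by
    intro α l; induction l <;> simp_all
  have : ∀ {A : Type} (f : Bool ⊕ (Bool ⊕ Bool) → List A),
      ((encodingTriple.encode (x, u, b)).map f).flatten = (x.map (f ∘ Sum.inl)).flatten ++
        ((u.map (f ∘ Sum.inr ∘ Sum.inl)).flatten ++
          ((unaryEncodingNat.encode b).map (f ∘ Sum.inr ∘ Sum.inr)).flatten) := by
    intro A f
    simp [encodingTriple, encodingProd, encodingList]
  simp only [this, Function.comp_def, Sum.elim_inl, Sum.elim_inr, e, e', List.append_nil,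
    List.nil_append]
  have hb' : (unaryEncodingNat.encode b).length = b := by
    change (unaryEncodeNat b).length = b
    rw [unaryEncodeNat_eq]; simp
  rw [hb', (h _).1, (h _).2]
  rfl

end PolyTime

/-! ## Codes of paths -/

instance {k : ℕ} : FinEnc (Fin k) := ⟨Fin.val, fun _ _ h => Fin.val_injective h⟩

/-- The code word of the `i`-th of `k` moves. -/
def moveWord {k : ℕ} (i : Fin k) : List Bool :=
  List.replicate i true ++ List.replicate (k - i) false

theorem length_moveWord {k : ℕ} (i : Fin k) : (moveWord i).length = k := by
  simp [moveWord]

/-- The code word of a path of at most `T` moves. -/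
def pathWord {k : ℕ} (T : ℕ) (l : List (Fin k)) : List Bool :=
  l.flatMap (fun i => true :: moveWord i) ++ List.replicate ((k + 1) * (T - l.length)) false

theorem length_pathWord {k T : ℕ} {l : List (Fin k)} (h : l.length ≤ T) :
    (pathWord T l).length = (k + 1) * T := by
  have : (l.flatMap fun i => true :: moveWord i).length = (k + 1) * l.length := by
    rw [List.length_flatMap]
    simp [length_moveWord, mul_comm]
  rw [pathWord, List.length_append, this, List.length_replicate, ← Nat.mul_add]
  congr 1; omega

/-- One step of the decoding of a path: the number of preceding ones and the moves found. -/
def readStep {k : ℕ} (s : Fin (k + 1) × List (Fin k)) (a : Bool) : Fin (k + 1) × List (Fin k) :=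
  (bif a then ⟨min (s.1 + 1) k, by omega⟩ else 0,
    s.2 ++ if h : a = false ∧ 0 < s.1.val then [⟨s.1 - 1, by omega⟩] else [])

/-- Decode a path. -/
def readMoves {k : ℕ} (l : List Bool) : List (Fin k) := (l.foldl readStep (0, [])).2

/-- The bit `1` and the word of the `i`-th move form a block of `i + 1` ones followed by at least
one zero, because `i < k`. So it suffices to count ones and to output the count minus one at the
first zero after them; further zeros, including the padding, have no effect. Such blocks have at
most `k` ones, so capping the counter at `k` does no harm and keeps it in a finite type. -/
theorem readMoves_pathWord {k : ℕ} (T : ℕ) (l : List (Fin k)) : readMoves (pathWord T l) = l := by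
  have ones : ∀ (n : ℕ) (r : Fin (k + 1)) (o : List (Fin k)) (h : r + n ≤ k),
      (List.replicate n true).foldl readStep (r, o) = (⟨r + n, by omega⟩, o) := by
    intro n
    induction n with
    | zero => intro r o _; rfl
    | succ n ih =>
      intro r o h
      have : readStep (r, o) true = (⟨r + 1, by omega⟩, o) := by
        simp [readStep]; omega
      rw [List.replicate_succ, List.foldl_cons, this, ih _ _ (by simp only; omega)]
      simp only [Prod.mk.injEq, Fin.mk.injEq, and_true]; omega
  have zeros : ∀ (n : ℕ) (o : List (Fin k)),
      (List.replicate n false).foldl readStep (0, o) = (0, o) := by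
    intro n
    induction n with
    | zero => intro o; rfl
    | succ n ih =>
      intro o
      have : readStep ((0 : Fin (k + 1)), o) false = (0, o) := by simp [readStep]
      rw [List.replicate_succ, List.foldl_cons, this, ih]
  have word : ∀ (i : Fin k) (o : List (Fin k)),
      (true :: moveWord i).foldl readStep (0, o) = (0, o ++ [i]) := by
    intro i o
    have h₁ : true :: moveWord i = List.replicate (i + 1) true ++
        (false :: List.replicate (k - i - 1) false) := by
      rw [moveWord, ← List.cons_append, ← List.replicate_succ, ← List.replicate_succ]
      congr 2; omega
    have h₂ : readStep ((⟨(0 : Fin (k + 1)) + (i + 1), by simp⟩ : Fin (k + 1)), o) false =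
        (0, o ++ [i]) := by simp [readStep]
    rw [h₁, List.foldl_append, ones _ _ _ (by simp), List.foldl_cons, h₂, zeros]
  have words : ∀ (l o : List (Fin k)),
      (l.flatMap fun i => true :: moveWord i).foldl readStep (0, o) = (0, o ++ l) := by
    intro l
    induction l with
    | nil => intro o; simp
    | cons i l ih => intro o; rw [List.flatMap_cons, List.foldl_append, word, ih]; simp
  rw [readMoves, pathWord, List.foldl_append, words, zeros]
  simp

/-- Decode a pair of paths. -/
def decodePair (k T : ℕ) (u : List Bool) : Option (List (Fin k) × List (Fin k)) :=
  bif decide ((readMoves (k := k) (u.take ((k + 1) * T))).length ≤ T) &&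
      (decide ((readMoves (k := k) (u.drop ((k + 1) * T))).length ≤ T) &&
        decide (pathWord T (readMoves (k := k) (u.take ((k + 1) * T))) ++
          pathWord T (readMoves (k := k) (u.drop ((k + 1) * T))) = u))
  then some (readMoves (u.take ((k + 1) * T)), readMoves (u.drop ((k + 1) * T))) else none

/-- `readMoves` extracts moves from any bit string whatsoever. Encoding the result again and
comparing it with `u` rules out the strings that are no codes. -/
theorem decodePair_eq_some {k T : ℕ} {u : List Bool} {p : List (Fin k) × List (Fin k)} :
    decodePair k T u = some p ↔
      p.1.length ≤ T ∧ p.2.length ≤ T ∧ u = pathWord T p.1 ++ pathWord T p.2 := by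
  constructor
  · intro h
    rw [decodePair, Bool.cond_eq_ite] at h
    split_ifs at h with hc
    simp only [Bool.and_eq_true, decide_eq_true_eq] at hc
    simp only [Option.some.injEq] at h
    subst h
    exact ⟨hc.1, hc.2.1, hc.2.2.symm⟩
  · rintro ⟨h₁, h₂, rfl⟩
    rw [decodePair, ← length_pathWord h₁, List.take_left, List.drop_left, readMoves_pathWord,
      readMoves_pathWord]
    simp [h₁, h₂]

namespace PolyTime

variable {X : Type} [Enc X] {k : ℕ}

theorem pathWord {n : X → ℕ} {f : X → List (Fin k)} (hn : PolyTime n) (hf : PolyTime f) :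
    PolyTime (fun x => pathWord (n x) (f x)) :=
  append ((flatten (map hf (finFun snd fun i => true :: moveWord i))).congr fun x => by
    rw [List.flatMap_def]) (replicate (mul (const (k + 1)) (sub hn (length hf))) (const false))

theorem readMoves {f : X → List Bool} (hf : PolyTime f) :
    PolyTime (fun x => readMoves (k := k) (f x)) := by
  refine snd.comp (foldl_of_le (f := fun _ => readStep) (s := fun _ : X => (0, [])) hf ?_
    (const _) (.const 4) fun x y a _ => ?_)
  · have a : PolyTime fun p : X × (Fin (k + 1) × List (Fin k)) × Bool => p.2.2 := snd.comp snd
    have r : PolyTime fun p : X × (Fin (k + 1) × List (Fin k)) × Bool => p.2.1.1 :=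
      fst.comp (fst.comp snd)
    exact (finFun₂ (Y := Fin (k + 1)) a r
        fun (a : Bool) (r : Fin (k + 1)) => bif a then ⟨min (r + 1) k, by omega⟩ else 0).pair
      (append (snd.comp (fst.comp snd)) (finFun₂ (Y := List (Fin k)) a r
        fun (a : Bool) (r : Fin (k + 1)) => if h : a = false ∧ 0 < r.val then [⟨r - 1, by omega⟩]
          else []))
  · have : ∀ l : List (Fin k), l.length ≤ 1 → size l ≤ 4 := by
      rintro (_ | ⟨a, _ | _⟩) h <;> simp at h ⊢
    have h := this (if h : a = false ∧ 0 < y.1.val then [⟨y.1 - 1, by omega⟩] else [])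
      (by split_ifs <;> simp)
    simp only [readStep, size_pair, size_append, size_fin]
    omega

theorem decodePair {n : X → ℕ} {f : X → List Bool} (hn : PolyTime n) (hf : PolyTime f) :
    PolyTime (fun x => decodePair k (n x) (f x)) := by
  have hL := mul (const (k + 1)) hn
  have h₁ := readMoves (k := k) (take hf hL)
  have h₂ := readMoves (k := k) (drop hf hL)
  exact cond (and (le (length h₁) hn) (and (le (length h₂) hn)
    (listEq (append (pathWord hn h₁) (pathWord hn h₂)) hf))) (some (h₁.pair h₂)) (const none)

end PolyTime

/-! ## Simulation of paths -/

/-- A state, the tape to the left of the head (from right to left), and the rest of the tape. -/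
abbrev Zipper (Q Γ : Type) : Type := Q × List Γ × List Γ

/-- The tape with the symbols `l` to the left of the cell `h`, read from right to left, and the
symbols `r` from the cell `h` on. -/
def zipTape {Γ : Type} (c : Γ) (h : ℤ) (l r : List Γ) (i : ℤ) : Γ :=
  if i < h then l.getD (h - 1 - i).toNat c else r.getD (i - h).toNat c

theorem getD_cons_sub {Γ : Type} (l : List Γ) (h i : ℤ) (a c : Γ) (hi : i ≤ h) :
    (a :: l).getD (h - i).toNat c = if i = h then a else l.getD (h - 1 - i).toNat c := by
  split_ifs with h'
  · simp [h']
  · obtain ⟨n, hn⟩ : ∃ n : ℕ, h - i = n + 1 := ⟨(h - i - 1).toNat, by omega⟩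
    rw [show (h - i).toNat = n + 1 by omega, show (h - 1 - i).toNat = n by omega]
    rfl

theorem getD_cons_sub' {Γ : Type} (l : List Γ) (h i : ℤ) (a c : Γ) (hi : h ≤ i) :
    (a :: l).getD (i - h).toNat c = if i = h then a else l.getD (i - (h + 1)).toNat c := by
  split_ifs with h'
  · simp [h']
  · obtain ⟨n, hn⟩ : ∃ n : ℕ, i - h = n + 1 := ⟨(i - h - 1).toNat, by omega⟩
    rw [show (i - h).toNat = n + 1 by omega, show (i - (h + 1)).toNat = n by omega]
    rfl

/-- Writing a symbol. -/
theorem zipTape_write {Γ : Type} (c : Γ) (h : ℤ) (l r : List Γ) (b s : Γ) :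
    zipTape c h l (s :: r) = Function.update (zipTape c h l (b :: r)) h s := by
  funext i
  rw [Function.update_apply]
  unfold zipTape
  rcases lt_trichotomy i h with hi | hi | hi
  · rw [if_pos hi, if_neg hi.ne, if_pos hi]
  · simp [hi]
  · rw [if_neg hi.le.not_gt, if_neg hi.ne', if_neg hi.le.not_gt, getD_cons_sub' _ _ _ _ _ hi.le,
      getD_cons_sub' _ _ _ _ _ hi.le, if_neg hi.ne', if_neg hi.ne']

/-- Moving to the right. -/
theorem zipTape_shift {Γ : Type} (c : Γ) (h : ℤ) (l r : List Γ) (s : Γ) :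
    zipTape c (h + 1) (s :: l) r = zipTape c h l (s :: r) := by
  funext i
  unfold zipTape
  rw [show h + 1 - 1 - i = h - i by omega]
  rcases lt_trichotomy i h with hi | hi | hi
  · rw [if_pos (by omega), if_pos hi, getD_cons_sub _ _ _ _ _ hi.le, if_neg hi.ne]
  · simp [hi]
  · rw [if_neg (by omega), if_neg (by omega), getD_cons_sub' _ _ _ _ _ hi.le, if_neg hi.ne']

namespace QuantumTM

section

variable {Q Γ R : Type} (M : QuantumTM Q Γ R)

/-- The configuration given by a zipper whose tape starts in the cell `-T`. -/
def zipCfg (T : ℕ) (z : Zipper Q Γ) : QCfg Q Γ where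
  state := z.1
  head := z.2.1.length - T
  tape := zipTape (M.symbol none) (z.2.1.length - T) z.2.1 z.2.2

/-- The scanned symbol. -/
def zipScanned (z : Zipper Q Γ) : Γ := z.2.2.headD (M.symbol none)

/-- Apply a move to a zipper. -/
def zipMove (z : Zipper Q Γ) (m : Q × Γ × SignType) : Zipper Q Γ :=
  SignType.casesOn (motive := fun _ => Zipper Q Γ) m.2.2 (m.1, z.2.1, m.2.1 :: z.2.2.tail)
    (m.1, z.2.1.tail, z.2.1.headD (M.symbol none) :: m.2.1 :: z.2.2.tail)
    (m.1, m.2.1 :: z.2.1, z.2.2.tail)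

/-- The zipper of the initial configuration. -/
def zipInit (T : ℕ) (x : List Bool) : Zipper Q Γ :=
  (M.start, List.replicate T (M.symbol none),
    x.map (fun a => M.symbol (some a)) ++ List.replicate (T + 1) (M.symbol none))

theorem scanned_zipCfg (T : ℕ) (z : Zipper Q Γ) : (M.zipCfg T z).scanned = M.zipScanned z := by
  obtain ⟨q, l, r⟩ := z
  cases r <;> simp [zipCfg, zipScanned, QCfg.scanned, zipTape]

/-- A zipper shows a fixed window of the tape, and the position of the head is read off from the
length of the left part. This remains correct as long as the window is not left, which the two
hypotheses guarantee. -/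
theorem zipCfg_zipMove (T : ℕ) (z : Zipper Q Γ) (m : Q × Γ × SignType) (hl : z.2.1 ≠ [])
    (hr : z.2.2 ≠ []) : M.zipCfg T (M.zipMove z m) = (M.zipCfg T z).move m := by
  obtain ⟨q, l, r⟩ := z
  obtain ⟨a, l, rfl⟩ := List.exists_cons_of_ne_nil hl
  obtain ⟨b, r, rfl⟩ := List.exists_cons_of_ne_nil hr
  obtain ⟨q', s, d⟩ := m
  ext1
  · cases d <;> rfl
  · cases d <;> simp [zipCfg, zipMove, QCfg.move] <;> omega
  · have hh : (((a :: l).length : ℕ) : ℤ) - T = l.length - T + 1 := by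
      rw [List.length_cons]; push_cast; ring
    cases d
    · exact zipTape_write _ _ _ _ _ _
    · change zipTape _ (l.length - T) l (a :: s :: r) =
        Function.update (zipTape _ (((a :: l).length : ℕ) - T) (a :: l) (b :: r))
          (((a :: l).length : ℕ) - T) s
      rw [← zipTape_write, hh, zipTape_shift]
    · change zipTape _ (((s :: a :: l).length : ℕ) - T) (s :: a :: l) r =
        Function.update (zipTape _ (((a :: l).length : ℕ) - T) (a :: l) (b :: r))
          (((a :: l).length : ℕ) - T) s
      rw [← zipTape_write, ← zipTape_shift]
      congr 1
      rw [List.length_cons]; push_cast; ring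

/-- In general the same tape is described by several pairs of lists, which differ by blanks at the
ends. For windows of equal length the description is unique, so final configurations can be compared
as lists. -/
theorem zipCfg_inj {T : ℕ} {z z' : Zipper Q Γ}
    (h : z.2.1.length + z.2.2.length = z'.2.1.length + z'.2.2.length) :
    M.zipCfg T z = M.zipCfg T z' ↔ z = z' := by
  refine ⟨fun e => ?_, fun e => by rw [e]⟩
  obtain ⟨q, l, r⟩ := z
  obtain ⟨q', l', r'⟩ := z'
  have h₁ := congrArg QCfg.state e
  have h₂ := congrArg QCfg.head e
  have h₃ := congrArg QCfg.tape e
  simp only [zipCfg] at h₁ h₂ h₃ h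
  have hl : l.length = l'.length := by omega
  have hr : r.length = r'.length := by omega
  rw [h₁]
  refine congrArg _ (Prod.ext (List.ext_getElem hl fun i hi hi' => ?_)
    (List.ext_getElem hr fun i hi hi' => ?_))
  · have := congrFun h₃ (l.length - T - 1 - i)
    rw [zipTape, zipTape, if_pos (by omega), if_pos (by omega), ← hl,
      show ((l.length : ℤ) - T - 1 - (l.length - T - 1 - i)).toNat = i by omega] at this
    simpa [hi, hi'] using this
  · have := congrFun h₃ (l.length - T + i)
    rw [zipTape, zipTape, if_neg (by omega), if_neg (by omega), ← hl,
      show ((l.length : ℤ) - T + i - (l.length - T)).toNat = i by omega] at this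
    simpa [hi, hi'] using this

theorem zipCfg_zipInit (T : ℕ) (x : List Bool) : M.zipCfg T (M.zipInit T x) = M.init x := by
  have rep : ∀ n i : ℕ, (List.replicate n (M.symbol none)).getD i (M.symbol none) =
      M.symbol none := by
    intro n i
    rw [List.getD_eq_getElem?_getD, List.getElem?_replicate]
    split_ifs <;> rfl
  ext1
  · rfl
  · simp [zipCfg, zipInit, init]
  · funext i
    simp only [zipCfg, zipInit, init, zipTape, List.length_replicate, sub_self, rep]
    by_cases hi : i < 0
    · simp [hi]
    · rw [if_neg hi, if_pos (by omega), sub_zero, List.getD_eq_getElem?_getD]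
      generalize i.toNat = n
      rw [List.getElem?_append]
      split_ifs with h
      · rw [List.length_map] at h
        simp [h]
      · rw [List.length_map] at h
        rw [← List.getD_eq_getElem?_getD, rep, List.getElem?_eq_none (by omega)]

end

variable {Q Γ R : Type} (M : QuantumTM Q Γ R) {k : ℕ} (e : Fin k ≃ Q × Γ × SignType)

/-- One step of the simulation of a path. It records whether a configuration before the present one
was final, the results of the measurements, and the arguments of the transition amplitudes. -/
def simStep (s : Zipper Q Γ × Bool × List R × List (Q × Γ × Fin k)) (i : Fin k) :
    Zipper Q Γ × Bool × List R × List (Q × Γ × Fin k) :=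
  (M.zipMove s.1 (e i), s.2.1 && !M.final s.1.1, M.outcome s.1.1 (M.zipScanned s.1) :: s.2.2.1,
    (s.1.1, M.zipScanned s.1, i) :: s.2.2.2)

/-- The simulation of a path. -/
def simulate (T : ℕ) (x : List Bool) (l : List (Fin k)) :
    Zipper Q Γ × Bool × List R × List (Q × Γ × Fin k) :=
  l.foldl (M.simStep e) (M.zipInit T x, true, [], [])

/-- Both parts of the window are long enough for the remaining moves. Instead of amplitudes, which
are real data, their arguments are recorded; the order is reversed but irrelevant for the product.
The last claim provides that only amplitudes at non-final states occur, for which there is a bound.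
-/
theorem foldl_simStep (T : ℕ) (l : List (Fin k))
    (s : Zipper Q Γ × Bool × List R × List (Q × Γ × Fin k)) (hl : l.length ≤ s.1.2.1.length)
    (hr : l.length < s.1.2.2.length) :
    (M.zipCfg T (l.foldl (M.simStep e) s).1 = endCfg (M.zipCfg T s.1) (l.map e) ∧
      (l.foldl (M.simStep e) s).1.2.1.length + (l.foldl (M.simStep e) s).1.2.2.length =
        s.1.2.1.length + s.1.2.2.length) ∧
    ((l.foldl (M.simStep e) s).2.1 = true ↔
      s.2.1 = true ∧ M.RunsUntilEnd (M.zipCfg T s.1) (l.map e)) ∧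
    (l.foldl (M.simStep e) s).2.2.1 =
      (M.pathOutcomes (M.zipCfg T s.1) (l.map e)).reverse ++ s.2.2.1 ∧
    (((l.foldl (M.simStep e) s).2.2.2.map fun a => M.amplitude a.1 a.2.1 (e a.2.2)).prod =
      M.pathAmplitude (M.zipCfg T s.1) (l.map e) *
        (s.2.2.2.map fun a => M.amplitude a.1 a.2.1 (e a.2.2)).prod) ∧
    (l.foldl (M.simStep e) s).2.2.2.length = l.length + s.2.2.2.length ∧
    (M.RunsUntilEnd (M.zipCfg T s.1) (l.map e) → ∀ a ∈ (l.foldl (M.simStep e) s).2.2.2,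
      a ∈ s.2.2.2 ∨ M.final a.1 = false) := by
  induction l generalizing s with
  | nil =>
    refine ⟨⟨rfl, rfl⟩, ?_, ?_, ?_, ?_, fun _ a ha => Or.inl ha⟩ <;>
      simp [RunsUntilEnd, pathOutcomes, pathAmplitude]
  | cons i l ih =>
    rw [List.length_cons] at hl hr
    have hl' : s.1.2.1 ≠ [] := by intro h; rw [h] at hl; simp at hl
    have hr' : s.1.2.2 ≠ [] := by intro h; rw [h] at hr; simp at hr
    have hm := M.zipCfg_zipMove T s.1 (e i) hl' hr'
    have h₁ : l.length ≤ (M.zipMove s.1 (e i)).2.1.length ∧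
        l.length < (M.zipMove s.1 (e i)).2.2.length ∧
        (M.zipMove s.1 (e i)).2.1.length + (M.zipMove s.1 (e i)).2.2.length =
          s.1.2.1.length + s.1.2.2.length := by
      rw [zipMove]
      generalize e i = m
      obtain ⟨q, g, d⟩ := m
      cases d <;> simp <;> omega
    obtain ⟨⟨a₁, a₂⟩, a₃, a₄, a₅, a₆, a₇⟩ := ih (M.simStep e s i) h₁.1 h₁.2.1
    have hc : M.zipCfg T (M.simStep e s i).1 = (M.zipCfg T s.1).move (e i) := hm
    rw [hc] at a₁ a₃ a₄ a₅ a₇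
    have hst : (M.zipCfg T s.1).state = s.1.1 := rfl
    simp only [List.foldl_cons, List.map_cons, List.length_cons, RunsUntilEnd, pathOutcomes,
      pathAmplitude, IsFinal, scanned_zipCfg, hst, List.reverse_cons]
    refine ⟨⟨a₁, a₂.trans h₁.2.2⟩, ?_, ?_, ?_, ?_, ?_⟩
    · rw [a₃]; simp [simStep, and_assoc]
    · rw [a₄]; simp [simStep]
    · rw [a₅]; simp [simStep]; ring
    · rw [a₆]; simp [simStep]; omega
    · rintro ⟨b₁, b₂⟩ a ha
      rcases a₇ b₂ a ha with h | h
      · rcases List.mem_cons.mp h with h | h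
        · subst h; right; simpa using b₁
        · exact Or.inl h
      · exact Or.inr h

theorem simulate_spec {T : ℕ} (x : List Bool) {l : List (Fin k)} (hl : l.length ≤ T) :
    (M.zipCfg T (M.simulate e T x l).1 = endCfg (M.init x) (l.map e) ∧
      (M.simulate e T x l).1.2.1.length + (M.simulate e T x l).1.2.2.length =
        2 * T + x.length + 1) ∧
    ((M.simulate e T x l).2.1 = true ↔ M.RunsUntilEnd (M.init x) (l.map e)) ∧
    (M.simulate e T x l).2.2.1 = (M.pathOutcomes (M.init x) (l.map e)).reverse ∧
    (((M.simulate e T x l).2.2.2.map fun a => M.amplitude a.1 a.2.1 (e a.2.2)).prod =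
      M.pathAmplitude (M.init x) (l.map e)) ∧
    (M.simulate e T x l).2.2.2.length = l.length ∧
    (M.RunsUntilEnd (M.init x) (l.map e) → ∀ a ∈ (M.simulate e T x l).2.2.2,
      M.final a.1 = false) := by
  have h := M.foldl_simStep e T l (M.zipInit T x, true, [], []) (by simpa [zipInit])
    (by simp [zipInit]; omega)
  rw [← simulate] at h
  simp only [zipCfg_zipInit] at h
  obtain ⟨⟨a₁, a₂⟩, a₃, a₄, a₅, a₆, a₇⟩ := h
  refine ⟨⟨a₁, a₂.trans ?_⟩, by simpa using a₃, by simpa using a₄, by simpa using a₅,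
    by simpa using a₆, by simpa using a₇⟩
  simp [zipInit]; omega

section

variable [DecidableEq Q] [DecidableEq Γ] [DecidableEq R]

/-- The test whether two simulated paths are compatible. -/
def compat (s s' : Zipper Q Γ × Bool × List R × List (Q × Γ × Fin k)) : Bool :=
  (s.2.1 && s'.2.1) && ((M.final s.1.1 && M.accept s.1.1 (M.zipScanned s.1)) &&
    ((decide (s.1.1 = s'.1.1) && (decide (s.1.2.1 = s'.1.2.1) && decide (s.1.2.2 = s'.1.2.2))) &&
      decide (s.2.2.1 = s'.2.2.1)))

/-- `compat` tests acceptance only for the first path; the second one ends in the same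
configuration. -/
theorem compat_iff {T : ℕ} (x : List Bool) {l l' : List (Fin k)} (hl : l.length ≤ T)
    (hl' : l'.length ≤ T) : M.compat (M.simulate e T x l) (M.simulate e T x l') = true ↔
      M.Compatible (M.init x) (l.map e) (l'.map e) := by
  obtain ⟨⟨a₁, a₂⟩, a₃, a₄, -⟩ := M.simulate_spec e x hl
  obtain ⟨⟨b₁, b₂⟩, b₃, b₄, -⟩ := M.simulate_spec e x hl'
  have h := M.zipCfg_inj (T := T) (a₂.trans b₂.symm)
  rw [a₁, b₁, Prod.ext_iff, Prod.ext_iff] at h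
  have hfin : M.IsAccepting (endCfg (M.init x) (l.map e)) ↔
      (M.final (M.simulate e T x l).1.1 = true ∧
        M.accept (M.simulate e T x l).1.1 (M.zipScanned (M.simulate e T x l).1) = true) := by
    rw [← a₁, IsAccepting, scanned_zipCfg]; rfl
  rw [compat, a₄, b₄]
  simp only [Bool.and_eq_true, decide_eq_true_eq, a₃, b₃, ← hfin, ← h, Compatible,
    IsAcceptingPath, List.reverse_inj]
  constructor
  · rintro ⟨⟨h₁, h₂⟩, h₃, h₄, h₅⟩
    exact ⟨⟨h₁, h₃⟩, ⟨h₂, h₄ ▸ h₃⟩, h₄, h₅⟩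
  · rintro ⟨⟨h₁, h₃⟩, ⟨h₂, -⟩, h₄, h₅⟩
    exact ⟨⟨h₁, h₂⟩, h₃, h₄, h₅⟩

end

/-! ### Running time of the simulation -/

variable [FinEnc Q] [FinEnc Γ] {X : Type} [Enc X]

theorem polyTime_zipScanned {z : X → Zipper Q Γ} (hz : PolyTime z) :
    PolyTime (fun x => M.zipScanned (z x)) :=
  (PolyTime.listCases (g := fun _ a _ => a) (.comp .snd (.comp .snd hz)) (.const (M.symbol none))
    (.comp .fst .snd)).congr fun x => by rw [zipScanned]; cases (z x).2.2 <;> rfl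

theorem polyTime_zipMove {z : X → Zipper Q Γ} {i : X → Fin k} (hz : PolyTime z)
    (hi : PolyTime i) : PolyTime (fun x => M.zipMove (z x) (e (i x))) := by
  refine PolyTime.finElim (h := fun i x => M.zipMove (z x) (e i)) hi fun i => ?_
  have hl : PolyTime fun x => (z x).2.1 := .comp .fst (.comp .snd hz)
  have hr : PolyTime fun x => (z x).2.2 := .comp .snd (.comp .snd hz)
  have ha : PolyTime fun x => (z x).2.1.headD (M.symbol none) :=
    (PolyTime.listCases (g := fun _ a _ => a) hl (.const (M.symbol none))
      (.comp .fst .snd)).congr fun x => by cases (z x).2.1 <;> rfl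
  obtain ⟨q, g, d⟩ := e i
  cases d
  · exact .pair (.const q) (.pair hl (.cons (.const g) (.tail hr)))
  · exact .pair (.const q) (.pair (.tail hl) (.cons ha (.cons (.const g) (.tail hr))))
  · exact .pair (.const q) (.pair (.cons (.const g) hl) (.tail hr))

theorem polyTime_simulate [FinEnc R] [Fintype Q] [Fintype Γ] {T : X → ℕ} {f : X → List Bool}
    {l : X → List (Fin k)} (hT : PolyTime T)
    (hf : PolyTime f) (hl : PolyTime l) : PolyTime (fun x => M.simulate e (T x) (f x) (l x)) := by
  -- A step adds a bounded number of symbols to the code of the state; `100` is a generous bound.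
  refine PolyTime.foldl_of_le (f := fun _ => M.simStep e)
    (s := fun x => (M.zipInit (T x) (f x), true, [], [])) hl ?_ ?_ (.const 100) ?_
  · have hs : PolyTime fun p : X × (Zipper Q Γ × Bool × List R × List (Q × Γ × Fin k)) × Fin k =>
        p.2.1 := .comp .fst .snd
    have hi : PolyTime fun p : X × (Zipper Q Γ × Bool × List R × List (Q × Γ × Fin k)) × Fin k =>
        p.2.2 := .comp .snd .snd
    have hz := PolyTime.comp .fst hs
    have hq := PolyTime.comp .fst hz
    have hg := M.polyTime_zipScanned hz
    have ht := PolyTime.comp .snd (.comp .snd hs)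
    exact .pair (M.polyTime_zipMove e hz hi) (.pair (.and (.comp .fst (.comp .snd hs))
      (.finFun hq fun q => !M.final q)) (.pair (.cons (.finFun₂ hq hg M.outcome) (.comp .fst ht))
        (.cons (.pair hq (.pair hg hi)) (.comp .snd ht))))
  · exact .pair (.pair (.const _) (.pair (.replicate hT (.const _)) (.append
      (.map hf (.finFun .snd fun a => M.symbol (some a))) (.replicate (.succ hT) (.const _)))))
      (.const _)
  · rintro x ⟨⟨q, l, r⟩, c, o, a⟩ i -
    have : size (M.zipMove (q, l, r) (e i)) ≤ size ((q, l, r) : Zipper Q Γ) + 12 := by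
      obtain ⟨q', g, d⟩ := e i
      have h₁ := size_drop_le l 1
      have h₂ := size_drop_le r 1
      rw [List.drop_one] at h₁ h₂
      cases d <;> simp [zipMove] <;> omega
    simp only [simStep, size_pair, size_cons, size_fin] at this ⊢
    omega

theorem polyTime_compat [FinEnc R] [Fintype Q] [Fintype Γ] [Fintype R] [DecidableEq Q]
    [DecidableEq Γ] [DecidableEq R] {s s' : X → Zipper Q Γ × Bool × List R × List (Q × Γ × Fin k)}
    (hs : PolyTime s) (hs' : PolyTime s') : PolyTime (fun x => M.compat (s x) (s' x)) := by
  have hz := PolyTime.comp .fst hs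
  have hz' := PolyTime.comp .fst hs'
  have hq := PolyTime.comp .fst hz
  exact .and (.and (.comp .fst (.comp .snd hs)) (.comp .fst (.comp .snd hs')))
    (.and (.and (.finFun hq M.final) (.finFun₂ hq (M.polyTime_zipScanned hz) M.accept))
      (.and (.and (.finEq hq (.comp .fst hz')) (.and
        (.listEq (.comp .fst (.comp .snd hz)) (.comp .fst (.comp .snd hz')))
        (.listEq (.comp .snd (.comp .snd hz)) (.comp .snd (.comp .snd hz')))))
        (.listEq (.comp .fst (.comp .snd (.comp .snd hs)))
          (.comp .fst (.comp .snd (.comp .snd hs'))))))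

end QuantumTM

/-! ## Approximation of amplitudes -/

/-- The number `(a - c) + (b - d) i` is given by the quadruple `(a, b, c, d)`. -/
abbrev Gauss : Type := Bin × Bin × Bin × Bin

namespace Gauss

/-- The value of a quadruple. -/
def toC (z : Gauss) : ℂ := ⟨(z.1.val : ℝ) - z.2.2.1.val, (z.2.1.val : ℝ) - z.2.2.2.val⟩

/-- The product. -/
def mul (z w : Gauss) : Gauss :=
  (⟨(z.1.val * w.1.val + z.2.2.1.val * w.2.2.1.val) +
      (z.2.1.val * w.2.2.2.val + z.2.2.2.val * w.2.1.val)⟩,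
    ⟨(z.1.val * w.2.1.val + z.2.1.val * w.1.val) +
      (z.2.2.1.val * w.2.2.2.val + z.2.2.2.val * w.2.2.1.val)⟩,
    ⟨(z.1.val * w.2.2.1.val + z.2.2.1.val * w.1.val) +
      (z.2.1.val * w.2.1.val + z.2.2.2.val * w.2.2.2.val)⟩,
    ⟨(z.1.val * w.2.2.2.val + z.2.2.2.val * w.1.val) +
      (z.2.1.val * w.2.2.1.val + z.2.2.1.val * w.2.1.val)⟩)

/-- The complex conjugate. -/
def conj (z : Gauss) : Gauss := (z.1, z.2.2.2, z.2.2.1, z.2.1)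

/-- Numbers are kept as differences of natural numbers, because the product of differences is again
a difference of sums of products. So no signs and no subtractions are needed before the final
rounding. -/
theorem toC_mul (z w : Gauss) : (z.mul w).toC = z.toC * w.toC := by
  apply Complex.ext
  · simp [toC, mul]; ring
  · simp [toC, mul]; ring

theorem toC_conj (z : Gauss) : z.conj.toC = starRingEnd ℂ z.toC := by
  apply Complex.ext <;> simp [toC, conj]

/-- All entries are less than `2 ^ n`. -/
def Small (z : Gauss) (n : ℕ) : Prop :=
  z.1.val < 2 ^ n ∧ z.2.1.val < 2 ^ n ∧ z.2.2.1.val < 2 ^ n ∧ z.2.2.2.val < 2 ^ n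

theorem small_of_size_le {z : Gauss} {n : ℕ} (h : size z ≤ n) : z.Small n := by
  simp only [size_pair] at h
  have key : ∀ c : Bin, size c ≤ n → c.val < 2 ^ n := fun c hc =>
    c.lt_two_pow_size.trans_le (Nat.pow_le_pow_right (by omega) hc)
  exact ⟨key _ (by omega), key _ (by omega), key _ (by omega), key _ (by omega)⟩

theorem Small.size_le {z : Gauss} {n : ℕ} (h : z.Small n) : size z ≤ 7 * n + 3 := by
  have h₁ := Bin.size_le h.1
  have h₂ := Bin.size_le h.2.1
  have h₃ := Bin.size_le h.2.2.1
  have h₄ := Bin.size_le h.2.2.2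
  simp only [size_pair]
  omega

/-- Each entry is a sum of four products below `2 ^ (m + n)`, which costs two additional bits. -/
theorem Small.mul {z w : Gauss} {m n : ℕ} (hz : z.Small m) (hw : w.Small n) :
    (z.mul w).Small (m + (n + 2)) := by
  have key : ∀ {a b c d a' b' c' d' : ℕ}, a < 2 ^ m → b < 2 ^ m → c < 2 ^ m → d < 2 ^ m →
      a' < 2 ^ n → b' < 2 ^ n → c' < 2 ^ n → d' < 2 ^ n →
      (a * a' + b * b') + (c * c' + d * d') < 2 ^ (m + (n + 2)) := by
    intro a b c d a' b' c' d' h₁ h₂ h₃ h₄ h₁' h₂' h₃' h₄'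
    have := Nat.mul_lt_mul'' h₁ h₁'
    have := Nat.mul_lt_mul'' h₂ h₂'
    have := Nat.mul_lt_mul'' h₃ h₃'
    have := Nat.mul_lt_mul'' h₄ h₄'
    rw [pow_add, pow_add, ← mul_assoc]
    omega
  obtain ⟨h₁, h₂, h₃, h₄⟩ := hz
  obtain ⟨h₁', h₂', h₃', h₄'⟩ := hw
  exact ⟨key h₁ h₃ h₂ h₄ h₁' h₃' h₄' h₂', key h₁ h₂ h₃ h₄ h₂' h₁' h₄' h₃',
    key h₁ h₃ h₂ h₄ h₃' h₁' h₂' h₄', key h₁ h₄ h₂ h₃ h₄' h₁' h₃' h₂'⟩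

variable {X A : Type} [Enc X] [Enc A]

theorem polyTime_mul {f g : X → Gauss} (hf : PolyTime f) (hg : PolyTime g) :
    PolyTime (fun x => (f x).mul (g x)) := by
  have a₀ := PolyTime.comp .fst hf
  have a₁ := PolyTime.comp .fst (.comp .snd hf)
  have a₂ := PolyTime.comp .fst (.comp .snd (.comp .snd hf))
  have a₃ := PolyTime.comp .snd (.comp .snd (.comp .snd hf))
  have b₀ := PolyTime.comp .fst hg
  have b₁ := PolyTime.comp .fst (.comp .snd hg)
  have b₂ := PolyTime.comp .fst (.comp .snd (.comp .snd hg))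
  have b₃ := PolyTime.comp .snd (.comp .snd (.comp .snd hg))
  have key : ∀ {a b c d a' b' c' d' : X → Bin}, PolyTime a → PolyTime b → PolyTime c → PolyTime d →
      PolyTime a' → PolyTime b' → PolyTime c' → PolyTime d' →
      PolyTime fun x => (⟨((a x).val * (a' x).val + (b x).val * (b' x).val) +
        ((c x).val * (c' x).val + (d x).val * (d' x).val)⟩ : Bin) :=
    fun h₁ h₂ h₃ h₄ h₁' h₂' h₃' h₄' => .binAdd (.binAdd (.binMul h₁ h₁') (.binMul h₂ h₂'))
      (.binAdd (.binMul h₃ h₃') (.binMul h₄ h₄'))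
  exact .pair (key a₀ a₂ a₁ a₃ b₀ b₂ b₃ b₁) (.pair (key a₀ a₁ a₂ a₃ b₁ b₀ b₃ b₂)
    (.pair (key a₀ a₂ a₁ a₃ b₂ b₀ b₁ b₃) (key a₀ a₃ a₁ a₂ b₃ b₀ b₂ b₁)))

theorem polyTime_conj {f : X → Gauss} (hf : PolyTime f) : PolyTime (fun x => (f x).conj) :=
  .pair (.comp .fst hf) (.pair (.comp .snd (.comp .snd (.comp .snd hf)))
    (.pair (.comp .fst (.comp .snd (.comp .snd hf))) (.comp .fst (.comp .snd hf))))

/-- The number of bits grows only linearly in the number of factors. This is the bound on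
intermediate results that makes exact products of approximations computable in polynomial time. -/
theorem Small.foldl_mul {A : Type} {l : List A} {f : A → Gauss} {z : Gauss} {n C : ℕ}
    (hz : z.Small n) (h : ∀ a ∈ l, (f a).Small C) :
    (l.foldl (fun z a => z.mul (f a)) z).Small (n + l.length * (C + 2)) := by
  induction l generalizing z n with
  | nil => simpa using hz
  | cons a l ih =>
    have := ih (hz.mul (h a List.mem_cons_self)) fun b hb => h b (List.mem_cons_of_mem _ hb)
    rwa [List.foldl_cons, List.length_cons, Nat.succ_mul, Nat.add_comm (l.length * _),
      ← Nat.add_assoc]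

theorem polyTime_foldl_mul {l : X → List A} {f : X → A → Gauss} {s : X → Gauss} (hl : PolyTime l)
    (hf : PolyTime fun p : X × A => f p.1 p.2) (hs : PolyTime s) :
    PolyTime (fun x => (l x).foldl (fun z a => z.mul (f x a)) (s x)) := by
  obtain ⟨q, hq⟩ := hf.size_le
  obtain ⟨C, hC, hCq⟩ : ∃ C : X → ℕ, PolyBdd C ∧
      ∀ x, q.eval (2 * size x + size (l x) + 1) ≤ C x :=
    ⟨_, (((PolyBdd.const 2).mul (.size .id)).add (.size hl)).add (.const 1) |>.poly q,
      fun x => le_rfl⟩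
  have hB : PolyBdd fun x => 7 * (size (s x) + size (l x) * (C x + 2)) + 3 :=
    ((PolyBdd.const 7).mul ((PolyBdd.size hs).add ((PolyBdd.size hl).mul
      (hC.add (.const 2))))).add (.const 3)
  have hstep : PolyTime fun p : X × Gauss × A => p.2.1.mul (f p.1 p.2.2) :=
    have h₁ : PolyTime fun p : X × Gauss × A => p.2.1 := .comp .fst .snd
    have h₂ : PolyTime fun p : X × Gauss × A => f p.1 p.2.2 :=
      PolyTime.comp (g := fun p : X × A => f p.1 p.2) (f := fun p : X × Gauss × A => (p.1, p.2.2))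
        hf (.pair .fst (.comp .snd .snd))
    polyTime_mul h₁ h₂
  refine PolyTime.foldl (S := Gauss) (A := A) (X := X) (l := l) (s := s)
    (f := fun (x : X) (z : Gauss) (a : A) => z.mul (f x a)) hl hstep hs hB fun x i => ?_
  have hsm : ∀ a ∈ (l x).take i, (f x a).Small (C x) := by
    intro a ha
    refine small_of_size_le ((hq (x, a)).trans ((q.eval_mono_nat ?_).trans (hCq x)))
    have := size_le_of_mem (List.mem_of_mem_take ha)
    rw [size_pair]; simp only; omega
  have h₀ : (s x).Small (size (s x)) := small_of_size_le le_rfl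
  refine (h₀.foldl_mul hsm).size_le.trans ?_
  have h₁ := (List.length_take_le' i (l x)).trans (length_le_size (l x))
  have := Nat.mul_le_mul_right (C x + 2) h₁
  omega

theorem toC_foldl_mul {A : Type} (l : List A) (f : A → Gauss) (z : Gauss) :
    (l.foldl (fun z a => z.mul (f a)) z).toC = z.toC * (l.map fun a => (f a).toC).prod := by
  induction l generalizing z with
  | nil => simp
  | cons a l ih => rw [List.foldl_cons, ih, toC_mul, List.map_cons, List.prod_cons, mul_assoc]

end Gauss

/-! ### Rounding and propagation of errors -/

/-- The number `m / 2 ^ n`, rounded to an integer. -/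
def roundShift (m n : ℕ) : ℕ := (m + 2 ^ (n - 1)) / 2 ^ n

/-- `2 ^ (n - 1)` is half of the denominator, so adding it before the division rounds to a nearest
integer. For `n = 0` it would not be half. -/
theorem abs_roundShift_sub_le (m : ℕ) {n : ℕ} (hn : n ≠ 0) :
    |(roundShift m n : ℝ) - m / 2 ^ n| ≤ 1 / 2 := by
  obtain ⟨n, rfl⟩ := Nat.exists_eq_succ_of_ne_zero hn
  have hp : (0 : ℝ) < 2 ^ (n + 1) := by positivity
  have h₁ := Nat.div_add_mod (m + 2 ^ n) (2 ^ (n + 1))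
  have h₂ := Nat.mod_lt (m + 2 ^ n) (show 0 < 2 ^ (n + 1) by positivity)
  have h₃ : roundShift m (n + 1) = (m + 2 ^ n) / 2 ^ (n + 1) := rfl
  rw [← h₃] at h₁
  generalize roundShift m (n + 1) = r at *
  generalize (m + 2 ^ n) % 2 ^ (n + 1) = d at *
  have h₁' : (2 : ℝ) ^ (n + 1) * r + d = m + 2 ^ n := by exact_mod_cast h₁
  have h₂' : (d : ℝ) < 2 ^ (n + 1) := by exact_mod_cast h₂
  have h₄ : (0 : ℝ) ≤ d := d.cast_nonneg
  have h₅ : (r : ℝ) - m / 2 ^ (n + 1) = (2 ^ n - d) / 2 ^ (n + 1) := by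
    field_simp; linarith
  have h₆ : (2 : ℝ) ^ (n + 1) = 2 * 2 ^ n := by rw [pow_succ]; ring
  rw [Nat.succ_eq_add_one, h₅, abs_div, abs_of_pos hp, div_le_iff₀ hp, h₆, abs_le]
  constructor <;> nlinarith

theorem roundShift_zero {n : ℕ} (hn : n ≠ 0) : roundShift 0 n = 0 := by
  rw [roundShift, Nat.zero_add]
  exact Nat.div_eq_of_lt (Nat.pow_lt_pow_right (by omega) (by omega))

theorem PolyTime.roundShift {X : Type} [Enc X] {f : X → Bin} {n : X → ℕ} (hf : PolyTime f)
    (hn : PolyTime n) : PolyTime (fun x => (⟨roundShift (f x).val (n x)⟩ : Bin)) :=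
  binShift (binAdd hf (binPow (sub hn (const 1)))) hn

/-- The error of a product of approximations. -/
theorem norm_prod_sub_prod_le (l : List (ℂ × ℂ)) {ε : ℝ} (h0 : 0 ≤ ε) (h1 : ε ≤ 1)
    (h : ∀ a ∈ l, ‖a.1‖ ≤ 1 ∧ ‖a.1 - a.2‖ ≤ ε) :
    ‖(l.map Prod.fst).prod‖ ≤ 1 ∧
      ‖(l.map Prod.fst).prod - (l.map Prod.snd).prod‖ ≤ (2 ^ l.length - 1) * ε := by
  induction l with
  | nil => simp
  | cons a l ih =>
    obtain ⟨i₁, i₂⟩ := ih fun b hb => h b (List.mem_cons_of_mem _ hb)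
    obtain ⟨h₁, h₂⟩ := h a List.mem_cons_self
    simp only [List.map_cons, List.prod_cons, List.length_cons]
    generalize (l.map Prod.fst).prod = p at *
    generalize (l.map Prod.snd).prod = p' at *
    -- The approximation of a number of modulus at most 1 may be larger than 1, but by at most `ε ≤
    -- 1`.
    have h₃ : ‖a.2‖ ≤ 2 := by
      have := norm_sub_le a.1 (a.1 - a.2)
      rw [sub_sub_cancel] at this
      linarith
    refine ⟨by rw [norm_mul]; exact mul_le_one₀ h₁ (norm_nonneg _) i₁, ?_⟩
    -- The resulting recursion for the error is `ε + 2 * (2 ^ n - 1) * ε = (2 ^ (n + 1) - 1) * ε`,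
    -- where `n` is the length of the tail.
    have h₄ : a.1 * p - a.2 * p' = (a.1 - a.2) * p + a.2 * (p - p') := by ring
    rw [h₄]
    refine (norm_add_le _ _).trans ?_
    rw [norm_mul, norm_mul, pow_succ]
    have h₅ := mul_le_mul h₂ i₁ (norm_nonneg _) h0
    have h₆ := mul_le_mul h₃ i₂ (norm_nonneg _) zero_le_two
    linarith

/-- Efficiently computable complex numbers. -/
theorem EfficientReal.exists_gauss {z : ℂ} (hre : EfficientReal z.re) (him : EfficientReal z.im) :
    ∃ g : ℕ → Gauss, PolyTime g ∧ ∀ b, ‖z - (g b).toC / 2 ^ b‖ ≤ 2 / 2 ^ b := by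
  have key : ∀ v : ℕ → ℤ,
      Nonempty (TM2ComputableInPolyTime unaryEncodingNat.encode encodingInt.encode v) →
      PolyTime (fun b => (⟨(v b).toNat⟩ : Bin)) ∧ PolyTime (fun b => (⟨(-v b).toNat⟩ : Bin)) := by
    rintro v ⟨h⟩
    have h' : PolyTime fun n : ℕ => (⟨encodingInt.encode (v n)⟩ : Bits) :=
      PolyTime.of_stackMachine (v := fun n => encodingInt.encode (v n))
        ⟨h.toTM2ComputableAux, h.time, h.outputsFun⟩
    have hs : PolyTime fun n => decide (v n < 0) :=
      (PolyTime.elim (g := fun _ (p : Bool × Bits) => p.1) (.comp .bitsUncons h') (.const false)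
        (.comp .fst .snd)).congr fun n => rfl
    have ha : PolyTime fun n => (⟨(v n).natAbs⟩ : Bin) :=
      .of_enc_congr (PolyTime.elim (g := fun _ (p : Bool × Bits) => p.2) (.comp .bitsUncons h')
        (.const ⟨[]⟩) (.comp .snd .snd)) fun n => rfl
    constructor
    · refine (PolyTime.cond hs (.const ⟨0⟩) ha).congr fun n => ?_
      by_cases hn : v n < 0 <;> simp [hn] <;> omega
    · refine (PolyTime.cond hs ha (.const ⟨0⟩)).congr fun n => ?_
      by_cases hn : v n < 0 <;> simp [hn] <;> omega
  obtain ⟨v, hv, hv'⟩ := hre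
  obtain ⟨w, hw, hw'⟩ := him
  refine ⟨fun b => (⟨(v b).toNat⟩, ⟨(w b).toNat⟩, ⟨(-v b).toNat⟩, ⟨(-w b).toNat⟩),
    .pair (key v hv).1 (.pair (key w hw).1 (.pair (key v hv).2 (key w hw).2)), fun b => ?_⟩
  have hz : ∀ z : ℤ, ((z.toNat : ℕ) : ℝ) - ((-z).toNat : ℕ) = z := by
    intro z
    have : ((z.toNat : ℕ) : ℤ) - ((-z).toNat : ℕ) = z := by omega
    exact_mod_cast this
  have hp : ((2 : ℂ) ^ b) = ((2 ^ b : ℝ) : ℂ) := by push_cast; rfl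
  -- The errors of the real and the imaginary part add up, whence the numerator `2`.
  refine (Complex.norm_le_abs_re_add_abs_im _).trans ?_
  rw [Complex.sub_re, Complex.sub_im, hp, Complex.div_ofReal_re, Complex.div_ofReal_im]
  simp only [Gauss.toC, hz]
  have := add_le_add (hv' b) (hw' b)
  rw [← add_div] at this
  norm_num at this ⊢
  exact this

/-! ## Approximation of the weights of pairs of paths -/

/-- The integer with a given sign and absolute value. -/
def signedVal (r : Bool × Bin) : ℤ := bif r.1 then -(r.2.val : ℤ) else r.2.val

/-- The real part of a number, divided by `2 ^ n` and rounded to an integer. -/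
def Gauss.roundRe (z : Gauss) (n : ℕ) : Bool × Bin :=
  (!decide (roundShift (z.2.2.1.val - z.1.val) n = 0),
    ⟨roundShift (z.1.val - z.2.2.1.val) n + roundShift (z.2.2.1.val - z.1.val) n⟩)

/-- One of the two truncated differences is zero and remains so after rounding, hence the sum in
`roundRe` is the absolute value. The sign is set only if the rounded negative part is nonzero: a
negative number that is rounded to zero must not get a sign, as its code would be wrong. -/
theorem Gauss.roundRe_spec (z : Gauss) {n : ℕ} (hn : n ≠ 0) :
    ((z.roundRe n).1 = decide (signedVal (z.roundRe n) < 0) ∧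
      (z.roundRe n).2.val = (signedVal (z.roundRe n)).natAbs) ∧
    |(signedVal (z.roundRe n) : ℝ) - z.toC.re / 2 ^ n| ≤ 1 / 2 := by
  obtain ⟨⟨a⟩, b, ⟨c⟩, d⟩ := z
  rcases le_total a c with h | h
  · have h₁ := abs_roundShift_sub_le (c - a) hn
    have e : roundRe (⟨a⟩, b, ⟨c⟩, d) n =
        (!decide (roundShift (c - a) n = 0), ⟨roundShift (c - a) n⟩) := by
      simp [roundRe, Nat.sub_eq_zero_of_le h, roundShift_zero hn]
    rw [Nat.cast_sub h] at h₁
    rw [e]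
    generalize roundShift (c - a) n = r at *
    have hv : signedVal (!decide (r = 0), ⟨r⟩) = -(r : ℤ) := by
      by_cases hr : r = 0 <;> simp [signedVal, hr]
    rw [hv]
    refine ⟨⟨?_, by simp⟩, ?_⟩
    · rw [← decide_not]; exact decide_eq_decide.mpr (by omega)
    · have h₃ : (-(r : ℝ)) - ((a : ℝ) - c) / 2 ^ n = -((r : ℝ) - ((c : ℝ) - a) / 2 ^ n) := by ring
      push_cast
      simp only [toC]
      rw [h₃, abs_neg]; exact h₁
  · have h₁ := abs_roundShift_sub_le (a - c) hn
    have e : roundRe (⟨a⟩, b, ⟨c⟩, d) n = (false, ⟨roundShift (a - c) n⟩) := by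
      simp [roundRe, Nat.sub_eq_zero_of_le h, roundShift_zero hn]
    rw [Nat.cast_sub h] at h₁
    rw [e]
    refine ⟨⟨(decide_eq_false (by simp [signedVal])).symm, by simp [signedVal]⟩, ?_⟩
    simpa [signedVal, toC] using h₁

theorem Gauss.polyTime_roundRe {X : Type} [Enc X] {z : X → Gauss} {n : X → ℕ} (hz : PolyTime z)
    (hn : PolyTime n) : PolyTime (fun x => (z x).roundRe (n x)) := by
  have h₀ := PolyTime.comp .fst hz
  have h₂ := PolyTime.comp .fst (.comp .snd (.comp .snd hz))
  have h₃ := PolyTime.roundShift (.binSub h₂ h₀) hn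
  exact .pair (.not (.binZero h₃)) (.binAdd (.roundShift (.binSub h₀ h₂) hn) h₃)

namespace QuantumTM

variable {Q Γ R : Type} (M : QuantumTM Q Γ R)

theorem move_injective (c : QCfg Q Γ) : Function.Injective c.move := by
  rintro ⟨q, s, d⟩ ⟨q', s', d'⟩ h
  have h₁ : q = q' := congrArg QCfg.state h
  have h₂ : c.head + (d : ℤ) = c.head + (d' : ℤ) := congrArg QCfg.head h
  have h₃ := congrFun (congrArg QCfg.tape h) c.head
  simp only [QCfg.move, Function.update_self] at h₃
  have h₄ : d = d' := by
    cases d <;> cases d' <;> simp at h₂ ⊢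
  rw [h₁, h₃, h₄]

/-- Different moves lead from a configuration to different ones, so the amplitude is a coefficient
of the image of a basis vector, and that image has norm 1. Well-formedness says nothing about final
configurations, hence the hypothesis on `q`. -/
theorem norm_amplitude_le [Fintype Q] [Fintype Γ] (hwf : M.WellFormed) {q : Q}
    (hq : M.final q = false) (s : Γ) (m : Q × Γ × SignType) : ‖M.amplitude q s m‖ ≤ 1 := by
  classical
  let c : QCfg Q Γ := ⟨q, 0, fun _ => s⟩
  have h := hwf (Finsupp.single c 1) fun c' hc' => by
    rw [Finsupp.mem_support_single] at hc'
    rw [hc'.1]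
    simp [IsFinal, c, hq]
  have h₁ : superNormSq (Finsupp.single c (1 : ℂ)) = 1 := by simp [superNormSq]
  rw [h₁] at h
  have h₂ : M.evolve (Finsupp.single c 1) =
      ∑ m : Q × Γ × SignType, Finsupp.single (c.move m) (M.amplitude q s m) := by
    rw [evolve, Finsupp.sum_single_index (by simp)]
    simp only [one_mul]
    rfl
  have h₃ : M.evolve (Finsupp.single c 1) (c.move m) = M.amplitude q s m := by
    rw [h₂, Finsupp.finsetSum_apply, Finset.sum_eq_single m]
    · simp
    · intro m' _ hm'
      exact Finsupp.single_eq_of_ne' fun h => hm' (move_injective c h)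
    · simp
  by_contra hlt
  rw [not_le] at hlt
  have h₄ : ‖M.evolve (Finsupp.single c 1) (c.move m)‖ ^ 2 ≤
      superNormSq (M.evolve (Finsupp.single c 1)) := by
    refine Finset.single_le_sum (f := fun a => ‖M.evolve (Finsupp.single c 1) a‖ ^ 2)
      (fun _ _ => by positivity) ?_
    rw [Finsupp.mem_support_iff, h₃]
    intro h0
    rw [h0, norm_zero] at hlt
    linarith
  rw [h₃, h] at h₄
  nlinarith

variable {k : ℕ} (e : Fin k ≃ Q × Γ × SignType) (amp : Q → Γ → Q × Γ × SignType → ℕ → Gauss)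

/-- The approximate product of the amplitude of a path and the conjugate of that of another one,
given the arguments of their transition amplitudes. -/
def pathProd (n : ℕ) (s s' : List (Q × Γ × Fin k)) : Gauss :=
  s'.foldl (fun z a => z.mul (amp a.1 a.2.1 (e a.2.2) n).conj)
    (s.foldl (fun z a => z.mul (amp a.1 a.2.1 (e a.2.2) n)) (⟨2 ^ n⟩, ⟨0⟩, ⟨0⟩, ⟨0⟩))

/-- `pathProd` starts with `2 ^ n` instead of `1`, which accounts for the additional `n` in the
exponent. Thereby the exponent exceeds the precision `b` required later even for empty paths, and
the final division is a genuine shift. -/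
theorem norm_sub_pathProd_le (hn : ∀ q s m, M.final q = false → ‖M.amplitude q s m‖ ≤ 1)
    (ha : ∀ q s m n, ‖M.amplitude q s m - (amp q s m n).toC / 2 ^ n‖ ≤ 2 / 2 ^ n)
    {n : ℕ} (h1 : 1 ≤ n) {s s' : List (Q × Γ × Fin k)} (hs : ∀ a ∈ s, M.final a.1 = false)
    (hs' : ∀ a ∈ s', M.final a.1 = false) :
    ‖(s.map fun a => M.amplitude a.1 a.2.1 (e a.2.2)).prod *
        starRingEnd ℂ (s'.map fun a => M.amplitude a.1 a.2.1 (e a.2.2)).prod -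
      (pathProd e amp n s s').toC / 2 ^ ((s.length + s'.length + 1) * n)‖ ≤
    2 ^ (s.length + s'.length) * (2 / 2 ^ n) := by
  have hε : (0 : ℝ) ≤ 2 / 2 ^ n := by positivity
  have hε' : (2 : ℝ) / 2 ^ n ≤ 1 := by
    rw [div_le_one (by positivity)]
    calc (2 : ℝ) = 2 ^ 1 := by norm_num
      _ ≤ 2 ^ n := pow_le_pow_right₀ (by norm_num) h1
  have scale : ∀ (l : List (Q × Γ × Fin k)) (f : Q × Γ × Fin k → ℂ),
      (l.map f).prod = (l.map fun a => f a / 2 ^ n).prod * 2 ^ (l.length * n) := by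
    intro l f
    induction l with
    | nil => simp
    | cons a l ih =>
      rw [List.map_cons, List.prod_cons, ih, List.map_cons, List.prod_cons, List.length_cons,
        Nat.succ_mul, pow_add]
      field_simp
  obtain ⟨-, h⟩ := norm_prod_sub_prod_le
    ((s.map fun a => (M.amplitude a.1 a.2.1 (e a.2.2),
        (amp a.1 a.2.1 (e a.2.2) n).toC / 2 ^ n)) ++
      (s'.map fun a => (starRingEnd ℂ (M.amplitude a.1 a.2.1 (e a.2.2)),
        (amp a.1 a.2.1 (e a.2.2) n).conj.toC / 2 ^ n))) hε hε' (by
    intro a ha'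
    rcases List.mem_append.mp ha' with h | h
    · obtain ⟨b, hb, rfl⟩ := List.mem_map.mp h
      exact ⟨hn _ _ _ (hs b hb), ha _ _ _ _⟩
    · obtain ⟨b, hb, rfl⟩ := List.mem_map.mp h
      refine ⟨by rw [Complex.norm_conj]; exact hn _ _ _ (hs' b hb), ?_⟩
      have h2 : (2 : ℂ) ^ n = starRingEnd ℂ (2 ^ n) := by
        rw [map_pow, Complex.conj_ofNat]
      simp only
      rw [Gauss.toC_conj, h2, ← map_div₀, ← map_sub, Complex.norm_conj]
      exact ha _ _ _ _)
  simp only [List.map_append, List.prod_append, List.map_map, Function.comp_def,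
    List.length_append, List.length_map] at h
  have hp : (pathProd e amp n s s').toC / 2 ^ ((s.length + s'.length + 1) * n) =
      (s.map fun a => (amp a.1 a.2.1 (e a.2.2) n).toC / 2 ^ n).prod *
        (s'.map fun a => (amp a.1 a.2.1 (e a.2.2) n).conj.toC / 2 ^ n).prod := by
    rw [pathProd, Gauss.toC_foldl_mul, Gauss.toC_foldl_mul,
      scale s fun a => (amp a.1 a.2.1 (e a.2.2) n).toC,
      scale s' fun a => (amp a.1 a.2.1 (e a.2.2) n).conj.toC]
    have : Gauss.toC (⟨2 ^ n⟩, ⟨0⟩, ⟨0⟩, ⟨0⟩) = 2 ^ n := by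
      have h2 : (2 : ℂ) ^ n = ((2 ^ n : ℝ) : ℂ) := by push_cast; rfl
      rw [h2]
      apply Complex.ext <;> simp [Gauss.toC, -Complex.ofReal_pow]
    rw [this, add_mul, add_mul, pow_add, pow_add, one_mul]
    field_simp
  have hc : starRingEnd ℂ (s'.map fun a => M.amplitude a.1 a.2.1 (e a.2.2)).prod =
      (s'.map fun a => starRingEnd ℂ (M.amplitude a.1 a.2.1 (e a.2.2))).prod := by
    rw [map_list_prod, List.map_map]; rfl
  rw [hp, hc]
  refine h.trans ?_
  exact mul_le_mul_of_nonneg_right (by linarith) hε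

section

variable [Fintype Q] [FinEnc Q] [Fintype Γ] [FinEnc Γ] {X : Type} [Enc X]

theorem polyTime_amp (hamp : ∀ q s m, PolyTime (amp q s m)) {n : X → ℕ} {a : X → Q × Γ × Fin k}
    (hn : PolyTime n) (ha : PolyTime a) :
    PolyTime fun x => amp (a x).1 (a x).2.1 (e (a x).2.2) (n x) := by
  refine PolyTime.finElim (h := fun q x => amp q (a x).2.1 (e (a x).2.2) (n x))
    (.comp .fst ha) fun q => ?_
  refine PolyTime.finElim (h := fun s x => amp q s (e (a x).2.2) (n x))
    (.comp .fst (.comp .snd ha)) fun s => ?_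
  exact PolyTime.finElim (h := fun i x => amp q s (e i) (n x))
    (.comp .snd (.comp .snd ha)) fun i => .comp (hamp q s (e i)) hn

theorem polyTime_pathProd (hamp : ∀ q s m, PolyTime (amp q s m)) {n : X → ℕ}
    {s s' : X → List (Q × Γ × Fin k)} (hn : PolyTime n) (hs : PolyTime s) (hs' : PolyTime s') :
    PolyTime fun x => pathProd e amp (n x) (s x) (s' x) := by
  have h₀ : PolyTime fun p : X × (Q × Γ × Fin k) => amp p.2.1 p.2.2.1 (e p.2.2.2) (n p.1) :=
    polyTime_amp e amp hamp (n := fun p : X × (Q × Γ × Fin k) => n p.1) (a := fun p => p.2)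
      (hn.comp .fst) .snd
  have h₁ := Gauss.polyTime_conj h₀
  have h₂ : PolyTime fun x => ((⟨2 ^ n x⟩, ⟨0⟩, ⟨0⟩, ⟨0⟩) : Gauss) :=
    .pair (.binPow hn) (.const ((⟨0⟩, ⟨0⟩, ⟨0⟩) : Bin × Bin × Bin))
  have h₃ := Gauss.polyTime_foldl_mul (X := X) (A := Q × Γ × Fin k)
    (f := fun x a => amp a.1 a.2.1 (e a.2.2) (n x)) hs h₀ h₂
  exact Gauss.polyTime_foldl_mul (X := X) (A := Q × Γ × Fin k)
    (f := fun x a => (amp a.1 a.2.1 (e a.2.2) (n x)).conj) hs' h₁ h₃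

end

section

variable [DecidableEq Q] [DecidableEq Γ] [DecidableEq R]

/-- The approximate weight of a pair of simulated paths. -/
def approxPair (T b : ℕ) (s s' : Zipper Q Γ × Bool × List R × List (Q × Γ × Fin k)) : Bool × Bin :=
  bif M.compat s s' then
    (pathProd e amp (b + 2 * T + 2) s.2.2.2 s'.2.2.2).roundRe
      ((s.2.2.2.length + s'.2.2.2.length + 1) * (b + 2 * T + 2) - b)
  else (false, ⟨0⟩)

/-- The approximate weight of a bit string. -/
def approxWeight (t : Polynomial ℕ) (y : List Bool × List Bool × ℕ) : Bool × Bin :=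
  (decodePair k (t.eval y.1.length) y.2.1).elim (false, ⟨0⟩) fun p =>
    M.approxPair e amp (t.eval y.1.length) y.2.2 (M.simulate e (t.eval y.1.length) y.1 p.1)
      (M.simulate e (t.eval y.1.length) y.1 p.2)

theorem approxPair_sign (T b : ℕ) (s s' : Zipper Q Γ × Bool × List R × List (Q × Γ × Fin k)) :
    (M.approxPair e amp T b s s').1 = decide (signedVal (M.approxPair e amp T b s s') < 0) ∧
      (M.approxPair e amp T b s s').2.val = (signedVal (M.approxPair e amp T b s s')).natAbs := by
  rw [approxPair]
  cases M.compat s s' with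
  | false => simp [signedVal]
  | true =>
    refine (Gauss.roundRe_spec _ ?_).1
    rw [add_mul, one_mul]; omega

theorem approxWeight_sign (t : Polynomial ℕ) (y : List Bool × List Bool × ℕ) :
    (M.approxWeight e amp t y).1 = decide (signedVal (M.approxWeight e amp t y) < 0) ∧
      (M.approxWeight e amp t y).2.val = (signedVal (M.approxWeight e amp t y)).natAbs := by
  rw [approxWeight]
  cases decodePair k (t.eval y.1.length) y.2.1 with
  | none => simp [signedVal]
  | some p => exact M.approxPair_sign e amp _ _ _ _

/-- For compatible paths the product has an error of at most `2 ^ (2 * T) * (2 / 2 ^ (b + 2 * T +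
2))`, which is half of `1 / 2 ^ b`. Rounding to an integer after scaling by `2 ^ b` adds at most the
other half. For other paths both weight and approximation are zero. -/
theorem abs_pairWeight_sub_le (hn : ∀ q s m, M.final q = false → ‖M.amplitude q s m‖ ≤ 1)
    (ha : ∀ q s m n, ‖M.amplitude q s m - (amp q s m n).toC / 2 ^ n‖ ≤ 2 / 2 ^ n)
    (T b : ℕ) (x : List Bool) {l l' : List (Fin k)} (hl : l.length ≤ T) (hl' : l'.length ≤ T) :
    |M.pairWeight x (l.map e) (l'.map e) - (signedVal (M.approxPair e amp T b
      (M.simulate e T x l) (M.simulate e T x l')) : ℝ) / 2 ^ b| ≤ 1 / 2 ^ b := by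
  rw [pairWeight, approxPair]
  by_cases hc : M.Compatible (M.init x) (l.map e) (l'.map e)
  · rw [if_pos hc, (M.compat_iff e x hl hl').mpr hc, cond_true]
    obtain ⟨-, -, -, h₁, h₂, h₃⟩ := M.simulate_spec e x hl
    obtain ⟨-, -, -, h₁', h₂', h₃'⟩ := M.simulate_spec e x hl'
    have h := M.norm_sub_pathProd_le e amp hn ha (n := b + 2 * T + 2) (by omega)
      (h₃ hc.1.1) (h₃' hc.2.1.1)
    rw [h₁, h₁'] at h
    have hE : ((M.simulate e T x l).2.2.2.length + (M.simulate e T x l').2.2.2.length + 1) *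
        (b + 2 * T + 2) - b ≠ 0 := by rw [add_mul, one_mul]; omega
    have hr := (Gauss.roundRe_spec (pathProd e amp (b + 2 * T + 2) (M.simulate e T x l).2.2.2
      (M.simulate e T x l').2.2.2) hE).2
    generalize M.pathAmplitude (M.init x) (l.map e) *
      starRingEnd ℂ (M.pathAmplitude (M.init x) (l'.map e)) = a at h ⊢
    rw [h₂, h₂'] at h hE hr ⊢
    generalize pathProd e amp (b + 2 * T + 2) _ _ = z at h hr ⊢
    generalize signedVal (z.roundRe _) = v at hr ⊢
    have hEb : (l.length + l'.length + 1) * (b + 2 * T + 2) =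
        ((l.length + l'.length + 1) * (b + 2 * T + 2) - b) + b := by
      have : b ≤ (l.length + l'.length + 1) * (b + 2 * T + 2) := by rw [add_mul, one_mul]; omega
      omega
    generalize (l.length + l'.length + 1) * (b + 2 * T + 2) - b = E at hE hr hEb
    rw [hEb] at h
    have hre : |a.re - z.toC.re / 2 ^ (E + b)| ≤
        2 ^ (l.length + l'.length) * (2 / 2 ^ (b + 2 * T + 2)) := by
      refine le_trans ?_ h
      have h2 : (2 : ℂ) ^ (E + b) = ((2 ^ (E + b) : ℝ) : ℂ) := by push_cast; rfl
      have := Complex.abs_re_le_norm (a - z.toC / 2 ^ (E + b))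
      rwa [Complex.sub_re, h2, Complex.div_ofReal_re, ← h2] at this
    have hT : (2 : ℝ) ^ (l.length + l'.length) * (2 / 2 ^ (b + 2 * T + 2)) ≤ (1 / 2) / 2 ^ b := by
      have : (2 : ℝ) ^ (l.length + l'.length) ≤ 2 ^ (2 * T) :=
        pow_le_pow_right₀ (by norm_num) (by omega)
      rw [pow_add 2 (b + 2 * T), pow_add 2 b, ← mul_div_assoc,
        div_le_div_iff₀ (by positivity) (by positivity)]
      have h0 : (0 : ℝ) < 2 ^ b := by positivity
      nlinarith [mul_le_mul_of_nonneg_right this h0.le]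
    have hv : |z.toC.re / 2 ^ (E + b) - v / 2 ^ b| ≤ (1 / 2) / 2 ^ b := by
      have : z.toC.re / 2 ^ (E + b) - v / 2 ^ b = -((v - z.toC.re / 2 ^ E) / 2 ^ b) := by
        rw [pow_add]; field_simp; ring
      rw [this, abs_neg, abs_div, abs_of_pos (show (0 : ℝ) < 2 ^ b by positivity)]
      gcongr
    calc |a.re - v / 2 ^ b|
        ≤ |a.re - z.toC.re / 2 ^ (E + b)| + |z.toC.re / 2 ^ (E + b) - v / 2 ^ b| :=
          abs_sub_le _ _ _
      _ ≤ (1 / 2) / 2 ^ b + (1 / 2) / 2 ^ b := add_le_add (hre.trans hT) hv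
      _ = 1 / 2 ^ b := by ring
  · have hc' : M.compat (M.simulate e T x l) (M.simulate e T x l') = false := by
      rw [← Bool.not_eq_true, M.compat_iff e x hl hl']; exact hc
    rw [if_neg hc, hc']
    simp [signedVal]

variable [Fintype Q] [FinEnc Q] [Fintype Γ] [FinEnc Γ] [Fintype R] [FinEnc R]

theorem polyTime_approxPair {X : Type} [Enc X] (hamp : ∀ q s m, PolyTime (amp q s m)) {T b : X → ℕ}
    {s s' : X → Zipper Q Γ × Bool × List R × List (Q × Γ × Fin k)} (hT : PolyTime T)
    (hb : PolyTime b) (hs : PolyTime s) (hs' : PolyTime s') :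
    PolyTime fun x => M.approxPair e amp (T x) (b x) (s x) (s' x) := by
  have hn : PolyTime fun x => b x + 2 * T x + 2 :=
    .add (.add hb (.mul (.const 2) hT)) (.const 2)
  have hk : PolyTime fun x => (s x).2.2.2 := .comp .snd (.comp .snd (.comp .snd hs))
  have hk' : PolyTime fun x => (s' x).2.2.2 := .comp .snd (.comp .snd (.comp .snd hs'))
  have hE : PolyTime fun x =>
      ((s x).2.2.2.length + (s' x).2.2.2.length + 1) * (b x + 2 * T x + 2) - b x :=
    .sub (.mul (.succ (.add (.length hk) (.length hk'))) hn) hb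
  have hz := Gauss.polyTime_roundRe (polyTime_pathProd e amp hamp hn hk hk') hE
  exact .cond (M.polyTime_compat hs hs') hz (.const _)

theorem polyTime_approxWeight (hamp : ∀ q s m, PolyTime (amp q s m)) (t : Polynomial ℕ) :
    PolyTime (M.approxWeight e amp t) := by
  have hT : PolyTime fun y : List Bool × List Bool × ℕ => t.eval y.1.length :=
    .polyEval (.length .fst) t
  have hd := PolyTime.decodePair (k := k) hT (.comp .fst .snd)
  let Y := (List Bool × List Bool × ℕ) × List (Fin k) × List (Fin k)
  have hx' : PolyTime fun p : Y => p.1.1 := .comp .fst .fst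
  have hb' : PolyTime fun p : Y => p.1.2.2 := .comp .snd (.comp .snd .fst)
  have hT' : PolyTime fun p : Y => t.eval p.1.1.length := .polyEval (.length hx') t
  have hl : PolyTime fun p : Y => p.2.1 := .comp .fst .snd
  have hl' : PolyTime fun p : Y => p.2.2 := .comp .snd .snd
  have hp := M.polyTime_approxPair e amp hamp hT' hb' (M.polyTime_simulate e hT' hx' hl)
    (M.polyTime_simulate e hT' hx' hl')
  exact PolyTime.elim (X := List Bool × List Bool × ℕ) (Y := Bool × Bin)
    (Z := List (Fin k) × List (Fin k)) (g := fun y p => M.approxPair e amp (t.eval y.1.length) y.2.2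
      (M.simulate e (t.eval y.1.length) y.1 p.1) (M.simulate e (t.eval y.1.length) y.1 p.2)) hd
    (.const _) hp

end

/-- The weight of the pair of paths that is encoded by a bit string. -/
noncomputable def bitWeight (t : Polynomial ℕ) (x u : List Bool) : ℝ :=
  (decodePair k (t.eval x.length) u).elim 0 fun p => M.pairWeight x (p.1.map e) (p.2.map e)

theorem efficientlyApproximable_bitWeight [Fintype Q] [Fintype Γ] [Fintype R] (hwf : M.WellFormed)
    (hamp : M.HasEfficientAmplitudes) (t : Polynomial ℕ) :
    EfficientlyApproximable (M.bitWeight e t) := by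
  classical
  have enc : ∀ (F : Type) [Fintype F], FinEnc F := fun F _ =>
    ⟨fun a => (Fintype.equivFin F a).val, fun a b h => by simpa [Fin.val_inj] using h⟩
  let _ : FinEnc Q := enc Q
  let _ : FinEnc Γ := enc Γ
  let _ : FinEnc R := enc R
  choose amp ha ha' using fun q s m =>
    EfficientReal.exists_gauss (hamp q s m).1 (hamp q s m).2
  refine ⟨fun y => signedVal (M.approxWeight e amp t y), PolyTime.toStackMachine_triple
    (M.polyTime_approxWeight e amp ha t) (M.approxWeight_sign e amp t), fun x u b => ?_⟩
  simp only [bitWeight, approxWeight]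
  cases h : decodePair k (t.eval x.length) u with
  | none => simp [signedVal]
  | some p =>
    obtain ⟨h₁, h₂, -⟩ := decodePair_eq_some.mp h
    exact M.abs_pairWeight_sub_le e amp (fun q s m hq => M.norm_amplitude_le hwf hq s m) ha' _ b x
      h₁ h₂

end QuantumTM

/-! ## The acceptance probability as a sum over pairs of paths -/

section

variable {Q Γ : Type}

theorem superNormSq_nonneg (ψ : QCfg Q Γ →₀ ℂ) : 0 ≤ superNormSq ψ :=
  Finset.sum_nonneg fun _ _ => by positivity

theorem superNormSq_filter (p : QCfg Q Γ → Prop) [DecidablePred p] (ψ : QCfg Q Γ →₀ ℂ) :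
    superNormSq (ψ.filter p) = ∑ c ∈ ψ.support, if p c then ‖ψ c‖ ^ 2 else 0 := by
  rw [superNormSq, Finsupp.sum, Finsupp.support_filter, Finset.sum_filter]
  refine Finset.sum_congr rfl fun c _ => ?_
  split_ifs with h
  · rw [Finsupp.filter_apply_pos _ _ h]
  · rfl

theorem superNormSq_smul (a : ℂ) (ψ : QCfg Q Γ →₀ ℂ) :
    superNormSq (a • ψ) = ‖a‖ ^ 2 * superNormSq ψ := by
  rw [superNormSq, Finsupp.sum_smul_index (by simp), superNormSq, Finsupp.sum, Finsupp.sum,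
    Finset.mul_sum]
  exact Finset.sum_congr rfl fun c _ => by rw [norm_mul, mul_pow]

/-- The squared norm of a part of a superposition that is given as a sum over a finite family. -/
theorem superNormSq_filter_sum {ι : Type} [Fintype ι] [DecidableEq (QCfg Q Γ)]
    (p : QCfg Q Γ → Prop) [DecidablePred p] (c : ι → QCfg Q Γ) (a : ι → ℂ) :
    (superNormSq ((∑ i, Finsupp.single (c i) (a i)).filter p) : ℂ) =
      ∑ i, ∑ j, if c i = c j ∧ p (c i) then a i * starRingEnd ℂ (a j) else 0 := by
  set ψ := ∑ i, Finsupp.single (c i) (a i) with hψ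
  have hval : ∀ d, ψ d = ∑ i, if c i = d then a i else 0 := by
    intro d
    rw [hψ, Finsupp.finsetSum_apply]
    exact Finset.sum_congr rfl fun i _ => Finsupp.single_apply
  have hsupp : ψ.support ⊆ Finset.univ.image c := by
    intro d hd
    by_contra h
    rw [Finsupp.mem_support_iff, hval] at hd
    refine hd (Finset.sum_eq_zero fun i _ => if_neg fun hi => h ?_)
    exact Finset.mem_image.mpr ⟨i, Finset.mem_univ _, hi⟩
  -- The `c i` may repeat and their coefficients may cancel, so the support can be smaller than the
  -- image of `c`; the additional terms vanish.
  rw [superNormSq_filter, Finset.sum_subset hsupp fun d _ hd => by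
    rw [Finsupp.notMem_support_iff.mp hd]; simp]
  rw [Complex.ofReal_sum]
  have hterm : ∀ d, (((if p d then ‖ψ d‖ ^ 2 else 0 : ℝ)) : ℂ) =
      ∑ i, ∑ j, if c i = d then if c j = d then if p d then a i * starRingEnd ℂ (a j) else 0
        else 0 else 0 := by
    intro d
    by_cases hp : p d
    · simp only [hp, if_true]
      rw [Complex.ofReal_pow, ← Complex.mul_conj', hval, map_sum, Finset.sum_mul_sum]
      refine Finset.sum_congr rfl fun i _ => Finset.sum_congr rfl fun j _ => ?_
      split_ifs <;> simp
    · simp [hp]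
  simp only [hterm]
  rw [Finset.sum_comm]
  refine Finset.sum_congr rfl fun i _ => ?_
  rw [Finset.sum_comm]
  refine Finset.sum_congr rfl fun j _ => ?_
  rw [Finset.sum_ite_eq, if_pos (Finset.mem_image_of_mem _ (Finset.mem_univ _))]
  by_cases h : c i = c j
  · simp [h]
  · simp [h, Ne.symm h]

end

/-! ### Halting probabilities without renormalization -/

namespace QuantumTM

variable {Q Γ R : Type} (M : QuantumTM Q Γ R)

open Classical in
theorem project_smul (r : R) (a : ℂ) (ψ : QCfg Q Γ →₀ ℂ) :
    M.project r (a • ψ) = a • M.project r ψ := Finsupp.filter_smul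

variable [Fintype Q] [Fintype Γ]

theorem evolve_add (ψ φ : QCfg Q Γ →₀ ℂ) : M.evolve (ψ + φ) = M.evolve ψ + M.evolve φ :=
  Finsupp.sum_add_index' (by simp) fun c a b => by
    simp [add_mul, Finset.sum_add_distrib]

theorem evolve_zero : M.evolve 0 = 0 := Finsupp.sum_zero_index

theorem evolve_single (c : QCfg Q Γ) (a : ℂ) : M.evolve (Finsupp.single c a) =
    ∑ m : Q × Γ × SignType, Finsupp.single (c.move m) (a * M.amplitude c.state c.scanned m) :=
  Finsupp.sum_single_index (by simp)

theorem evolve_smul (a : ℂ) (ψ : QCfg Q Γ →₀ ℂ) : M.evolve (a • ψ) = a • M.evolve ψ := by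
  rw [evolve, Finsupp.sum_smul_index (by simp), evolve, Finsupp.smul_sum]
  refine Finsupp.sum_congr fun c _ => ?_
  rw [Finset.smul_sum]
  exact Finset.sum_congr rfl fun m _ => by rw [Finsupp.smul_single, smul_eq_mul, mul_assoc]

variable [Fintype R]

open Classical in
/-- The probability that the machine halts after at most `n` steps in a configuration satisfying
`F`, computed without renormalization. -/
noncomputable def haltWeight (F : QCfg Q Γ → Prop) : ℕ → (QCfg Q Γ →₀ ℂ) → ℝ
  | 0, ψ => superNormSq (ψ.filter fun c => M.IsFinal c ∧ F c)
  | n + 1, ψ => superNormSq (ψ.filter fun c => M.IsFinal c ∧ F c) +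
      ∑ r : R, haltWeight F n (M.evolve (M.project r ψ))

/-- Squared norms are quadratic and all other operations are linear. -/
theorem haltWeight_smul (F : QCfg Q Γ → Prop) (n : ℕ) (a : ℂ) (ψ : QCfg Q Γ →₀ ℂ) :
    M.haltWeight F n (a • ψ) = ‖a‖ ^ 2 * M.haltWeight F n ψ := by
  classical
  induction n generalizing ψ with
  | zero => rw [haltWeight, haltWeight, Finsupp.filter_smul, superNormSq_smul]
  | succ n ih =>
    rw [haltWeight, haltWeight, Finsupp.filter_smul, superNormSq_smul, mul_add, Finset.mul_sum]
    congr 1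
    exact Finset.sum_congr rfl fun r _ => by rw [project_smul, evolve_smul, ih]

/-- The renormalizing factor enters by its square, the inverse of the probability of the result, and
cancels it. If this probability is zero, the projection vanishes, and so do both sides. -/
theorem haltProbWith_eq_haltWeight (F : QCfg Q Γ → Prop) (n : ℕ) (ψ : QCfg Q Γ →₀ ℂ) :
    M.haltProbWith F n ψ = M.haltWeight F n ψ := by
  induction n generalizing ψ with
  | zero => rfl
  | succ n ih =>
    rw [haltProbWith, haltWeight]
    congr 1
    refine Finset.sum_congr rfl fun r _ => ?_
    rw [ih, collapse, evolve_smul, haltWeight_smul, ← mul_assoc]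
    have h0 := superNormSq_nonneg (M.project r ψ)
    have hn : ‖(((Real.sqrt (superNormSq (M.project r ψ)))⁻¹ : ℝ) : ℂ)‖ ^ 2 =
        (superNormSq (M.project r ψ))⁻¹ := by
      rw [Complex.norm_real, Real.norm_eq_abs, sq_abs, inv_pow, Real.sq_sqrt h0]
    rw [hn]
    rcases h0.eq_or_lt with h | h
    · have hz : M.project r ψ = 0 := by
        ext c
        by_contra hc
        have : 0 < superNormSq (M.project r ψ) :=
          Finset.sum_pos' (fun _ _ => by positivity)
            ⟨c, Finsupp.mem_support_iff.mpr hc, by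
              have := norm_pos_iff.mpr hc
              positivity⟩
        exact this.ne h
      have h1 := M.haltWeight_smul F n 0 0
      rw [norm_zero, zero_smul] at h1
      rw [hz, evolve_zero, h1]
      simp
    · rw [mul_inv_cancel₀ h.ne', one_mul]

theorem haltWeight_nonneg (F : QCfg Q Γ → Prop) (n : ℕ) (ψ : QCfg Q Γ →₀ ℂ) :
    0 ≤ M.haltWeight F n ψ := by
  induction n generalizing ψ with
  | zero => exact superNormSq_nonneg _
  | succ n ih => exact add_nonneg (superNormSq_nonneg _) (Finset.sum_nonneg fun r _ => ih _)

theorem haltWeight_mono (F : QCfg Q Γ → Prop) (ψ : QCfg Q Γ →₀ ℂ) :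
    Monotone fun n => M.haltWeight F n ψ := by
  refine monotone_nat_of_le_succ fun n => ?_
  induction n generalizing ψ with
  | zero => exact le_add_of_nonneg_right (Finset.sum_nonneg fun r _ => M.haltWeight_nonneg F _ _)
  | succ n ih => exact add_le_add le_rfl (Finset.sum_le_sum fun r _ => ih _)

theorem haltWeight_add_compl (F : QCfg Q Γ → Prop) (n : ℕ) (ψ : QCfg Q Γ →₀ ℂ) :
    M.haltWeight F n ψ + M.haltWeight (fun c => ¬ F c) n ψ =
      M.haltWeight (fun _ => True) n ψ := by
  have h : ∀ ψ : QCfg Q Γ →₀ ℂ, M.haltWeight F 0 ψ + M.haltWeight (fun c => ¬ F c) 0 ψ =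
      M.haltWeight (fun _ => True) 0 ψ := by
    intro ψ
    simp only [haltWeight, superNormSq_filter, ← Finset.sum_add_distrib]
    refine Finset.sum_congr rfl fun c _ => ?_
    by_cases h₁ : M.IsFinal c <;> by_cases h₂ : F c <;> simp [h₁, h₂]
  induction n generalizing ψ with
  | zero => exact h ψ
  | succ n ih =>
    have h' := h ψ
    simp only [haltWeight] at h' ⊢
    rw [← h', ← Finset.sum_congr rfl fun r _ => ih (M.evolve (M.project r ψ)),
      Finset.sum_add_distrib]
    ring

/-- The squared norm is the sum of those of the final part and of the projections, because these
have disjoint supports. The projections are non-final, so the evolution preserves their norms. -/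
theorem haltWeight_le (hwf : M.WellFormed) (n : ℕ) (ψ : QCfg Q Γ →₀ ℂ) :
    M.haltWeight (fun _ => True) n ψ ≤ superNormSq ψ := by
  classical
  have hψ : superNormSq ψ = ∑ c ∈ ψ.support, ‖ψ c‖ ^ 2 := rfl
  induction n generalizing ψ with
  | zero =>
    rw [haltWeight, superNormSq_filter, superNormSq]
    refine Finset.sum_le_sum fun c _ => ?_
    split_ifs
    · exact le_rfl
    · positivity
  | succ n ih =>
    rw [haltWeight]
    have h₁ : ∀ r, M.haltWeight (fun _ => True) n (M.evolve (M.project r ψ)) ≤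
        superNormSq (M.project r ψ) := by
      intro r
      refine (ih _ rfl).trans (hwf _ fun c hc => ?_).le
      rw [project, Finsupp.support_filter, Finset.mem_filter] at hc
      exact hc.2.1
    refine (add_le_add le_rfl (Finset.sum_le_sum fun r _ => h₁ r)).trans ?_
    simp only [project, superNormSq_filter]
    rw [Finset.sum_comm, ← Finset.sum_add_distrib, hψ]
    refine Finset.sum_le_sum fun c _ => ?_
    by_cases h : M.IsFinal c <;> simp [h]

/-- The weights for `F` and for its complement are nondecreasing in the number of steps. Their sum
is at most 1 and equals 1 at `T`, so neither can grow after that. -/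
theorem haltWeight_le_of_halts (hwf : M.WellFormed) {T : ℕ} {ψ : QCfg Q Γ →₀ ℂ}
    (hψ : superNormSq ψ = 1) (hT : M.haltWeight (fun _ => True) T ψ = 1) (F : QCfg Q Γ → Prop)
    (n : ℕ) : M.haltWeight F n ψ ≤ M.haltWeight F T ψ := by
  rcases le_total n T with h | h
  · exact M.haltWeight_mono F ψ h
  · have h₁ := M.haltWeight_add_compl F n ψ
    have h₂ := M.haltWeight_add_compl F T ψ
    have h₃ := M.haltWeight_le hwf n ψ
    have h₄ := M.haltWeight_mono (fun c => ¬ F c) ψ h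
    simp only at h₄
    linarith

theorem acceptanceProbability_eq_haltWeight (hwf : M.WellFormed) {t : Polynomial ℕ}
    (ht : M.HaltsInTime t) (x : List Bool) : M.acceptanceProbability x =
      M.haltWeight M.IsAccepting (t.eval x.length) (Finsupp.single (M.init x) 1) := by
  have hψ : superNormSq (Finsupp.single (M.init x) (1 : ℂ)) = 1 := by simp [superNormSq]
  have hT := ht x
  rw [haltProbWith_eq_haltWeight] at hT
  have h := M.haltWeight_le_of_halts hwf hψ hT M.IsAccepting
  rw [acceptanceProbability]
  simp only [haltProbWith_eq_haltWeight]
  exact le_antisymm (ciSup_le h) (le_ciSup (f := fun n => M.haltWeight M.IsAccepting n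
    (Finsupp.single (M.init x) 1)) ⟨_, Set.forall_mem_range.mpr h⟩ _)

end QuantumTM

/-! ### The expansion into paths -/

theorem QPath.sum_succ {Q Γ : Type} [Fintype Q] [Fintype Γ] {n : ℕ} {A : Type} [AddCommMonoid A]
    (f : List (Q × Γ × SignType) → A) : ∑ P : QPath Q Γ (n + 1), f P.moves =
      f [] + ∑ m : Q × Γ × SignType, ∑ P : QPath Q Γ n, f (m :: P.moves) := by
  have h : ∀ k : ℕ, ∑ v : Fin (k + 1) → Q × Γ × SignType, f (List.ofFn v) =
      ∑ m : Q × Γ × SignType, ∑ v : Fin k → Q × Γ × SignType, f (m :: List.ofFn v) := by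
    intro k
    rw [← Equiv.sum_comp (Fin.consEquiv fun _ : Fin (k + 1) => Q × Γ × SignType),
      Fintype.sum_prod_type]
    refine Finset.sum_congr rfl fun m _ => Finset.sum_congr rfl fun v _ => ?_
    simp [Fin.consEquiv, List.ofFn_succ]
  rw [Fintype.sum_sigma, Fin.sum_univ_succ]
  congr 1
  · change ∑ v : Fin 0 → Q × Γ × SignType, f (List.ofFn v) = _
    simp
  · rw [Finset.sum_comm, Fintype.sum_sigma]
    refine Finset.sum_congr rfl fun k _ => ?_
    rw [Finset.sum_comm]
    exact h k

namespace QuantumTM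

variable {Q Γ R : Type} (M : QuantumTM Q Γ R)

open Classical in
/-- The contribution of a pair of paths from `c` and `d`. -/
noncomputable def pairTerm (F : QCfg Q Γ → Prop) (c d : QCfg Q Γ)
    (l l' : List (Q × Γ × SignType)) : ℂ :=
  if M.RunsUntilEnd c l ∧ M.RunsUntilEnd d l' ∧ endCfg c l = endCfg d l' ∧
      (M.IsFinal (endCfg c l) ∧ F (endCfg c l)) ∧ M.pathOutcomes c l = M.pathOutcomes d l' then
    M.pathAmplitude c l * starRingEnd ℂ (M.pathAmplitude d l')
  else 0

-- Two different initial configurations are admitted because the paths of a pair are in general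
-- separated by their first moves. This factorization is what the induction on the number of steps
-- uses.
open Classical in
theorem pairTerm_cons (F : QCfg Q Γ → Prop) (c d : QCfg Q Γ) (m m' : Q × Γ × SignType)
    (l l' : List (Q × Γ × SignType)) : M.pairTerm F c d (m :: l) (m' :: l') =
      if (¬ M.IsFinal c ∧ ¬ M.IsFinal d) ∧
          M.outcome c.state c.scanned = M.outcome d.state d.scanned then
        M.amplitude c.state c.scanned m * starRingEnd ℂ (M.amplitude d.state d.scanned m') *
          M.pairTerm F (c.move m) (d.move m') l l'
      else 0 := by
  have e : ∀ (c : QCfg Q Γ) (m : Q × Γ × SignType) (l : List (Q × Γ × SignType)),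
      endCfg c (m :: l) = endCfg (c.move m) l := fun _ _ _ => rfl
  simp only [pairTerm, RunsUntilEnd, pathOutcomes, pathAmplitude, e, List.cons.injEq, map_mul]
  by_cases h₁ : M.IsFinal c
  · simp [h₁]
  by_cases h₂ : M.IsFinal d
  · simp [h₂]
  by_cases h₃ : M.outcome c.state c.scanned = M.outcome d.state d.scanned
  · simp only [h₁, h₂, h₃, not_false_eq_true, true_and, and_self, if_true]
    split_ifs
    · ring
    · ring
  · simp [h₃]

/-- Paths of different lengths have different numbers of results. -/
theorem pairTerm_nil_cons (F : QCfg Q Γ → Prop) (c d : QCfg Q Γ) (m : Q × Γ × SignType)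
    (l : List (Q × Γ × SignType)) : M.pairTerm F c d [] (m :: l) = 0 :=
  if_neg fun h => by simpa [pathOutcomes] using h.2.2.2.2

theorem pairTerm_cons_nil (F : QCfg Q Γ → Prop) (c d : QCfg Q Γ) (m : Q × Γ × SignType)
    (l : List (Q × Γ × SignType)) : M.pairTerm F c d (m :: l) [] = 0 :=
  if_neg fun h => by simpa [pathOutcomes] using h.2.2.2.2

open Classical in
theorem pairTerm_nil (F : QCfg Q Γ → Prop) (c d : QCfg Q Γ) : M.pairTerm F c d [] [] =
    if c = d ∧ (M.IsFinal c ∧ F c) then 1 else 0 := by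
  simp [pairTerm, RunsUntilEnd, pathOutcomes, pathAmplitude, endCfg]

theorem re_pairTerm (x : List Bool) (l l' : List (Q × Γ × SignType)) :
    (M.pairTerm M.IsAccepting (M.init x) (M.init x) l l').re = M.pairWeight x l l' := by
  have : (M.RunsUntilEnd (M.init x) l ∧ M.RunsUntilEnd (M.init x) l' ∧
      endCfg (M.init x) l = endCfg (M.init x) l' ∧
      (M.IsFinal (endCfg (M.init x) l) ∧ M.IsAccepting (endCfg (M.init x) l)) ∧
      M.pathOutcomes (M.init x) l = M.pathOutcomes (M.init x) l') ↔
      M.Compatible (M.init x) l l' := by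
    constructor
    · rintro ⟨h₁, h₂, h₃, ⟨-, h₄⟩, h₅⟩
      exact ⟨⟨h₁, h₄⟩, ⟨h₂, h₃ ▸ h₄⟩, h₃, h₅⟩
    · rintro ⟨⟨h₁, h₄⟩, ⟨h₂, -⟩, h₃, h₅⟩
      exact ⟨h₁, h₂, h₃, ⟨h₄.1, h₄⟩, h₅⟩
  rw [pairTerm, pairWeight]
  by_cases h : M.Compatible (M.init x) l l'
  · rw [if_pos h, if_pos (this.mpr h)]
  · rw [if_neg h, if_neg fun h' => h (this.mp h'), Complex.zero_re]

variable [Fintype Q] [Fintype Γ]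

/-- The contribution of all pairs of paths of at most `n` moves from `c` and `d`. -/
noncomputable def pairSum (F : QCfg Q Γ → Prop) (n : ℕ) (c d : QCfg Q Γ) : ℂ :=
  ∑ P₁ : QPath Q Γ n, ∑ P₂ : QPath Q Γ n, M.pairTerm F c d P₁.moves P₂.moves

open Classical in
theorem pairSum_zero (F : QCfg Q Γ → Prop) (c d : QCfg Q Γ) : M.pairSum F 0 c d =
    if c = d ∧ (M.IsFinal c ∧ F c) then 1 else 0 := by
  have h : ∀ f : List (Q × Γ × SignType) → ℂ, ∑ P : QPath Q Γ 0, f P.moves = f [] := by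
    intro f
    rw [Fintype.sum_sigma, Fin.sum_univ_one]
    simp [QPath.moves]
  rw [pairSum, h fun l => ∑ P₂ : QPath Q Γ 0, M.pairTerm F c d l P₂.moves,
    h (M.pairTerm F c d []), pairTerm_nil]

-- The recursion mirrors that of `haltWeight`: either both paths end at once, or both go on after
-- the same result of measurement.
open Classical in
theorem pairSum_succ (F : QCfg Q Γ → Prop) (n : ℕ) (c d : QCfg Q Γ) : M.pairSum F (n + 1) c d =
    (if c = d ∧ (M.IsFinal c ∧ F c) then 1 else 0) +
      if (¬ M.IsFinal c ∧ ¬ M.IsFinal d) ∧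
          M.outcome c.state c.scanned = M.outcome d.state d.scanned then
        ∑ m : Q × Γ × SignType, ∑ m' : Q × Γ × SignType,
          M.amplitude c.state c.scanned m * starRingEnd ℂ (M.amplitude d.state d.scanned m') *
            M.pairSum F n (c.move m) (d.move m')
      else 0 := by
  rw [pairSum, QPath.sum_succ fun l => ∑ P₂ : QPath Q Γ (n + 1), M.pairTerm F c d l P₂.moves,
    QPath.sum_succ (M.pairTerm F c d []), pairTerm_nil]
  simp only [pairTerm_nil_cons, Finset.sum_const_zero, add_zero]
  congr 1
  have h : ∀ l : List (Q × Γ × SignType), ∀ m, ∑ P₂ : QPath Q Γ (n + 1),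
      M.pairTerm F c d (m :: l) P₂.moves =
      ∑ m' : Q × Γ × SignType, ∑ P₂ : QPath Q Γ n, M.pairTerm F c d (m :: l) (m' :: P₂.moves) := by
    intro l m
    rw [QPath.sum_succ (M.pairTerm F c d (m :: l)), pairTerm_cons_nil, zero_add]
  simp only [h, pairTerm_cons]
  split_ifs
  · refine Finset.sum_congr rfl fun m _ => ?_
    rw [Finset.sum_comm]
    refine Finset.sum_congr rfl fun m' _ => ?_
    rw [pairSum, Finset.mul_sum]
    exact Finset.sum_congr rfl fun P _ => by rw [Finset.mul_sum]
  · simp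

variable [Fintype R]

/-- Induction on `n` for all finite families of configurations with coefficients. A step replaces
the index set `ι` by its product with the moves. Repetitions in the family must be allowed: they are
the different paths to one configuration, and they produce the interference terms. -/
theorem haltWeight_sum (F : QCfg Q Γ → Prop) (n : ℕ) {ι : Type} [Fintype ι] (c : ι → QCfg Q Γ)
    (a : ι → ℂ) : (M.haltWeight F n (∑ i, Finsupp.single (c i) (a i)) : ℂ) =
      ∑ i, ∑ j, a i * starRingEnd ℂ (a j) * M.pairSum F n (c i) (c j) := by
  classical
  induction n generalizing ι with
  | zero =>
    rw [haltWeight, superNormSq_filter_sum]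
    refine Finset.sum_congr rfl fun i _ => Finset.sum_congr rfl fun j _ => ?_
    rw [pairSum_zero, mul_ite, mul_one, mul_zero]
  | succ n ih =>
    have hstep : ∀ r : R, M.evolve (M.project r (∑ i, Finsupp.single (c i) (a i))) =
        ∑ p : ι × (Q × Γ × SignType), Finsupp.single ((c p.1).move p.2)
          ((if ¬ M.IsFinal (c p.1) ∧ M.outcome (c p.1).state (c p.1).scanned = r then a p.1
            else 0) * M.amplitude (c p.1).state (c p.1).scanned p.2) := by
      intro r
      have h₁ : M.project r (∑ i, Finsupp.single (c i) (a i)) = ∑ i, Finsupp.single (c i)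
          (if ¬ M.IsFinal (c i) ∧ M.outcome (c i).state (c i).scanned = r then a i else 0) := by
        rw [project, Finsupp.filter_sum]
        refine Finset.sum_congr rfl fun i _ => ?_
        split_ifs with h
        · exact Finsupp.filter_single_of_pos _ h
        · exact (Finsupp.filter_single_of_neg
            (fun c => ¬ M.IsFinal c ∧ M.outcome c.state c.scanned = r) h).trans
            (Finsupp.single_zero (c i)).symm
      have h₂ : ∀ (s : Finset ι) (b : ι → ℂ), M.evolve (∑ i ∈ s, Finsupp.single (c i) (b i)) =
          ∑ i ∈ s, M.evolve (Finsupp.single (c i) (b i)) := by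
        intro s b
        induction s using Finset.induction_on with
        | empty => simp [evolve_zero]
        | insert i s hi ihs => rw [Finset.sum_insert hi, Finset.sum_insert hi, evolve_add, ihs]
      rw [h₁, h₂, Fintype.sum_prod_type]
      exact Finset.sum_congr rfl fun i _ => M.evolve_single _ _
    set b : R → ι → ℂ := fun r i =>
      if ¬ M.IsFinal (c i) ∧ M.outcome (c i).state (c i).scanned = r then a i else 0 with hb
    set K : ι → ι → ℂ := fun i j => ∑ m : Q × Γ × SignType, ∑ m' : Q × Γ × SignType,
      M.amplitude (c i).state (c i).scanned m *
        starRingEnd ℂ (M.amplitude (c j).state (c j).scanned m') *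
          M.pairSum F n ((c i).move m) ((c j).move m') with hK
    have hr : ∀ r : R, (M.haltWeight F n (M.evolve (M.project r
        (∑ i, Finsupp.single (c i) (a i)))) : ℂ) =
        ∑ i, ∑ j, b r i * starRingEnd ℂ (b r j) * K i j := by
      intro r
      rw [hstep, ih, Fintype.sum_prod_type]
      refine Finset.sum_congr rfl fun i _ => ?_
      rw [Finset.sum_congr rfl fun m _ => Fintype.sum_prod_type _, Finset.sum_comm]
      refine Finset.sum_congr rfl fun j _ => ?_
      rw [hK, Finset.mul_sum]
      refine Finset.sum_congr rfl fun m _ => ?_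
      rw [Finset.mul_sum]
      refine Finset.sum_congr rfl fun m' _ => ?_
      rw [map_mul]
      ring
    -- For given `i` and `j`, only the common outcome of the two configurations contributes to the
    -- sum over `r`. So measuring removes exactly the pairs with different outcomes.
    have hbb : ∀ i j, ∑ r, b r i * starRingEnd ℂ (b r j) =
        if (¬ M.IsFinal (c i) ∧ ¬ M.IsFinal (c j)) ∧
          M.outcome (c i).state (c i).scanned = M.outcome (c j).state (c j).scanned
        then a i * starRingEnd ℂ (a j) else 0 := by
      intro i j
      rw [Finset.sum_eq_single (M.outcome (c i).state (c i).scanned)]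
      · by_cases h₁ : M.IsFinal (c i)
        · simp [hb, h₁]
        by_cases h₂ : M.IsFinal (c j)
        · simp [hb, h₂]
        by_cases h₃ : M.outcome (c i).state (c i).scanned = M.outcome (c j).state (c j).scanned
        · simp [hb, h₁, h₂, h₃]
        · simp [hb, h₃, Ne.symm h₃]
      · intro r _ hr'
        simp [hb, Ne.symm hr']
      · simp
    have hcomm : ∑ r, ∑ i, ∑ j, b r i * starRingEnd ℂ (b r j) * K i j =
        ∑ i, ∑ j, ∑ r, b r i * starRingEnd ℂ (b r j) * K i j := by
      rw [Finset.sum_comm]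
      exact Finset.sum_congr rfl fun i _ => Finset.sum_comm
    rw [haltWeight, Complex.ofReal_add, superNormSq_filter_sum, Complex.ofReal_sum,
      Finset.sum_congr rfl fun r _ => hr r, hcomm, ← Finset.sum_add_distrib]
    refine Finset.sum_congr rfl fun i _ => ?_
    rw [← Finset.sum_add_distrib]
    refine Finset.sum_congr rfl fun j _ => ?_
    rw [← Finset.sum_mul, hbb, pairSum_succ, mul_add, mul_ite, mul_one, mul_zero, ite_mul, zero_mul,
      mul_ite, mul_zero]

/-- The initial superposition is a family with one member and coefficient 1. The terms of the double
sum are complex, but the total is a real number, so they may be replaced by their real parts. -/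
theorem acceptanceProbability_eq_sum (hwf : M.WellFormed) {t : Polynomial ℕ}
    (ht : M.HaltsInTime t) (x : List Bool) : M.acceptanceProbability x =
      ∑ P₁ : QPath Q Γ (t.eval x.length), ∑ P₂ : QPath Q Γ (t.eval x.length),
        M.pairWeight x P₁.moves P₂.moves := by
  have h := M.haltWeight_sum M.IsAccepting (t.eval x.length) (fun _ : Unit => M.init x) fun _ => 1
  simp only [Finset.univ_unique, Finset.sum_singleton, map_one, one_mul] at h
  rw [M.acceptanceProbability_eq_haltWeight hwf ht, ← Complex.ofReal_re (M.haltWeight _ _ _), h,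
    pairSum, Complex.re_sum]
  refine Finset.sum_congr rfl fun P₁ _ => ?_
  rw [Complex.re_sum]
  exact Finset.sum_congr rfl fun P₂ _ => M.re_pairTerm x _ _

end QuantumTM

/-! ## Codes of pairs of paths -/

theorem moveWord_injective {k : ℕ} : Function.Injective (moveWord (k := k)) := by
  intro i j h
  have := congrArg (List.count true) h
  simp only [moveWord, List.count_append, List.count_replicate_self] at this
  simpa [List.count_replicate, Fin.ext_iff] using this

namespace QPath

variable {Q Γ : Type} {T k : ℕ} (e : Fin k ≃ Q × Γ × SignType)

theorem length_moves (P : QPath Q Γ T) : P.moves.length = P.1 := by simp [moves]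

theorem toBits_eq_pathWord (P : QPath Q Γ T) :
    P.toBits k (fun m => moveWord (e.symm m)) = pathWord T (P.moves.map e.symm) := by
  rw [toBits, pathWord, List.length_map, length_moves, List.flatMap_map]

theorem exists_moves_eq {l : List (Fin k)} (hl : l.length ≤ T) :
    ∃ P : QPath Q Γ T, P.moves.map e.symm = l := by
  refine ⟨⟨⟨l.length, by omega⟩, fun i => e (l.get i)⟩, ?_⟩
  simp [moves, Function.comp_def]

theorem moves_injective : Function.Injective (moves (Q := Q) (Γ := Γ) (T := T)) := by
  rintro ⟨⟨n, hn⟩, f⟩ ⟨⟨n', hn'⟩, f'⟩ h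
  have hl := congrArg List.length h
  simp only [length_moves] at hl
  subst hl
  rw [List.ofFn_injective (show List.ofFn f = List.ofFn f' from h)]

end QPath

namespace QuantumTM

variable {Q Γ R : Type} (M : QuantumTM Q Γ R) {k : ℕ} (e : Fin k ≃ Q × Γ × SignType)
  (t : Polynomial ℕ)

theorem decodePair_toBits {T : ℕ} (P₁ P₂ : QPath Q Γ T) :
    decodePair k T (P₁.toBits k (fun m => moveWord (e.symm m)) ++
      P₂.toBits k fun m => moveWord (e.symm m)) =
        some (P₁.moves.map e.symm, P₂.moves.map e.symm) := by
  have h : ∀ P : QPath Q Γ T, (P.moves.map e.symm).length ≤ T := fun P => by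
    rw [List.length_map, P.length_moves]; omega
  exact decodePair_eq_some.mpr ⟨h P₁, h P₂, by rw [P₁.toBits_eq_pathWord, P₂.toBits_eq_pathWord]⟩

theorem bitWeight_toBits (x : List Bool) (P₁ P₂ : QPath Q Γ (t.eval x.length)) :
    M.bitWeight e t x (P₁.toBits k (fun m => moveWord (e.symm m)) ++
      P₂.toBits k fun m => moveWord (e.symm m)) = M.pairWeight x P₁.moves P₂.moves := by
  rw [bitWeight, decodePair_toBits]
  simp

theorem bitWeight_eq_zero (x u : List Bool) (h : ∀ P₁ P₂ : QPath Q Γ (t.eval x.length),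
    u ≠ P₁.toBits k (fun m => moveWord (e.symm m)) ++
      P₂.toBits k fun m => moveWord (e.symm m)) : M.bitWeight e t x u = 0 := by
  rw [bitWeight]
  cases hd : decodePair k (t.eval x.length) u with
  | none => rfl
  | some p =>
    obtain ⟨h₁, h₂, hu⟩ := decodePair_eq_some.mp hd
    obtain ⟨P₁, hP₁⟩ := QPath.exists_moves_eq e h₁
    obtain ⟨P₂, hP₂⟩ := QPath.exists_moves_eq e h₂
    refine absurd ?_ (h P₁ P₂)
    rw [P₁.toBits_eq_pathWord, P₂.toBits_eq_pathWord, hP₁, hP₂, hu]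

/-- Encoding pairs of paths is injective, since it can be undone by decoding, and the weight
vanishes outside of its image. -/
theorem sum_bitWeight [Fintype Q] [Fintype Γ] (x : List Bool) {N : ℕ}
    (hN : N = 2 * ((k + 1) * t.eval x.length)) :
    ∑ u : Fin N → Bool, M.bitWeight e t x (List.ofFn u) =
      ∑ P₁ : QPath Q Γ (t.eval x.length), ∑ P₂ : QPath Q Γ (t.eval x.length),
        M.pairWeight x P₁.moves P₂.moves := by
  let bits : QPath Q Γ (t.eval x.length) × QPath Q Γ (t.eval x.length) → List Bool := fun P =>
    P.1.toBits k (fun m => moveWord (e.symm m)) ++ P.2.toBits k fun m => moveWord (e.symm m)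
  have hlen : ∀ P, (bits P).length = N := by
    intro P
    have h : ∀ P : QPath Q Γ (t.eval x.length),
        (P.toBits k fun m => moveWord (e.symm m)).length = (k + 1) * t.eval x.length := by
      intro P
      rw [P.toBits_eq_pathWord, length_pathWord]
      rw [List.length_map, P.length_moves]; omega
    rw [List.length_append, h, h, hN, two_mul]
  let g : QPath Q Γ (t.eval x.length) × QPath Q Γ (t.eval x.length) → Fin N → Bool :=
    fun P i => (bits P)[i]'(by rw [hlen]; exact i.2)
  have hg : ∀ P, List.ofFn (g P) = bits P := fun P =>
    List.ext_getElem (by rw [List.length_ofFn, hlen]) fun i _ _ => by simp [g]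
  have hinj : Function.Injective g := by
    intro P P' h
    have h₁ : bits P = bits P' := by rw [← hg, ← hg, h]
    have h₂ := (decodePair_toBits e P.1 P.2).symm.trans
      ((congrArg _ h₁).trans (decodePair_toBits e P'.1 P'.2))
    simp only [Option.some.injEq, Prod.mk.injEq] at h₂
    have hm := (List.map_injective_iff.mpr e.symm.injective)
    exact Prod.ext (QPath.moves_injective (hm h₂.1)) (QPath.moves_injective (hm h₂.2))
  rw [← Fintype.sum_prod_type']
  symm
  refine Fintype.sum_of_injective g hinj _ _ (fun u hu => ?_) fun P => ?_
  · refine M.bitWeight_eq_zero e t x _ fun P₁ P₂ h => hu ⟨(P₁, P₂), ?_⟩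
    exact List.ofFn_injective ((hg _).trans h.symm)
  · rw [hg]
    exact (M.bitWeight_toBits e t x P.1 P.2).symm

end QuantumTM

theorem mainTheorem9 {Q Γ R : Type} [Fintype Q] [Fintype Γ] [Fintype R]
    (M : QuantumTM Q Γ R) (hwf : M.WellFormed) (hamp : M.HasEfficientAmplitudes)
    (t : Polynomial ℕ) (ht : M.HaltsInTime t) :
    M.acceptanceProbability ∈ SharpP Set.univ ∧
    (∀ x : List Bool, M.acceptanceProbability x =
      ∑ P₁ : QPath Q Γ (t.eval x.length), ∑ P₂ : QPath Q Γ (t.eval x.length),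
        M.pairWeight x P₁.moves P₂.moves) ∧
    ∃ (p : Polynomial ℕ) (w : List Bool → List Bool → ℝ)
      (k : ℕ) (code : Q × Γ × SignType → List Bool),
      IsWeightedCountingProblem Set.univ p w M.acceptanceProbability ∧
      Function.Injective code ∧ (∀ m, (code m).length = k) ∧
      (∀ n : ℕ, p.eval n = 2 * ((k + 1) * t.eval n)) ∧
      (∀ (x : List Bool) (P₁ P₂ : QPath Q Γ (t.eval x.length)),
        w x (P₁.toBits k code ++ P₂.toBits k code) = M.pairWeight x P₁.moves P₂.moves) ∧
      (∀ x u : List Bool, u.length = p.eval x.length →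
        (∀ P₁ P₂ : QPath Q Γ (t.eval x.length), u ≠ P₁.toBits k code ++ P₂.toBits k code) →
        w x u = 0) := by
  have hsum := M.acceptanceProbability_eq_sum hwf ht
  -- The code words of the moves are unary numbers padded to a common length, so this length is the
  -- number of moves.
  let k := Fintype.card (Q × Γ × SignType)
  let e : Fin k ≃ Q × Γ × SignType := (Fintype.equivFin _).symm
  let p : Polynomial ℕ := 2 * (((k + 1 : ℕ) : Polynomial ℕ) * t)
  have hp : ∀ n, p.eval n = 2 * ((k + 1) * t.eval n) := fun n => by simp [p]
  have hw : IsWeightedCountingProblem Set.univ p (M.bitWeight e t) M.acceptanceProbability :=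
    ⟨M.efficientlyApproximable_bitWeight e hwf hamp t, fun _ _ => Set.mem_univ _, fun x => by
      rw [hsum, M.sum_bitWeight e t x (hp _)]⟩
  exact ⟨⟨p, _, hw⟩, hsum, p, M.bitWeight e t, k, fun m => moveWord (e.symm m), hw,
    moveWord_injective.comp e.symm.injective, fun m => length_moveWord _, hp,
    M.bitWeight_toBits e t, fun x u _ h => M.bitWeight_eq_zero e t x u h⟩
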